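/- Let $\mathbb{K}$ be an algebraically closed field of characteristic zero and let $X$ be an affine toric variety over $\mathbb{K}$, not necessarily normal: an irreducible affine variety with an effective regular action of a torus $T=(\mathbb{K}^\times)^n$ that has an open orbit. Let $M=\mathbb{Z}^n$ be the character lattice of $T$, $N=\mathrm{Hom}(M,\mathbb{Z})$, let $A=\mathbb{K}[X]$, let $A_m$ $(m\in M)$ be the space of functions $f\in A$ with $f(t\cdot x)=\chi^m(t)f(x)$, and let $P=\{m\in M : A_m\neq 0\}$ be the weight monoid. Let $\sigma^\vee\subseteq M_{\mathbb{Q}}$ be the cone spanned by $P$ and $\sigma\subseteq N_{\mathbb{Q}}$ its dual cone; for a ray $\rho$ of $\sigma$ let $p_\rho\in N$ be its primitive vector. A Demazure root is an element $e\in M$ such that $\langle e,p_\rho\rangle=-1$ for one ray $\rho$ of $\sigma$ and $\langle e,p_{\rho'}\rangle\ge 0$ for all other rays $\rho'$; it is admissible if $(e+P)\cap\sigma^\vee\subseteq P$. For a face $\tau$ of $\sigma^\vee$, a $\tau$-root is a Demazure root $e$ such that, among the rays of $\sigma$ normal to $\tau$, one ray $\rho$ has $\langle e,p_\rho\rangle=-1$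 and all others have $\langle e,p_{\rho'}\rangle=0$. Let $O_\tau\subseteq X$ be the $T$-orbit whose ideal of vanishing functions is $\bigoplus_{m\in P\setminus\tau}A_m$. Let $\mathrm{Aut}(X)^0$ be the group of those automorphisms of $X$ that occur in an algebraic family $\{\varphi_b\}_{b\in B}$ of automorphisms of $X$ (that is, $B\times X\to X$, $(b,x)\mapsto\varphi_b(x)$ is a morphism), with $B$ an irreducible variety, such that $\varphi_{b_0}=\mathrm{id}_X$ for some $b_0\in B$. Then the closures of the $\mathrm{Aut}(X)^0$-orbits on $X$ are exactly the sets $\overline{O_\tau}$, where $\tau$ is a face of $\sigma^\vee$ that has no admissible $\tau$-roots. Consequently, the $\mathrm{Aut}(X)^0$-orbits on $X$ are exactly the sets $\overline{O_\tau}\setminus\bigcup_{\gamma}\overline{O_\gamma}$, where $\tau$ is a face of $\sigma^\vee$ without admissible $\tau$-roots and $\gamma$ runs over the faces of $\sigma^\vee$ that are properly contained in $\tau$ and have no admissible $\gamma$-roots. -/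

import Mathlib

universe u

namespace ToricOrbits

/-! ### Affine varieties

An affine variety `X` over an algebraically closed field `K` is given by its coordinate algebra
`A = K[X]`. Its points are the `K`-algebra homomorphisms `A → K`, with `x f = f(x)`. -/

section Variety

open CategoryTheory CategoryTheory.Limits AlgebraicGeometry

variable (K A : Type u) [Field K] [CommRing A] [Algebra K A]

/-- The points of the affine variety with coordinate algebra `A`. -/
def Points : Type u := A →ₐ[K] K

variable {K A}

/-- The maximal ideal of a point. -/
def Points.toPrimeSpectrum (x : Points K A) : PrimeSpectrum A :=
  ⟨RingHom.ker (show A →ₐ[K] K from x), RingHom.ker_isPrime _⟩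

/-- The Zariski topology. -/
instance : TopologicalSpace (Points K A) :=
  TopologicalSpace.induced Points.toPrimeSpectrum inferInstance

/-- The value `f(x)` of a regular function `f` at a point `x`. -/
def Points.eval (x : Points K A) (f : A) : K := (show A →ₐ[K] K from x) f

/-- An automorphism `φ` of `X` is given by its comorphism `φ^* : A ≃ₐ[K] A`; the image of the
point `x` is the point `f ↦ (φ^* f)(x)`. -/
def Points.map (φ : A ≃ₐ[K] A) (x : Points K A) : Points K A :=
  (show A →ₐ[K] K from x).comp φ.toAlgHom

variable (K A)

/-- The structure morphism `Spec A ⟶ Spec K`. -/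
noncomputable abbrev toBase : Spec (CommRingCat.of A) ⟶ Spec (CommRingCat.of K) :=
  Spec.map (CommRingCat.ofHom (algebraMap K A))

/-- The morphism `Spec A ⟶ Spec A` with comorphism `φ`. -/
noncomputable def autMor {K A : Type u} [Field K] [CommRing A] [Algebra K A] (φ : A ≃ₐ[K] A) :
    Spec (CommRingCat.of A) ⟶ Spec (CommRingCat.of A) :=
  Spec.map (CommRingCat.ofHom (φ : A →+* A))

/-- An algebraic family `{φ_b, b ∈ B}` of automorphisms of `X`, parametrized by an irreducible
variety `B` (an integral separated scheme of finite type over `K`, not necessarily affine). The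
parameters `b` are the `K`-points of `B`. -/
structure IrreducibleFamily where
  /-- the parametrizing variety -/
  B : Scheme.{u}
  /-- its structure morphism -/
  str : B ⟶ Spec (CommRingCat.of K)
  isIntegral : IsIntegral B
  isSeparated : IsSeparated str
  locallyOfFiniteType : LocallyOfFiniteType str
  quasiCompact : QuasiCompact str
  /-- the morphism `B × X ⟶ X`, `(b, x) ↦ φ_b(x)` -/
  total : pullback str (toBase K A) ⟶ Spec (CommRingCat.of A)
  total_over : total ≫ toBase K A = pullback.fst str (toBase K A) ≫ str
  /-- the automorphism `φ_b` -/
  aut : (b : Spec (CommRingCat.of K) ⟶ B) → b ≫ str = 𝟙 _ → (A ≃ₐ[K] A)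
  /-- `φ_b` is the restriction of `B × X ⟶ X` to `{b} × X = X` -/
  restrict : ∀ (b : Spec (CommRingCat.of K) ⟶ B) (hb : b ≫ str = 𝟙 _),
    pullback.lift (toBase K A ≫ b) (𝟙 (Spec (CommRingCat.of A)))
      (by rw [Category.assoc, hb, Category.comp_id, Category.id_comp]) ≫ total = autMor (aut b hb)

/-- The neutral component `Aut(X)^0`: all automorphisms that occur in an algebraic family over an
irreducible variety which contains the identity. -/
def aut0 : Set (A ≃ₐ[K] A) :=
  {φ | ∃ (F : IrreducibleFamily K A) (b₀ b₁ : Spec (CommRingCat.of K) ⟶ F.B)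
    (h₀ : b₀ ≫ F.str = 𝟙 _) (h₁ : b₁ ≫ F.str = 𝟙 _),
    F.aut b₀ h₀ = AlgEquiv.refl ∧ F.aut b₁ h₁ = φ}

variable {K A}

/-- The `Aut(X)^0`-orbit of the point `x`. -/
def aut0Orbit (x : Points K A) : Set (Points K A) :=
  {y | ∃ φ ∈ aut0 K A, y = x.map φ}

end Variety

/-! ### Lattices and cones

The lattices `M` and `N` are `ℤⁿ`, with the standard pairing. -/

section Cones

variable {n : ℕ}

/-- The inclusion `ℤⁿ ⊆ ℚⁿ`. -/
def toRat (m : Fin n → ℤ) : Fin n → ℚ := fun i => (m i : ℚ)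

/-- The cone `σ^∨` in `M_ℚ` spanned by `P`. -/
def weightCone (P : Set (Fin n → ℤ)) : PointedCone ℚ (Fin n → ℚ) :=
  PointedCone.hull ℚ (toRat '' P)

/-- The cone `σ` in `N_ℚ` dual to `σ^∨`. -/
def dualCone (P : Set (Fin n → ℤ)) : PointedCone ℚ (Fin n → ℚ) :=
  PointedCone.dual (dotProductBilin ℚ ℚ) (weightCone P : Set (Fin n → ℚ))

/-- `p` is the primitive lattice vector on a ray (a one-dimensional face) of the cone `σ`.
Such vectors `p` correspond bijectively to the rays of `σ`. -/
def IsPrimitiveOnRay (P : Set (Fin n → ℤ)) (p : Fin n → ℤ) : Prop :=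
  (∀ d : ℤ, (∀ i, d ∣ p i) → IsUnit d) ∧
    (PointedCone.hull ℚ {toRat p}).IsFaceOf (dualCone P)

/-- `e` is a Demazure root of `σ` whose distinguished ray is the one through `p`. -/
def IsDemazureRootAt (P : Set (Fin n → ℤ)) (p e : Fin n → ℤ) : Prop :=
  IsPrimitiveOnRay P p ∧ e ⬝ᵥ p = -1 ∧
    ∀ p' : Fin n → ℤ, IsPrimitiveOnRay P p' → p' ≠ p → 0 ≤ e ⬝ᵥ p'

/-- `e` is a Demazure root of `σ`. -/
def IsDemazureRoot (P : Set (Fin n → ℤ)) (e : Fin n → ℤ) : Prop :=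
  ∃ p, IsDemazureRootAt P p e

/-- `p` is the primitive lattice vector on a ray of `σ` that is normal to `τ`. -/
def IsNormalRay (P : Set (Fin n → ℤ)) (τ : PointedCone ℚ (Fin n → ℚ)) (p : Fin n → ℤ) : Prop :=
  IsPrimitiveOnRay P p ∧ ∀ v ∈ τ, v ⬝ᵥ toRat p = 0

/-- `e` is a `τ`-root: a Demazure root whose pairing with the primitive vector of one of the rays
of `σ` normal to `τ` is `-1` and with those of all other rays normal to `τ` is `0`. -/
def IsFaceRoot (P : Set (Fin n → ℤ)) (τ : PointedCone ℚ (Fin n → ℚ)) (e : Fin n → ℤ) : Prop :=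
  IsDemazureRoot P e ∧ ∃ p, IsNormalRay P τ p ∧ e ⬝ᵥ p = -1 ∧
    ∀ p', IsNormalRay P τ p' → p' ≠ p → e ⬝ᵥ p' = 0

/-- `e` is admissible: `(e + P) ∩ σ^∨ ⊆ P`. -/
def IsAdmissible (P : Set (Fin n → ℤ)) (e : Fin n → ℤ) : Prop :=
  ∀ m ∈ P, toRat (e + m) ∈ weightCone P → e + m ∈ P

/-- `τ` is a face of `σ^∨` for which there are no admissible `τ`-roots. -/
def IsRootFreeFace (P : Set (Fin n → ℤ)) (τ : PointedCone ℚ (Fin n → ℚ)) : Prop :=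
  τ.IsFaceOf (weightCone P) ∧ ¬ ∃ e, IsFaceRoot P τ e ∧ IsAdmissible P e

end Cones

/-! ### Torus actions and toric varieties -/

section Torus

/-- The value at `t ∈ (Kˣ)ⁿ` of the character `χ^m = t₁^{m₁} ⋯ tₙ^{mₙ}`. -/
def character {K : Type u} [Field K] {n : ℕ} (m : Fin n → ℤ) (t : Fin n → Kˣ) : K :=
  ((∏ i, t i ^ m i : Kˣ) : K)

/-- A regular action of the torus `T = (Kˣ)ⁿ` on `X`. -/
structure TorusAction (K A : Type u) [Field K] [CommRing A] [Algebra K A] (n : ℕ) where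
  /-- the comorphism of `x ↦ t · x`; left and right actions agree because `T` is commutative -/
  act : (Fin n → Kˣ) →* (A ≃ₐ[K] A)
  /-- `T × X → X` is a morphism: it pulls back each `f ∈ K[X]` to a regular function on `T × X`,
  i.e. to a Laurent polynomial in the coordinates of `t` with coefficients in `K[X]` -/
  regular : ∀ f : A, ∃ c : (Fin n → ℤ) →₀ A, ∀ t, act t f = c.sum fun m a => character m t • a

namespace TorusAction

variable {K A : Type u} [Field K] [CommRing A] [Algebra K A] {n : ℕ} (T : TorusAction K A n)

/-- The `T`-orbit of a point. -/
def orbit (x : Points K A) : Set (Points K A) := Set.range fun t => x.map (T.act t)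

/-- `X` is a toric variety with torus `T`: the action is effective and has an open orbit. -/
def IsToric : Prop :=
  Function.Injective T.act ∧ ∃ x : Points K A, IsOpen (T.orbit x)

/-- The set `A_m` of functions of weight `m`: those with `f(t · x) = χ^m(t) f(x)`. -/
def weightSpace (m : Fin n → ℤ) : Set A := {f | ∀ t, T.act t f = character m t • f}

/-- The weight monoid `P = {m | A_m ≠ 0}`. -/
def weightMonoid : Set (Fin n → ℤ) := {m | ∃ f ∈ T.weightSpace m, f ≠ 0}

/-- The ideal `I_τ = ⨁ A_m` over `m ∈ P \ τ` (here, the `K`-subspace of `A` underlying it). -/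
def faceIdeal (τ : PointedCone ℚ (Fin n → ℚ)) : Submodule K A :=
  Submodule.span K (⋃ m ∈ {m | m ∈ T.weightMonoid ∧ toRat m ∉ τ}, T.weightSpace m)

/-- The `T`-orbit `O_τ`: the points `x` such that the functions vanishing on the orbit `T x` are
exactly those in `I_τ`. -/
def faceOrbit (τ : PointedCone ℚ (Fin n → ℚ)) : Set (Points K A) :=
  {x | ∀ f : A, (∀ y ∈ T.orbit x, y.eval f = 0) ↔ f ∈ T.faceIdeal τ}

end TorusAction

end Torus

end ToricOrbits

/-!
The action of the torus `T` identifies `A` with the monoid algebra `K[P]`: evaluation at a point of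
the open orbit is injective on each weight space, so weight spaces are lines, `A` is spanned by
monomials `χ^m` with `m ∈ P`, `P` is finitely generated, and `P` generates `M` because the action is
effective (`TorusAction.IsToric.exists_monoidAlgebra_equiv`). A point lies in `O_τ` exactly if the
monomials that do not vanish at it are those in `τ` (`mem_faceOrbit`). Every point lies in some
`O_τ`, each `O_τ` is a single `T`-orbit because `Kˣ` is divisible (`exists_eq_map_act`), and
`closure O_τ` is the zero set of the prime ideal of `τ`, spanned by the monomials outside `τ`.

The closures `closure O_τ` with `τ` free of admissible roots are invariant under `Aut(X)^0`. A
homogeneous derivation of degree `ε` sends `χ^m` to `c(m) χ^(m + ε)` with `c` additive. If it moves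
a monomial outside `τ` into `τ`, then `c` is a multiple of the pairing with the primitive vector of
a ray, and `ε` is an admissible `τ`-root (`isFaceRoot_and_isAdmissible_of_ne_zero`). Hence the prime
ideal of a root-free face is stable under all derivations. Such ideals are spanned by monomials, so
only finitely many of them are prime, and automorphisms permute these. In an irreducible family of
automorphisms, the image of each of finitely many permuted primes is constant, because the parameter
space is not a union of finitely many proper closed subsets (`comap_eq_of_mem_aut0`); so elements of
`Aut(X)^0` fix each of them.

Conversely, an admissible root `ε` with distinguished ray `p` defines the locally nilpotent
derivation `χ^m ↦ ⟨m, p⟩ χ^(m + ε)`, with exponential `χ^m ↦ χ^m (1 + χ^ε)^⟨m, p⟩` (`rootAut`).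
If `ε` is a `τ`-root, there is `m ∈ P` outside `τ` with `⟨m, p⟩ = 1` and `m + ε ∈ τ`
(`exists_add_mem_face`), so the exponential sends `χ^m` to `χ^m + χ^(m + ε)`, which does not vanish
on `O_τ`, and fixes the monomials in `τ`
(`exists_rootAut_eval_ne_zero`). As `P` is finitely generated, finitely many such automorphisms move
each point into `O_τ` for a root-free `τ`. This `τ` is the least root-free face with the given point
in `closure O_τ`, and any two points with the same `τ` are related by root automorphisms and one
torus element. These lie in one group contained in `Aut(X)^0`, since they all come from families
over `T × 𝔸¹` that are composed pointwise (`exists_subgroup_subset_aut0`). So the orbits of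
`Aut(X)^0` are the sets `faceStratum T τ`.
-/

namespace ToricOrbits

/-! ### Polyhedral cones over the rationals -/

section Polyhedral

open PointedCone

variable {n : ℕ}

theorem mem_hull_image_of_forall_dotProduct_nonneg {ι : Type*} (s : Finset ι)
    (a : ι → Fin n → ℚ) (v : Fin n → ℚ)
    (h : ∀ y, (∀ i ∈ s, 0 ≤ a i ⬝ᵥ y) → 0 ≤ v ⬝ᵥ y) : v ∈ hull ℚ (a '' (s : Set ι)) := by
  classical
  induction s using Finset.induction_on generalizing a v with
  | empty =>
    have h1 := h (-v) (by simp)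
    have h2 : v ⬝ᵥ v = 0 := by
      have : 0 ≤ v ⬝ᵥ v := Finset.sum_nonneg fun i _ => mul_self_nonneg _
      rw [dotProduct_neg] at h1
      linarith
    rw [dotProduct_self_eq_zero.1 h2]
    exact zero_mem _
  | insert j s hj ih =>
    by_cases hs : ∀ y, (∀ i ∈ s, 0 ≤ a i ⬝ᵥ y) → 0 ≤ v ⬝ᵥ y
    · exact Submodule.span_mono (Set.image_mono (by simp)) (ih a v hs)
    push Not at hs
    obtain ⟨x, hx, hvx⟩ := hs
    have hjx : a j ⬝ᵥ x < 0 := by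
      by_contra hcon
      refine hvx.not_ge (h x fun i hi => ?_)
      rcases Finset.mem_insert.1 hi with rfl | hi
      · exact not_lt.1 hcon
      · exact hx i hi
    -- rescale `x` so that `a j` takes the value `-1`, and project along `x`
    obtain ⟨x, hx, hvx, hjx⟩ : ∃ x, (∀ i ∈ s, 0 ≤ a i ⬝ᵥ x) ∧ v ⬝ᵥ x < 0 ∧ a j ⬝ᵥ x = -1 := by
      have hpos : 0 < (-(a j ⬝ᵥ x))⁻¹ := inv_pos.2 (by linarith)
      refine ⟨(-(a j ⬝ᵥ x))⁻¹ • x, fun i hi => ?_, ?_, ?_⟩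
      · rw [dotProduct_smul]; exact mul_nonneg hpos.le (hx i hi)
      · rw [dotProduct_smul]; exact mul_neg_of_pos_of_neg hpos hvx
      · rw [dotProduct_smul, smul_eq_mul, inv_neg, neg_mul, inv_mul_cancel₀ hjx.ne]
    have key := ih (fun i => a i + (a i ⬝ᵥ x) • a j) (v + (v ⬝ᵥ x) • a j) (fun y hy => by
      have h1 := h (y + (a j ⬝ᵥ y) • x) (fun i hi => by
        rcases Finset.mem_insert.1 hi with rfl | hi
        · simp [dotProduct_add, dotProduct_smul, hjx]
        · have := hy i hi
          simp only [add_dotProduct, smul_dotProduct, smul_eq_mul] at this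
          simp only [dotProduct_add, dotProduct_smul, smul_eq_mul]
          linarith)
      simp only [dotProduct_add, dotProduct_smul, smul_eq_mul] at h1
      simp only [add_dotProduct, smul_dotProduct, smul_eq_mul]
      linarith)
    have hle : hull ℚ ((fun i => a i + (a i ⬝ᵥ x) • a j) '' (s : Set ι)) ≤
        hull ℚ (a '' ((insert j s : Finset ι) : Set ι)) := by
      refine Submodule.span_le.2 ?_
      rintro _ ⟨i, hi, rfl⟩
      refine add_mem (Submodule.subset_span ⟨i, by simp [Finset.mem_coe.1 hi], rfl⟩) ?_
      exact PointedCone.smul_mem _ (hx i hi) (Submodule.subset_span ⟨j, by simp, rfl⟩)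
    have := add_mem (hle key)
      (PointedCone.smul_mem (hull ℚ (a '' ((insert j s : Finset ι) : Set ι)))
      (neg_nonneg.2 hvx.le) (Submodule.subset_span ⟨j, by simp, rfl⟩ :
        a j ∈ hull ℚ (a '' ((insert j s : Finset ι) : Set ι))))
    simpa using this

/-- **Farkas' lemma** over `ℚ`. -/
theorem exists_dotProduct_neg_of_notMem_hull (S : Finset (Fin n → ℚ)) {v : Fin n → ℚ}
    (hv : v ∉ hull ℚ (S : Set (Fin n → ℚ))) :
    ∃ y, (∀ s ∈ S, 0 ≤ s ⬝ᵥ y) ∧ v ⬝ᵥ y < 0 := by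
  by_contra! hcon
  exact hv (by simpa using mem_hull_image_of_forall_dotProduct_nonneg S id v hcon)

/-- If `S` spans the space, then a vector outside the cone over `S` is separated from it by a
functional whose zeros in `S` determine it up to scaling, i.e. one on a ray of the dual cone.
Such a functional is obtained by maximizing the number of its zeros in `S`. -/
theorem exists_extremal_dotProduct_neg (S : Finset (Fin n → ℚ))
    (hS : ∀ z, (∀ s ∈ S, s ⬝ᵥ z = 0) → z = 0) {v : Fin n → ℚ}
    (hv : v ∉ hull ℚ (S : Set (Fin n → ℚ))) :
    ∃ y, (∀ s ∈ S, 0 ≤ s ⬝ᵥ y) ∧ v ⬝ᵥ y < 0 ∧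
      ∀ z, (∀ s ∈ S, s ⬝ᵥ y = 0 → s ⬝ᵥ z = 0) → ∃ c : ℚ, z = c • y := by
  classical
  -- a separating functional with the largest number of zeros in `S`
  obtain ⟨y, ⟨hy, hvy⟩, hmax⟩ : ∃ y, ((∀ s ∈ S, 0 ≤ s ⬝ᵥ y) ∧ v ⬝ᵥ y < 0) ∧
      ∀ y', ((∀ s ∈ S, 0 ≤ s ⬝ᵥ y') ∧ v ⬝ᵥ y' < 0) →
        (S.filter fun s => s ⬝ᵥ y' = 0).card ≤ (S.filter fun s => s ⬝ᵥ y = 0).card := by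
    let Q : Set ℕ := {k | ∃ y, ((∀ s ∈ S, 0 ≤ s ⬝ᵥ y) ∧ v ⬝ᵥ y < 0) ∧
      (S.filter fun s => s ⬝ᵥ y = 0).card = k}
    have hQ : BddAbove Q := ⟨S.card, by rintro _ ⟨y, -, rfl⟩; exact Finset.card_filter_le _ _⟩
    obtain ⟨y₀, hy₀⟩ := exists_dotProduct_neg_of_notMem_hull S hv
    obtain ⟨y, hy, hk⟩ := Nat.sSup_mem (s := Q) ⟨_, y₀, hy₀, rfl⟩ hQ
    exact ⟨y, hy, fun y' hy' => hk ▸ le_csSup hQ ⟨y', hy', rfl⟩⟩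
  refine ⟨y, hy, hvy, fun z hz => ?_⟩
  by_contra hzy
  -- a direction `z` in which the zeros of `y` persist, `v` is constant, and some `s` decreases
  obtain ⟨z, hz, hvz, s₀, hs₀, hsz₀⟩ : ∃ z, (∀ s ∈ S, s ⬝ᵥ y = 0 → s ⬝ᵥ z = 0) ∧ v ⬝ᵥ z = 0 ∧
      ∃ s ∈ S, s ⬝ᵥ z < 0 := by
    set z' := z - ((v ⬝ᵥ z) / (v ⬝ᵥ y)) • y with hz'
    have h1 : ∀ s ∈ S, s ⬝ᵥ y = 0 → s ⬝ᵥ z' = 0 := fun s hs h => by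
      simp [hz', dotProduct_sub, dotProduct_smul, h, hz s hs h]
    have h2 : v ⬝ᵥ z' = 0 := by
      simp [hz', dotProduct_sub, dotProduct_smul, hvy.ne]
    have h3 : ∃ s ∈ S, s ⬝ᵥ z' ≠ 0 := by
      by_contra! h0
      exact hzy ⟨_, sub_eq_zero.1 (hS z' h0)⟩
    obtain ⟨s, hs, hsz⟩ := h3
    rcases lt_or_gt_of_ne hsz with h | h
    · exact ⟨z', h1, h2, s, hs, h⟩
    · exact ⟨-z', fun s hs h => by rw [dotProduct_neg, h1 s hs h, neg_zero],
        by rw [dotProduct_neg, h2, neg_zero], s, hs, by rw [dotProduct_neg]; linarith⟩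
  obtain ⟨s₁, hs₁, hmin⟩ := (S.filter fun s => s ⬝ᵥ z < 0).exists_min_image
    (fun s => (s ⬝ᵥ y) / (-(s ⬝ᵥ z))) ⟨s₀, by simp [hs₀, hsz₀]⟩
  obtain ⟨hs₁S, hs₁z⟩ := Finset.mem_filter.1 hs₁
  set l := (s₁ ⬝ᵥ y) / (-(s₁ ⬝ᵥ z)) with hl
  have hl0 : 0 ≤ l := div_nonneg (hy _ hs₁S) (by linarith)
  have h1 : ∀ s ∈ S, 0 ≤ s ⬝ᵥ (y + l • z) := fun s hs => by
    rw [dotProduct_add, dotProduct_smul, smul_eq_mul]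
    rcases lt_or_ge (s ⬝ᵥ z) 0 with h | h
    · have := hmin s (by simp [hs, h])
      rw [le_div_iff₀ (by linarith)] at this
      linarith
    · have := hy s hs
      positivity
  have h2 : v ⬝ᵥ (y + l • z) < 0 := by
    rw [dotProduct_add, dotProduct_smul, hvz]; simpa using hvy
  have h3 : s₁ ⬝ᵥ (y + l • z) = 0 := by
    rw [dotProduct_add, dotProduct_smul, smul_eq_mul, hl]
    have : s₁ ⬝ᵥ z ≠ 0 := hs₁z.ne
    field_simp
    ring
  have h4 : (S.filter fun s => s ⬝ᵥ y = 0) ⊂ S.filter fun s => s ⬝ᵥ (y + l • z) = 0 := by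
    refine Finset.ssubset_iff_of_subset (fun s hs => ?_) |>.2
      ⟨s₁, Finset.mem_filter.2 ⟨hs₁S, h3⟩, fun h => ?_⟩
    · obtain ⟨hs, hsy⟩ := Finset.mem_filter.1 hs
      simp [hs, dotProduct_add, dotProduct_smul, hsy, hz s hs hsy]
    · exact hs₁z.ne (hz _ hs₁S (Finset.mem_filter.1 h).2)
  exact (Finset.card_lt_card h4).not_ge (hmax _ ⟨h1, h2⟩)

/-- Every nonzero rational vector is a positive multiple of a primitive lattice vector. -/
theorem exists_primitive_of_ne_zero {y : Fin n → ℚ} (hy : y ≠ 0) :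
    ∃ p : Fin n → ℤ, (∀ d : ℤ, (∀ i, d ∣ p i) → IsUnit d) ∧ ∃ c : ℚ, 0 < c ∧ y = c • toRat p := by
  obtain ⟨b, hb⟩ := IsLocalization.exist_integer_multiples (nonZeroDivisors ℤ) Finset.univ y
  choose w hw using hb
  have hw' : ∀ i, (w i (Finset.mem_univ i) : ℚ) = (b : ℤ) * y i := fun i => by
    simpa [Algebra.smul_def] using hw i (Finset.mem_univ i)
  obtain ⟨i₀, hi₀⟩ := Function.ne_iff.1 hy
  have hb0 : ((b : ℤ) : ℚ) ≠ 0 := by exact_mod_cast nonZeroDivisors.coe_ne_zero b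
  obtain ⟨g, hg, hgcd⟩ := Finset.extract_gcd (fun i => w i (Finset.mem_univ i))
    (s := Finset.univ) ⟨i₀, Finset.mem_univ _⟩
  set G := Finset.univ.gcd fun i => w i (Finset.mem_univ i) with hG
  have hy' : ∀ i, y i = (G / (b : ℤ) : ℚ) * g i := fun i => by
    have h1 := hw' i
    rw [hg i (Finset.mem_univ i)] at h1
    push_cast at h1
    field_simp
    linarith
  have hprim : ∀ d : ℤ, (∀ i, d ∣ g i) → IsUnit d := fun d hd =>
    isUnit_of_dvd_one (hgcd ▸ Finset.dvd_gcd fun i _ => hd i)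
  have hc : (G / (b : ℤ) : ℚ) ≠ 0 := fun h => hi₀ (by rw [hy' i₀, h]; simp)
  rcases lt_or_gt_of_ne hc with h | h
  · refine ⟨-g, fun d hd => hprim d fun i => by simpa using hd i, -(G / (b : ℤ) : ℚ),
      by linarith, ?_⟩
    ext i
    simp [toRat, hy' i]
  · refine ⟨g, hprim, _, h, ?_⟩
    ext i
    simp [toRat, hy' i]

end Polyhedral

/-! ### Rays and faces of the weight cone -/

section WeightCone

open PointedCone

variable {n : ℕ}

@[simp] theorem toRat_add (a b : Fin n → ℤ) : toRat (a + b) = toRat a + toRat b := by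
  ext i; simp [toRat]

@[simp] theorem toRat_zero : toRat (0 : Fin n → ℤ) = 0 := by
  ext i; simp [toRat]

theorem toRat_nsmul (k : ℕ) (a : Fin n → ℤ) : toRat (k • a) = (k : ℚ) • toRat a := by
  ext i; simp [toRat]

theorem toRat_injective : Function.Injective (toRat (n := n)) := fun a b h => by
  ext i
  have := congrFun h i
  simpa [toRat] using this

theorem toRat_dotProduct (a b : Fin n → ℤ) : toRat a ⬝ᵥ toRat b = ((a ⬝ᵥ b : ℤ) : ℚ) := by
  simp [toRat, dotProduct]

/-- Up to a positive multiple, a point of the cone over a submonoid of the lattice lies in the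
submonoid. -/
theorem exists_nsmul_mem_of_mem_hull (Q : AddSubmonoid (Fin n → ℤ)) {v : Fin n → ℚ}
    (hv : v ∈ hull ℚ (toRat '' (Q : Set (Fin n → ℤ)))) :
    ∃ k : ℕ, 0 < k ∧ ∃ m ∈ Q, (k : ℚ) • v = toRat m := by
  induction hv using Submodule.span_induction with
  | mem v hv =>
    obtain ⟨m, hm, rfl⟩ := hv
    exact ⟨1, one_pos, m, hm, by simp⟩
  | zero => exact ⟨1, one_pos, 0, zero_mem _, by simp⟩
  | add v w _ _ hv hw =>
    obtain ⟨k, hk, m, hm, hkm⟩ := hv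
    obtain ⟨l, hl, m', hm', hlm⟩ := hw
    refine ⟨k * l, Nat.mul_pos hk hl, l • m + k • m',
      add_mem (nsmul_mem hm _) (nsmul_mem hm' _), ?_⟩
    rw [toRat_add, toRat_nsmul, toRat_nsmul, ← hkm, ← hlm, smul_add, smul_smul, smul_smul]
    push_cast
    rw [mul_comm (l : ℚ)]
  | smul c v _ hv =>
    obtain ⟨k, hk, m, hm, hkm⟩ := hv
    obtain ⟨c, hc⟩ := c
    refine ⟨c.den * k, Nat.mul_pos c.den_pos hk, c.num.toNat • m, nsmul_mem hm _, ?_⟩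
    rw [toRat_nsmul, ← hkm]
    have h1 : ((c.num.toNat : ℤ) : ℚ) = c * c.den := by
      rw [Int.toNat_of_nonneg (Rat.num_nonneg.2 hc), Rat.mul_den_eq_num]
    rw [Int.cast_natCast] at h1
    rw [h1, Nonneg.mk_smul, smul_smul, smul_smul]
    push_cast
    congr 1
    ring

/-- A lattice point of the cone over a submonoid of the lattice has a positive multiple in it. -/
theorem exists_nsmul_mem_of_toRat_mem_hull (Q : AddSubmonoid (Fin n → ℤ)) {m : Fin n → ℤ}
    (hm : toRat m ∈ hull ℚ (toRat '' (Q : Set (Fin n → ℤ)))) :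
    ∃ k : ℕ, 0 < k ∧ k • m ∈ Q := by
  obtain ⟨k, hk, m', hm', h⟩ := exists_nsmul_mem_of_mem_hull Q hm
  rw [← toRat_nsmul] at h
  exact ⟨k, hk, toRat_injective h ▸ hm'⟩

theorem toRat_mem_weightCone {P : Set (Fin n → ℤ)} {m : Fin n → ℤ} (hm : m ∈ P) :
    toRat m ∈ weightCone P :=
  Submodule.subset_span ⟨m, hm, rfl⟩

theorem mem_dualCone {P : Set (Fin n → ℤ)} {y : Fin n → ℚ} :
    y ∈ dualCone P ↔ ∀ m ∈ P, 0 ≤ toRat m ⬝ᵥ y := by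
  rw [dualCone, weightCone, dual_hull, mem_dual]
  simp

/-- A face of the cone over `P` is the cone over its points in `P`. -/
theorem hull_toRat_image_eq (P : AddSubmonoid (Fin n → ℤ)) {τ : PointedCone ℚ (Fin n → ℚ)}
    (hτ : τ.IsFaceOf (weightCone (P : Set (Fin n → ℤ)))) :
    hull ℚ (toRat '' {m | m ∈ P ∧ toRat m ∈ τ}) = τ := by
  refine le_antisymm (Submodule.span_le.2 ?_) fun v hv => ?_
  · rintro _ ⟨m, ⟨-, hm⟩, rfl⟩
    exact hm
  · obtain ⟨k, hk, m, hm, h⟩ := exists_nsmul_mem_of_mem_hull P (hτ.le hv)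
    have hk' : (0 : ℚ) < k := by exact_mod_cast hk
    have h1 : toRat m ∈ τ := h ▸ PointedCone.smul_mem _ hk'.le hv
    have h2 : v = (k : ℚ)⁻¹ • toRat m := by rw [← h, smul_smul, inv_mul_cancel₀ hk'.ne', one_smul]
    rw [h2]
    exact PointedCone.smul_mem _ (by positivity) (Submodule.subset_span ⟨m, ⟨hm, h1⟩, rfl⟩)

theorem le_of_forall_mem {P : AddSubmonoid (Fin n → ℤ)} {τ τ' : PointedCone ℚ (Fin n → ℚ)}
    (hτ : τ.IsFaceOf (weightCone (P : Set (Fin n → ℤ))))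
    (h : ∀ m ∈ P, toRat m ∈ τ → toRat m ∈ τ') : τ ≤ τ' := by
  rw [← hull_toRat_image_eq P hτ]
  refine Submodule.span_le.2 ?_
  rintro _ ⟨m, ⟨hm, hmτ⟩, rfl⟩
  exact h m hm hmτ

/-- A submonoid `F` of `P` that contains the summands in `P` of its elements spans a face of the
cone over `P`, and `F` consists of the points of `P` on that face. -/
theorem isFaceOf_hull_of_summand_mem {P F : AddSubmonoid (Fin n → ℤ)} (hFP : F ≤ P)
    (hF : ∀ a ∈ P, ∀ b ∈ P, a + b ∈ F → a ∈ F) :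
    (hull ℚ (toRat '' (F : Set (Fin n → ℤ)))).IsFaceOf (weightCone (P : Set (Fin n → ℤ))) ∧
      ∀ m ∈ P, toRat m ∈ hull ℚ (toRat '' (F : Set (Fin n → ℤ))) ↔ m ∈ F := by
  have hmul : ∀ m ∈ P, ∀ k : ℕ, 0 < k → k • m ∈ F → m ∈ F := fun m hm k hk hkm => by
    obtain ⟨k, rfl⟩ := Nat.exists_eq_succ_of_ne_zero hk.ne'
    rw [succ_nsmul'] at hkm
    exact hF m hm _ (nsmul_mem hm k) hkm
  refine ⟨⟨Submodule.span_mono (Set.image_mono hFP), fun {x y a} hx hy ha hxy => ?_⟩,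
    fun m hm => ⟨fun h => ?_, fun h => Submodule.subset_span ⟨m, h, rfl⟩⟩⟩
  · obtain ⟨k₁, hk₁, m₁, hm₁, h₁⟩ := exists_nsmul_mem_of_mem_hull P
      (PointedCone.smul_mem _ ha.le hx : a • x ∈ weightCone (P : Set (Fin n → ℤ)))
    obtain ⟨k₂, hk₂, m₂, hm₂, h₂⟩ := exists_nsmul_mem_of_mem_hull P hy
    have h3 : toRat (k₂ • m₁ + k₁ • m₂) ∈ hull ℚ (toRat '' (F : Set (Fin n → ℤ))) := by
      have := PointedCone.smul_mem _ (by positivity : (0 : ℚ) ≤ k₁ * k₂) hxy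
      rw [toRat_add, toRat_nsmul, toRat_nsmul, ← h₁, ← h₂, smul_smul (k₂ : ℚ), smul_smul (k₁ : ℚ),
        mul_comm (k₂ : ℚ), ← smul_add]
      exact this
    obtain ⟨k₃, hk₃, h4⟩ := exists_nsmul_mem_of_toRat_mem_hull F h3
    have h5 : k₂ • m₁ ∈ F := hF _ (nsmul_mem hm₁ _) _ (nsmul_mem hm₂ k₁)
      (hmul _ (add_mem (nsmul_mem hm₁ _) (nsmul_mem hm₂ _)) _ hk₃ h4)
    have h6 : m₁ ∈ F := hmul _ hm₁ _ hk₂ h5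
    have hk₁' : (0 : ℚ) < k₁ := by exact_mod_cast hk₁
    have h7 : x = ((k₁ : ℚ) * a)⁻¹ • toRat m₁ := by
      rw [← h₁, smul_smul, smul_smul, mul_assoc, inv_mul_cancel₀ (by positivity), one_smul]
    rw [h7]
    exact PointedCone.smul_mem _ (by positivity) (Submodule.subset_span ⟨m₁, h6, rfl⟩)
  · obtain ⟨k, hk, h1⟩ := exists_nsmul_mem_of_toRat_mem_hull F h
    exact hmul m hm k hk h1

variable {P : AddSubmonoid (Fin n → ℤ)}

theorem eq_zero_of_forall_toRat_dotProduct_eq_zero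
    (hgen : AddSubgroup.closure (P : Set (Fin n → ℤ)) = ⊤) {z : Fin n → ℚ}
    (hz : ∀ m ∈ P, toRat m ⬝ᵥ z = 0) : z = 0 := by
  have h : ∀ m : Fin n → ℤ, toRat m ⬝ᵥ z = 0 := fun m => by
    have hm : m ∈ AddSubgroup.closure (P : Set (Fin n → ℤ)) := hgen ▸ AddSubgroup.mem_top m
    induction hm using AddSubgroup.closure_induction with
    | mem m hm => exact hz m hm
    | zero => simp
    | add a b _ _ ha hb => rw [toRat_add, add_dotProduct, ha, hb, add_zero]
    | neg a _ ha =>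
      have : toRat (-a) = -toRat a := by ext i; simp [toRat]
      rw [this, neg_dotProduct, ha, neg_zero]
  ext i
  have := h (Pi.single i 1)
  have h2 : toRat (Pi.single i 1 : Fin n → ℤ) = Pi.single i 1 := by
    ext j; by_cases hj : j = i
    · subst hj; simp [toRat]
    · simp [toRat, hj]
  rw [h2, single_dotProduct] at this
  simpa using this

theorem IsPrimitiveOnRay.nonneg {p : Fin n → ℤ} (hp : IsPrimitiveOnRay (P : Set (Fin n → ℤ)) p)
    {m : Fin n → ℤ} (hm : m ∈ P) : 0 ≤ m ⬝ᵥ p := by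
  have h1 : toRat p ∈ dualCone (P : Set (Fin n → ℤ)) :=
    hp.2.le (Submodule.subset_span rfl)
  have h2 := mem_dualCone.1 h1 m hm
  rw [toRat_dotProduct] at h2
  exact_mod_cast h2

theorem IsPrimitiveOnRay.nonneg_of_mem_weightCone {p : Fin n → ℤ}
    (hp : IsPrimitiveOnRay (P : Set (Fin n → ℤ)) p)
    {v : Fin n → ℚ} (hv : v ∈ weightCone (P : Set (Fin n → ℤ))) : 0 ≤ v ⬝ᵥ toRat p := by
  have h1 : toRat p ∈ dualCone (P : Set (Fin n → ℤ)) :=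
    hp.2.le (Submodule.subset_span rfl)
  exact h1 hv

/-- Primitive vectors that are proportional with a nonnegative factor agree. -/
theorem eq_of_primitive {p q : Fin n → ℤ} (hp : ∀ d : ℤ, (∀ i, d ∣ p i) → IsUnit d)
    (hq : ∀ d : ℤ, (∀ i, d ∣ q i) → IsUnit d) {c : ℚ} (hc : 0 ≤ c)
    (h : toRat p = c • toRat q) : p = q := by
  have h1 : ∀ i, (c.den : ℤ) * p i = c.num * q i := fun i => by
    have h2 : (p i : ℚ) = c * q i := congrFun h i
    have h3 : (c.den : ℚ) * p i = c.num * q i := by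
      rw [h2, ← mul_assoc, mul_comm (c.den : ℚ), Rat.mul_den_eq_num]
    exact_mod_cast h3
  have hcop : IsCoprime (c.den : ℤ) c.num := by
    rw [Int.isCoprime_iff_gcd_eq_one, Int.gcd_comm]
    simpa [Int.gcd] using c.reduced
  have hnum : IsUnit c.num := hp _ fun i =>
    hcop.symm.dvd_of_dvd_mul_left ⟨q i, h1 i⟩
  have hden : IsUnit (c.den : ℤ) := hq _ fun i =>
    hcop.dvd_of_dvd_mul_left ⟨p i, (h1 i).symm⟩
  have hn1 : c.num = 1 := by
    rcases Int.isUnit_iff.1 hnum with h | h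
    · exact h
    · have := Rat.num_nonneg.2 hc; omega
  have hd1 : (c.den : ℤ) = 1 := by
    rcases Int.isUnit_iff.1 hden with h | h
    · exact h
    · omega
  ext i
  have := h1 i
  rwa [hn1, hd1, one_mul, one_mul] at this

theorem exists_finset_weightCone_eq (hfg : P.FG) : ∃ S : Finset (Fin n → ℤ),
    AddSubmonoid.closure (S : Set (Fin n → ℤ)) = P ∧
      weightCone (P : Set (Fin n → ℤ)) = hull ℚ (toRat '' (S : Set (Fin n → ℤ))) := by
  obtain ⟨S, hS⟩ := hfg
  refine ⟨S, hS, le_antisymm (Submodule.span_le.2 ?_) (Submodule.span_mono (Set.image_mono ?_))⟩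
  · rintro _ ⟨m, hm, rfl⟩
    rw [← hS] at hm
    induction hm using AddSubmonoid.closure_induction with
    | mem m hm => exact Submodule.subset_span ⟨m, hm, rfl⟩
    | zero => rw [toRat_zero]; exact zero_mem _
    | add a b _ _ ha hb => rw [toRat_add]; exact add_mem ha hb
  · rw [← hS]; exact AddSubmonoid.subset_closure

/-- A primitive vector on a ray of `σ` is determined up to scaling by its zeros in `P`: a vector
`z` with at least the same zeros can be subtracted from a large multiple of `p` within `σ`. -/
theorem IsPrimitiveOnRay.exists_eq_smul (hfg : P.FG) {p : Fin n → ℤ}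
    (hp : IsPrimitiveOnRay (P : Set (Fin n → ℤ)) p) {z : Fin n → ℚ}
    (hz : ∀ m ∈ P, m ⬝ᵥ p = 0 → toRat m ⬝ᵥ z = 0) : ∃ c : ℚ, z = c • toRat p := by
  obtain ⟨S, hS, -⟩ := exists_finset_weightCone_eq hfg
  have hSP : ∀ s ∈ S, s ∈ P := fun s hs => hS ▸ AddSubmonoid.subset_closure hs
  have hmem : ∀ y : Fin n → ℚ, (∀ s ∈ S, 0 ≤ toRat s ⬝ᵥ y) →
      y ∈ dualCone (P : Set (Fin n → ℤ)) := by
    intro y hy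
    rw [mem_dualCone]
    intro m hm
    have hmS : m ∈ AddSubmonoid.closure (S : Set (Fin n → ℤ)) := hS ▸ hm
    clear hm
    induction hmS using AddSubmonoid.closure_induction with
    | mem m hm => exact hy m hm
    | zero => simp
    | add a b _ _ iha ihb =>
      rw [toRat_add, add_dotProduct]
      exact add_nonneg iha ihb
  obtain ⟨N, hN0, hN⟩ : ∃ N : ℚ, 0 ≤ N ∧ ∀ s ∈ S, |toRat s ⬝ᵥ z| ≤ N := by
    refine ⟨∑ s ∈ S, |toRat s ⬝ᵥ z|, Finset.sum_nonneg fun _ _ => abs_nonneg _, fun s hs => ?_⟩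
    exact Finset.single_le_sum (f := fun s => |toRat s ⬝ᵥ z|) (fun _ _ => abs_nonneg _) hs
  have hbound : ∀ s ∈ S, |toRat s ⬝ᵥ z| ≤ N * (toRat s ⬝ᵥ toRat p) := fun s hs => by
    rcases (hp.nonneg (hSP s hs)).eq_or_lt with h | h
    · rw [hz s (hSP s hs) h.symm, toRat_dotProduct, ← h]; simp
    · refine (hN s hs).trans (le_mul_of_one_le_right hN0 ?_)
      rw [toRat_dotProduct]
      exact_mod_cast h
  have h1 : N • toRat p + z ∈ dualCone (P : Set (Fin n → ℤ)) := hmem _ fun s hs => by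
    rw [dotProduct_add, dotProduct_smul, smul_eq_mul]
    linarith [hbound s hs, neg_abs_le (toRat s ⬝ᵥ z)]
  have h2 : N • toRat p - z ∈ dualCone (P : Set (Fin n → ℤ)) := hmem _ fun s hs => by
    rw [dotProduct_sub, dotProduct_smul, smul_eq_mul]
    linarith [hbound s hs, le_abs_self (toRat s ⬝ᵥ z)]
  have h3 : N • toRat p + z ∈ hull ℚ {toRat p} := by
    refine hp.2.mem_of_add_mem_left h1 h2 ?_
    have : N • toRat p + z + (N • toRat p - z) = (2 * N) • toRat p := by
      rw [two_mul, add_smul]; abel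
    rw [this]
    exact PointedCone.smul_mem _ (by positivity) (Submodule.subset_span rfl)
  obtain ⟨c, hc⟩ := Submodule.mem_span_singleton.1 h3
  refine ⟨c - N, ?_⟩
  rw [sub_smul, eq_sub_iff_add_eq, add_comm, ← hc]
  rfl

/-- Conversely, a nonzero vector of `σ` that is determined up to scaling by its zeros among
generators of `σ^∨` is a positive multiple of a primitive vector on a ray of `σ`. -/
theorem exists_isPrimitiveOnRay (hgen : AddSubgroup.closure (P : Set (Fin n → ℤ)) = ⊤)
    {y : Fin n → ℚ} (hy0 : y ≠ 0) (hy : y ∈ dualCone (P : Set (Fin n → ℤ)))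
    (hyz : ∀ z ∈ dualCone (P : Set (Fin n → ℤ)),
      (∀ m ∈ P, toRat m ⬝ᵥ y = 0 → toRat m ⬝ᵥ z = 0) → ∃ c : ℚ, z = c • y) :
    ∃ p, IsPrimitiveOnRay (P : Set (Fin n → ℤ)) p ∧ ∃ c : ℚ, 0 < c ∧ y = c • toRat p := by
  obtain ⟨p, hp, c, hc, rfl⟩ := exists_primitive_of_ne_zero hy0
  have hpmem : toRat p ∈ dualCone (P : Set (Fin n → ℤ)) := by
    have := PointedCone.smul_mem _ (inv_nonneg.2 hc.le) hy
    rwa [smul_smul, inv_mul_cancel₀ hc.ne', one_smul] at this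
  refine ⟨p, ⟨hp, ⟨Submodule.span_le.2 (by simpa using hpmem), fun {a b k} ha hb hk hab => ?_⟩⟩,
    c, hc, rfl⟩
  obtain ⟨d, hd⟩ := Submodule.mem_span_singleton.1 hab
  obtain ⟨e, he⟩ := hyz a ha fun m hm h => by
    rw [dotProduct_smul, smul_eq_mul] at h
    have h1 : toRat m ⬝ᵥ (k • a + b) = 0 := by
      have hd' : (d : ℚ) • toRat p = k • a + b := hd
      rw [← hd', dotProduct_smul, (mul_eq_zero.1 h).resolve_left hc.ne', smul_zero]
    have h2 := mem_dualCone.1 ha m hm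
    have h3 := mem_dualCone.1 hb m hm
    rw [dotProduct_add, dotProduct_smul, smul_eq_mul] at h1
    nlinarith
  rw [smul_smul] at he
  have hec : 0 ≤ e * c := by
    by_contra hneg
    push Not at hneg
    refine hy0 (eq_zero_of_forall_toRat_dotProduct_eq_zero hgen fun m hm => ?_)
    have h1 := mem_dualCone.1 ha m hm
    have h2 := mem_dualCone.1 hpmem m hm
    rw [he, dotProduct_smul, smul_eq_mul] at h1
    rw [dotProduct_smul, smul_eq_mul, mul_eq_zero]
    right
    nlinarith
  rw [he]
  exact PointedCone.smul_mem _ hec (Submodule.subset_span rfl)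

end WeightCone

section WeightCone

open PointedCone

variable {n : ℕ} {P : AddSubmonoid (Fin n → ℤ)}

/-- If `v` cannot be moved into `σ^∨` by adding elements of the cone over a finite set `F ⊆ P`,
then some ray of `σ` normal to `F` is negative on `v`. -/
theorem exists_isPrimitiveOnRay_neg (hfg : P.FG)
    (hgen : AddSubgroup.closure (P : Set (Fin n → ℤ)) = ⊤) (F : Finset (Fin n → ℤ))
    (hF : ∀ f ∈ F, f ∈ P) {v : Fin n → ℚ}
    (hv : ∀ u ∈ hull ℚ (toRat '' (F : Set (Fin n → ℤ))),
      v + u ∉ weightCone (P : Set (Fin n → ℤ))) :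
    ∃ p, IsPrimitiveOnRay (P : Set (Fin n → ℤ)) p ∧ (∀ f ∈ F, f ⬝ᵥ p = 0) ∧
      v ⬝ᵥ toRat p < 0 := by
  classical
  obtain ⟨S, hS, hScone⟩ := exists_finset_weightCone_eq hfg
  have hSP : ∀ s ∈ S, s ∈ P := fun s hs => hS ▸ AddSubmonoid.subset_closure hs
  have hdual : ∀ y : Fin n → ℚ, (∀ s ∈ S, 0 ≤ toRat s ⬝ᵥ y) →
      y ∈ dualCone (P : Set (Fin n → ℤ)) := fun y hy => by
    rw [dualCone, hScone, dual_hull, mem_dual]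
    rintro _ ⟨s, hs, rfl⟩
    exact hy s hs
  let S' : Finset (Fin n → ℚ) := S.image toRat ∪ F.image fun f => -toRat f
  have hvS' : v ∉ hull ℚ (S' : Set (Fin n → ℚ)) := fun hmem => by
    have h1 : (S' : Set (Fin n → ℚ)) =
        toRat '' (S : Set (Fin n → ℤ)) ∪ (fun f => -toRat f) '' (F : Set (Fin n → ℤ)) := by
      simp [S']
    rw [h1, hull, Submodule.span_union] at hmem
    obtain ⟨a, ha, b, hb, rfl⟩ := Submodule.mem_sup.1 hmem
    have h2 : -b ∈ hull ℚ (toRat '' (F : Set (Fin n → ℤ))) := by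
      clear hv hmem
      induction hb using Submodule.span_induction with
      | mem b hb =>
        obtain ⟨f, hf, rfl⟩ := hb
        rw [neg_neg]
        exact Submodule.subset_span ⟨f, hf, rfl⟩
      | zero => simp
      | add a b _ _ ha hb => rw [neg_add]; exact add_mem ha hb
      | smul c a _ ha => rw [← smul_neg]; exact Submodule.smul_mem _ c ha
    refine hv _ h2 ?_
    rw [hScone, add_neg_cancel_right]
    exact ha
  have hspan : ∀ z, (∀ s ∈ S', s ⬝ᵥ z = 0) → z = 0 := fun z hz =>
    eq_zero_of_forall_toRat_dotProduct_eq_zero hgen fun m hm => by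
      rw [← hS] at hm
      induction hm using AddSubmonoid.closure_induction with
      | mem m hm =>
        exact hz _ (Finset.mem_union_left _ (Finset.mem_image_of_mem _ hm))
      | zero => simp
      | add a b _ _ ha hb => rw [toRat_add, add_dotProduct, ha, hb, add_zero]
  obtain ⟨y, hy, hvy, hyz⟩ := exists_extremal_dotProduct_neg S' hspan hvS'
  have hyσ : y ∈ dualCone (P : Set (Fin n → ℤ)) := hdual y fun s hs =>
    hy _ (Finset.mem_union_left _ (Finset.mem_image_of_mem _ hs))
  have hyF : ∀ f ∈ F, toRat f ⬝ᵥ y = 0 := fun f hf => by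
    have h1 := hy _ (Finset.mem_union_right _
      (Finset.mem_image_of_mem (fun f => -toRat f) hf))
    have h2 := mem_dualCone.1 hyσ f (hF f hf)
    rw [neg_dotProduct] at h1
    linarith
  obtain ⟨p, hp, c, hc, rfl⟩ := exists_isPrimitiveOnRay hgen
    (by rintro rfl; simp at hvy) hyσ fun z _ hz => hyz z fun s hs hsy => by
      rcases Finset.mem_union.1 hs with h | h
      · obtain ⟨m, hm, rfl⟩ := Finset.mem_image.1 h
        exact hz m (hSP m hm) hsy
      · obtain ⟨m, hm, rfl⟩ := Finset.mem_image.1 h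
        rw [neg_dotProduct, neg_eq_zero] at hsy ⊢
        exact hz m (hF m hm) hsy
  refine ⟨p, hp, fun f hf => ?_, ?_⟩
  · have := hyF f hf
    rw [dotProduct_smul, smul_eq_mul, mul_eq_zero, toRat_dotProduct] at this
    exact_mod_cast this.resolve_left hc.ne'
  · rw [dotProduct_smul, smul_eq_mul] at hvy
    by_contra! hcon
    exact hvy.not_ge (mul_nonneg hc.le hcon)

/-- The cone `σ^∨` is cut out by the rays of `σ`. -/
theorem mem_weightCone_of_forall_nonneg (hfg : P.FG)
    (hgen : AddSubgroup.closure (P : Set (Fin n → ℤ)) = ⊤) {v : Fin n → ℚ}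
    (hv : ∀ p, IsPrimitiveOnRay (P : Set (Fin n → ℤ)) p → 0 ≤ v ⬝ᵥ toRat p) :
    v ∈ weightCone (P : Set (Fin n → ℤ)) := by
  by_contra hcon
  obtain ⟨p, hp, -, h⟩ := exists_isPrimitiveOnRay_neg hfg hgen ∅ (by simp) (v := v)
    (fun u hu => by
      have : u = 0 := by simpa [hull] using hu
      rwa [this, add_zero])
  exact h.not_ge (hv p hp)

/-- A face `τ` of `σ^∨` is cut out by the rays of `σ` normal to `τ`. -/
theorem exists_isNormalRay_pos (hfg : P.FG)
    (hgen : AddSubgroup.closure (P : Set (Fin n → ℤ)) = ⊤) {τ : PointedCone ℚ (Fin n → ℚ)}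
    (hτ : τ.IsFaceOf (weightCone (P : Set (Fin n → ℤ)))) {v : Fin n → ℚ}
    (hv : v ∈ weightCone (P : Set (Fin n → ℤ))) (hvτ : v ∉ τ) :
    ∃ p, IsNormalRay (P : Set (Fin n → ℤ)) τ p ∧ 0 < v ⬝ᵥ toRat p := by
  classical
  obtain ⟨S, hS, -⟩ := exists_finset_weightCone_eq hfg
  have hSP : ∀ s ∈ S, s ∈ P := fun s hs => hS ▸ AddSubmonoid.subset_closure hs
  obtain ⟨p, hp, hpF, hneg⟩ := exists_isPrimitiveOnRay_neg hfg hgen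
    (S.filter fun s => toRat s ∈ τ) (fun f hf => hSP f (Finset.mem_filter.1 hf).1) (v := -v)
    (fun u hu hmem => by
      have huτ : u ∈ τ := by
        refine (Submodule.span_le (p := τ)).2 ?_ hu
        rintro _ ⟨f, hf, rfl⟩
        exact (Finset.mem_filter.1 (Finset.mem_coe.1 hf)).2
      exact hvτ (hτ.mem_of_add_mem_left hv hmem (by simpa using huτ)))
  refine ⟨p, ⟨hp, ?_⟩, by rw [neg_dotProduct] at hneg; linarith⟩
  have h1 : ∀ m ∈ P, toRat m ∈ τ → m ⬝ᵥ p = 0 := fun m hm hmτ => by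
    have hm' : m ∈ AddSubmonoid.closure (S : Set (Fin n → ℤ)) := hS ▸ hm
    clear hm
    induction hm' using AddSubmonoid.closure_induction with
    | mem m hm => exact hpF m (Finset.mem_filter.2 ⟨hm, hmτ⟩)
    | zero => simp
    | add a b ha hb iha ihb =>
      rw [hS] at ha hb
      rw [toRat_add] at hmτ
      rw [add_dotProduct, iha (hτ.mem_of_add_mem_left (toRat_mem_weightCone ha)
        (toRat_mem_weightCone hb) hmτ), ihb (hτ.mem_of_add_mem_right (toRat_mem_weightCone ha)
        (toRat_mem_weightCone hb) hmτ), add_zero]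
  intro w hw
  rw [← hull_toRat_image_eq P hτ] at hw
  induction hw using Submodule.span_induction with
  | mem w hw =>
    obtain ⟨m, ⟨hm, hmτ⟩, rfl⟩ := hw
    rw [toRat_dotProduct, h1 m hm hmτ, Int.cast_zero]
  | zero => simp
  | add a b _ _ ha hb => rw [add_dotProduct, ha, hb, add_zero]
  | smul c a _ ha =>
    have : c • a = (c : ℚ) • a := rfl
    rw [this, smul_dotProduct, ha, smul_zero]

theorem IsPrimitiveOnRay.exists_pos (hgen : AddSubgroup.closure (P : Set (Fin n → ℤ)) = ⊤)
    {p : Fin n → ℤ} (hp : IsPrimitiveOnRay (P : Set (Fin n → ℤ)) p) : ∃ m ∈ P, 0 < m ⬝ᵥ p := by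
  by_contra! hcon
  have h0 : toRat p = 0 := eq_zero_of_forall_toRat_dotProduct_eq_zero hgen fun m hm => by
    rw [toRat_dotProduct, le_antisymm (hcon m hm) (hp.nonneg hm), Int.cast_zero]
  have h2 := hp.1 0 fun i => by
    have : (p i : ℚ) = 0 := congrFun h0 i
    simpa using this
  simp at h2

/-- A ray of `σ` is determined by its zeros in `P`. -/
theorem IsPrimitiveOnRay.eq_of_forall (hfg : P.FG)
    (hgen : AddSubgroup.closure (P : Set (Fin n → ℤ)) = ⊤) {p q : Fin n → ℤ}
    (hp : IsPrimitiveOnRay (P : Set (Fin n → ℤ)) p) (hq : IsPrimitiveOnRay (P : Set (Fin n → ℤ)) q)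
    (h : ∀ m ∈ P, m ⬝ᵥ p = 0 → m ⬝ᵥ q = 0) : q = p := by
  obtain ⟨c, hc⟩ := hp.exists_eq_smul hfg (z := toRat q) fun m hm h0 => by
    rw [toRat_dotProduct, h m hm h0, Int.cast_zero]
  refine eq_of_primitive hq.1 hp.1 (c := c) ?_ hc
  obtain ⟨m, hm, hpos⟩ := hp.exists_pos hgen
  have h1 : toRat m ⬝ᵥ toRat q = c * (toRat m ⬝ᵥ toRat p) := by
    rw [hc, dotProduct_smul, smul_eq_mul]
  rw [toRat_dotProduct, toRat_dotProduct] at h1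
  have h2 : (0 : ℚ) ≤ (m ⬝ᵥ q : ℤ) := by exact_mod_cast hq.nonneg hm
  have h3 : (0 : ℚ) < (m ⬝ᵥ p : ℤ) := by exact_mod_cast hpos
  rw [h1] at h2
  exact nonneg_of_mul_nonneg_left h2 h3

theorem finite_setOf_isPrimitiveOnRay (hfg : P.FG)
    (hgen : AddSubgroup.closure (P : Set (Fin n → ℤ)) = ⊤) :
    {p | IsPrimitiveOnRay (P : Set (Fin n → ℤ)) p}.Finite := by
  classical
  obtain ⟨S, hS, -⟩ := exists_finset_weightCone_eq hfg
  refine Set.Finite.of_finite_image (f := fun p => S.filter fun s => s ⬝ᵥ p = 0)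
    ((Finset.finite_toSet S.powerset).subset ?_) fun p hp q hq hpq => ?_
  · rintro _ ⟨p, -, rfl⟩
    exact Finset.mem_coe.2 (Finset.mem_powerset.2 (Finset.filter_subset _ _))
  · refine (hp.eq_of_forall hfg hgen hq fun m hm h0 => ?_).symm
    have hm' : m ∈ AddSubmonoid.closure (S : Set (Fin n → ℤ)) := hS ▸ hm
    clear hm
    induction hm' using AddSubmonoid.closure_induction with
    | mem m hm =>
      have h1 : m ∈ S.filter fun s => s ⬝ᵥ p = 0 := Finset.mem_filter.2 ⟨hm, h0⟩
      rw [show (S.filter fun s => s ⬝ᵥ p = 0) = S.filter fun s => s ⬝ᵥ q = 0 from hpq] at h1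
      exact (Finset.mem_filter.1 h1).2
    | zero => simp
    | add a b ha hb iha ihb =>
      rw [hS] at ha hb
      have h1 := hp.nonneg ha
      have h2 := hp.nonneg hb
      rw [add_dotProduct] at h0 ⊢
      rw [iha (by omega), ihb (by omega), add_zero]

/-! ### Admissible roots -/

theorem IsAdmissible.add_mem (hfg : P.FG) (hgen : AddSubgroup.closure (P : Set (Fin n → ℤ)) = ⊤)
    {p e : Fin n → ℤ} (he : IsAdmissible (P : Set (Fin n → ℤ)) e)
    (hpe : IsDemazureRootAt (P : Set (Fin n → ℤ)) p e) {m : Fin n → ℤ} (hm : m ∈ P)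
    (hmp : 0 < m ⬝ᵥ p) : m + e ∈ P := by
  rw [add_comm]
  refine he m hm (mem_weightCone_of_forall_nonneg hfg hgen fun q hq => ?_)
  rw [toRat_dotProduct, add_dotProduct]
  have h1 := hq.nonneg hm
  by_cases hqp : q = p
  · subst hqp
    rw [hpe.2.1]
    exact_mod_cast (by omega : 0 ≤ -1 + m ⬝ᵥ q)
  · have := hpe.2.2 q hq hqp
    exact_mod_cast add_nonneg this h1

theorem IsAdmissible.add_nsmul_mem (hfg : P.FG)
    (hgen : AddSubgroup.closure (P : Set (Fin n → ℤ)) = ⊤)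
    {p e : Fin n → ℤ} (he : IsAdmissible (P : Set (Fin n → ℤ)) e)
    (hpe : IsDemazureRootAt (P : Set (Fin n → ℤ)) p e) {m : Fin n → ℤ} (hm : m ∈ P) {j : ℕ}
    (hj : (j : ℤ) ≤ m ⬝ᵥ p) : m + j • e ∈ P := by
  induction j with
  | zero => simpa using hm
  | succ j ih =>
    rw [succ_nsmul, ← add_assoc]
    push_cast at hj
    refine he.add_mem hfg hgen hpe (ih (by omega)) ?_
    rw [add_dotProduct, smul_dotProduct, hpe.2.1]
    simp only [nsmul_eq_mul, mul_neg, mul_one]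
    omega

/-- An admissible `τ`-root moves some point of `P` outside `τ` into `τ`, in one step. -/
theorem exists_add_mem_face (hfg : P.FG)
    (hgen : AddSubgroup.closure (P : Set (Fin n → ℤ)) = ⊤) {τ : PointedCone ℚ (Fin n → ℚ)}
    (hτ : τ.IsFaceOf (weightCone (P : Set (Fin n → ℤ)))) {p e : Fin n → ℤ}
    (he : IsAdmissible (P : Set (Fin n → ℤ)) e)
    (hpe : IsDemazureRootAt (P : Set (Fin n → ℤ)) p e)
    (hpτ : IsNormalRay (P : Set (Fin n → ℤ)) τ p)
    (heτ : ∀ q, IsNormalRay (P : Set (Fin n → ℤ)) τ q → q ≠ p → e ⬝ᵥ q = 0) :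
    ∃ m ∈ P, m ⬝ᵥ p = 1 ∧ toRat m ∉ τ ∧ m + e ∈ P ∧ toRat (m + e) ∈ τ := by
  classical
  -- `m₀` lies in the relative interior of `τ`
  obtain ⟨m₀, hm₀, hm₀τ, hm₀q⟩ : ∃ m₀ ∈ P, toRat m₀ ∈ τ ∧
      ∀ q, IsPrimitiveOnRay (P : Set (Fin n → ℤ)) q → ¬ IsNormalRay (P : Set (Fin n → ℤ)) τ q →
        0 < m₀ ⬝ᵥ q := by
    have h1 : ∀ q, IsPrimitiveOnRay (P : Set (Fin n → ℤ)) q →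
        ¬ IsNormalRay (P : Set (Fin n → ℤ)) τ q → ∃ m ∈ P, toRat m ∈ τ ∧ 0 < m ⬝ᵥ q := by
      intro q hq hqτ
      by_contra! hcon
      refine hqτ ⟨hq, fun w hw => ?_⟩
      rw [← hull_toRat_image_eq P hτ] at hw
      induction hw using Submodule.span_induction with
      | mem w hw =>
        obtain ⟨m, ⟨hm, hmτ⟩, rfl⟩ := hw
        rw [toRat_dotProduct, le_antisymm (hcon m hm hmτ) (hq.nonneg hm), Int.cast_zero]
      | zero => simp
      | add a b _ _ ha hb => rw [add_dotProduct, ha, hb, add_zero]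
      | smul c a _ ha =>
        have : c • a = (c : ℚ) • a := rfl
        rw [this, smul_dotProduct, ha, smul_zero]
    choose! g hgP hgτ hgq using h1
    have hfin : {q | IsPrimitiveOnRay (P : Set (Fin n → ℤ)) q ∧
        ¬ IsNormalRay (P : Set (Fin n → ℤ)) τ q}.Finite :=
      (finite_setOf_isPrimitiveOnRay hfg hgen).subset fun q hq => hq.1
    have hmem : ∀ q, q ∈ hfin.toFinset ↔ IsPrimitiveOnRay (P : Set (Fin n → ℤ)) q ∧
        ¬ IsNormalRay (P : Set (Fin n → ℤ)) τ q := fun q => by simp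
    refine ⟨∑ q ∈ hfin.toFinset, g q, sum_mem fun q hq => ?_, ?_, fun q hq hqτ => ?_⟩
    · exact hgP q ((hmem q).1 hq).1 ((hmem q).1 hq).2
    · have : toRat (∑ q ∈ hfin.toFinset, g q) = ∑ q ∈ hfin.toFinset, toRat (g q) :=
        map_sum (⟨⟨toRat, toRat_zero⟩, toRat_add⟩ : (Fin n → ℤ) →+ (Fin n → ℚ)) _ _
      rw [this]
      exact sum_mem fun q hq => hgτ q ((hmem q).1 hq).1 ((hmem q).1 hq).2
    · rw [sum_dotProduct]
      refine Finset.sum_pos' (fun q' hq' => hq.nonneg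
        (hgP q' ((hmem q').1 hq').1 ((hmem q').1 hq').2)) ⟨q, (hmem q).2 ⟨hq, hqτ⟩, hgq q hq hqτ⟩
  obtain ⟨N, hN⟩ : ∃ N : ℕ, ∀ q, IsPrimitiveOnRay (P : Set (Fin n → ℤ)) q → e ⬝ᵥ q ≤ N := by
    refine ⟨∑ q ∈ (finite_setOf_isPrimitiveOnRay hfg hgen).toFinset, (e ⬝ᵥ q).natAbs,
      fun q hq => ?_⟩
    have h1 := Finset.single_le_sum (f := fun q => (e ⬝ᵥ q).natAbs) (fun _ _ => Nat.zero_le _)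
      ((finite_setOf_isPrimitiveOnRay hfg hgen).mem_toFinset.2 hq)
    have h2 : e ⬝ᵥ q ≤ (e ⬝ᵥ q).natAbs := Int.le_natAbs
    exact h2.trans (by exact_mod_cast h1)
  have hzero : ∀ q, IsNormalRay (P : Set (Fin n → ℤ)) τ q → m₀ ⬝ᵥ q = 0 := fun q hq => by
    have := hq.2 _ hm₀τ
    rw [toRat_dotProduct] at this
    exact_mod_cast this
  have hw : toRat (N • m₀ - e) ∈ weightCone (P : Set (Fin n → ℤ)) := by
    refine mem_weightCone_of_forall_nonneg hfg hgen fun q hq => ?_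
    rw [toRat_dotProduct, sub_dotProduct, smul_dotProduct, nsmul_eq_mul]
    by_cases hqτ : IsNormalRay (P : Set (Fin n → ℤ)) τ q
    · rw [hzero q hqτ]
      by_cases hqp : q = p
      · subst hqp; rw [hpe.2.1]; simp
      · rw [heτ q hqτ hqp]; simp
    · have h1 := hN q hq
      have h2 := hm₀q q hq hqτ
      have h3 : (N : ℤ) ≤ N * (m₀ ⬝ᵥ q) := le_mul_of_one_le_right (by positivity) h2
      exact_mod_cast (by linarith : (0 : ℤ) ≤ N * (m₀ ⬝ᵥ q) - e ⬝ᵥ q)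
  obtain ⟨k, hk, hkP⟩ := exists_nsmul_mem_of_toRat_mem_hull P hw
  obtain ⟨k, rfl⟩ := Nat.exists_eq_succ_of_ne_zero hk.ne'
  have hkp : ((k + 1) • (N • m₀ - e)) ⬝ᵥ p = k + 1 := by
    rw [smul_dotProduct, sub_dotProduct, smul_dotProduct, hzero p hpτ, hpe.2.1]
    simp
  have hm1 : ((k + 1) • (N • m₀ - e) + k • e) ⬝ᵥ p = 1 := by
    rw [add_dotProduct, hkp, smul_dotProduct, hpe.2.1]
    simp
  have hmP := he.add_nsmul_mem hfg hgen hpe hkP (j := k) (by rw [hkp]; omega)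
  have hmeP := he.add_mem hfg hgen hpe hmP (by rw [hm1]; omega)
  refine ⟨_, hmP, hm1, fun hmem => ?_, hmeP, ?_⟩
  · have := hpτ.2 _ hmem
    rw [toRat_dotProduct, hm1] at this
    norm_num at this
  · by_contra hcon
    obtain ⟨q, hq, hpos⟩ := exists_isNormalRay_pos hfg hgen hτ (toRat_mem_weightCone hmeP) hcon
    rw [toRat_dotProduct, add_dotProduct, add_dotProduct, smul_dotProduct, smul_dotProduct,
      sub_dotProduct, smul_dotProduct, hzero q hq] at hpos
    by_cases hqp : q = p
    · subst hqp; rw [hpe.2.1] at hpos; simp at hpos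
    · rw [heτ q hq hqp] at hpos; simp at hpos

/-- An additive function on `P` with values in a field of characteristic zero that vanishes on
the zeros in `P` of a ray `p` is a multiple of the pairing with `p`. -/
theorem IsPrimitiveOnRay.mul_eq_mul {K : Type*} [Field K] [CharZero K] (hfg : P.FG)
    (hgen : AddSubgroup.closure (P : Set (Fin n → ℤ)) = ⊤) {p : Fin n → ℤ}
    (hp : IsPrimitiveOnRay (P : Set (Fin n → ℤ)) p) (c : (Fin n → ℤ) → K)
    (hc : ∀ a ∈ P, ∀ b ∈ P, c (a + b) = c a + c b) (hcp : ∀ m ∈ P, m ⬝ᵥ p = 0 → c m = 0)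
    {a b : Fin n → ℤ} (ha : a ∈ P) (hb : b ∈ P) :
    c a * ((b ⬝ᵥ p : ℤ) : K) = c b * ((a ⬝ᵥ p : ℤ) : K) := by
  -- extend `c` to the lattice
  obtain ⟨C, hC⟩ : ∃ C : Fin n → K, ∀ m ∈ P, c m = ∑ i, (m i : K) * C i := by
    have h1 : ∀ g : Fin n → ℤ, ∃ x ∈ P, ∃ y ∈ P, g = x - y := fun g => by
      have hg : g ∈ AddSubgroup.closure (P : Set (Fin n → ℤ)) := hgen ▸ AddSubgroup.mem_top g
      induction hg using AddSubgroup.closure_induction with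
      | mem m hm => exact ⟨m, hm, 0, zero_mem _, by simp⟩
      | zero => exact ⟨0, zero_mem _, 0, zero_mem _, by simp⟩
      | add a b _ _ ha hb =>
        obtain ⟨x, hx, y, hy, rfl⟩ := ha
        obtain ⟨x', hx', y', hy', rfl⟩ := hb
        exact ⟨x + x', add_mem hx hx', y + y', add_mem hy hy', by abel⟩
      | neg a _ ha =>
        obtain ⟨x, hx, y, hy, rfl⟩ := ha
        exact ⟨y, hy, x, hx, by abel⟩
    choose x hx y hy hxy using h1
    have h2 : ∀ g, ∀ u ∈ P, ∀ v ∈ P, g = u - v → c (x g) - c (y g) = c u - c v := by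
      intro g u hu v hv huv
      have h3 : x g + v = u + y g := by
        have := (hxy g).symm.trans huv
        rw [sub_eq_sub_iff_add_eq_add] at this
        exact this
      have h4 := hc _ (hx g) _ hv
      rw [h3, hc _ hu _ (hy g)] at h4
      linear_combination -h4
    let D : (Fin n → ℤ) →+ K := AddMonoidHom.mk' (fun g => c (x g) - c (y g)) fun g h => by
      rw [h2 (g + h) (x g + x h) (add_mem (hx g) (hx h)) (y g + y h) (add_mem (hy g) (hy h))
        (by conv_lhs => rw [hxy g, hxy h]
            abel), hc _ (hx g) _ (hx h), hc _ (hy g) _ (hy h)]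
      ring
    refine ⟨fun i => D (Pi.single i 1), fun m hm => ?_⟩
    have h5 : D m = c m := by
      have := h2 m m hm 0 (zero_mem _) (by simp)
      have h0 : c 0 = 0 := by simpa using hc 0 (zero_mem _) 0 (zero_mem _)
      rw [h0, sub_zero] at this
      exact this
    have h6 : m = ∑ i, m i • (Pi.single i 1 : Fin n → ℤ) := by
      ext j
      simp [Finset.sum_apply, Pi.single_apply]
    rw [← h5]
    conv_lhs => rw [h6, map_sum]
    exact Finset.sum_congr rfl fun i _ => by rw [map_zsmul, zsmul_eq_mul]
  -- test the claim on `ℚ`-linear functionals of `K`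
  rw [← sub_eq_zero, ← Module.forall_dual_apply_eq_zero_iff ℚ]
  intro l
  have hl : ∀ m ∈ P, l (c m) = toRat m ⬝ᵥ fun i => l (C i) := fun m hm => by
    rw [hC m hm, map_sum]
    refine Finset.sum_congr rfl fun i _ => ?_
    rw [← zsmul_eq_mul, map_zsmul, zsmul_eq_mul]
    rfl
  obtain ⟨κ, hκ⟩ := hp.exists_eq_smul hfg (z := fun i => l (C i)) fun m hm h0 => by
    rw [← hl m hm, hcp m hm h0, map_zero]
  rw [map_sub, mul_comm, ← zsmul_eq_mul, map_zsmul, mul_comm (c b), ← zsmul_eq_mul, map_zsmul,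
    hl a ha, hl b hb, hκ, dotProduct_smul, dotProduct_smul, toRat_dotProduct, toRat_dotProduct]
  simp only [zsmul_eq_mul, smul_eq_mul]
  ring

end WeightCone

/-! ### Points of affine varieties -/

section Points

variable {K A : Type u} [Field K] [CommRing A] [Algebra K A]

/-- The weak Nullstellensatz: maximal ideals are kernels of points. -/
theorem exists_algHom_ker_eq [IsAlgClosed K] [Algebra.FiniteType K A] (m : Ideal A)
    [hm : m.IsMaximal] : ∃ x : A →ₐ[K] K, RingHom.ker x = m := by
  let _ := Ideal.Quotient.field m
  have := finite_of_finite_type_of_isJacobsonRing K (A ⧸ m)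
  let e : K ≃ₐ[K] (A ⧸ m) := AlgEquiv.ofBijective (Algebra.ofId K (A ⧸ m))
    IsAlgClosed.algebraMap_bijective_of_isIntegral
  refine ⟨e.symm.toAlgHom.comp (Ideal.Quotient.mkₐ K m), ?_⟩
  ext a
  simp [RingHom.mem_ker, Ideal.Quotient.eq_zero_iff_mem]

/-- A function on a variety that vanishes at all points is zero. -/
theorem eq_zero_of_forall_algHom [IsAlgClosed K] [Algebra.FiniteType K A] [IsReduced A] {a : A}
    (h : ∀ x : A →ₐ[K] K, x a = 0) : a = 0 := by
  have := isJacobsonRing_of_finiteType (A := K) (B := A)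
  have h1 : a ∈ (⊥ : Ideal A).jacobson := by
    rw [Ideal.jacobson, Ideal.mem_sInf]
    rintro m ⟨-, hm⟩
    obtain ⟨x, hx⟩ := exists_algHom_ker_eq (K := K) m
    rw [← hx]
    exact h x
  rw [(isJacobsonRing_iff.1 this) ⊥ (by
    rw [Ideal.isRadical_iff_quotient_reduced]
    exact isReduced_of_injective (RingEquiv.quotientBot A) (RingEquiv.quotientBot A).injective)]
    at h1
  simpa using h1

theorem mem_closure_iff {Z : Set (Points K A)} {y : Points K A} :
    y ∈ closure Z ↔ ∀ f : A, (∀ x ∈ Z, x.eval f = 0) → y.eval f = 0 := by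
  rw [(Topology.IsInducing.mk rfl : Topology.IsInducing
    (Points.toPrimeSpectrum (K := K) (A := A))).closure_eq_preimage_closure_image, Set.mem_preimage,
    ← PrimeSpectrum.zeroLocus_vanishingIdeal_eq_closure, PrimeSpectrum.mem_zeroLocus]
  refine forall_congr' fun f => imp_congr ?_ Iff.rfl
  rw [SetLike.mem_coe, PrimeSpectrum.mem_vanishingIdeal]
  simp only [Set.forall_mem_image]
  rfl

/-- A function that vanishes on a nonempty open subset is zero. -/
theorem eq_zero_of_isOpen [IsAlgClosed K] [Algebra.FiniteType K A] [IsDomain A]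
    {U : Set (Points K A)} (hU : IsOpen U) {x : Points K A} (hx : x ∈ U) {f : A}
    (hf : ∀ y ∈ U, y.eval f = 0) : f = 0 := by
  by_contra hf0
  -- otherwise a function `g` that vanishes exactly off `U` at most has `f * g = 0`
  have h1 : x ∉ closure Uᶜ := by
    rw [closure_compl, hU.interior_eq]
    exact fun h => h hx
  rw [mem_closure_iff] at h1
  push Not at h1
  obtain ⟨g, hg, hgx⟩ := h1
  have h2 : f * g = 0 := eq_zero_of_forall_algHom (K := K) fun y => by
    rw [map_mul]
    by_cases hy : (show Points K A from y) ∈ U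
    · rw [show y f = 0 from hf y hy, zero_mul]
    · rw [show y g = 0 from hg y hy, mul_zero]
  rcases mul_eq_zero.1 h2 with h | h
  · exact hf0 h
  · exact hgx (by rw [h]; exact map_zero (show A →ₐ[K] K from x))

end Points

/-! ### Characters of the torus -/

section Characters

variable {K : Type u} [Field K] {n : ℕ}

theorem character_add (a b : Fin n → ℤ) (t : Fin n → Kˣ) :
    character (a + b) t = character a t * character b t := by
  simp [character, zpow_add, Finset.prod_mul_distrib]

@[simp] theorem character_zero (t : Fin n → Kˣ) : character 0 t = 1 := by
  simp [character]

@[simp] theorem character_one (m : Fin n → ℤ) : character m (1 : Fin n → Kˣ) = 1 := by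
  simp [character]

theorem character_mul (m : Fin n → ℤ) (s t : Fin n → Kˣ) :
    character m (s * t) = character m s * character m t := by
  simp [character, mul_zpow, Finset.prod_mul_distrib]

theorem character_ne_zero (m : Fin n → ℤ) (t : Fin n → Kˣ) : character m t ≠ 0 :=
  Units.ne_zero _

/-- The character `χ^m` as a homomorphism. -/
def characterHom (m : Fin n → ℤ) : (Fin n → Kˣ) →* K where
  toFun := character m
  map_one' := character_one m
  map_mul' := character_mul m

theorem characterHom_injective [CharZero K] :
    Function.Injective (characterHom : (Fin n → ℤ) → (Fin n → Kˣ) →* K) := fun a b hab => by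
  ext i
  have h2 : (2 : K) ≠ 0 := two_ne_zero
  have h := DFunLike.congr_fun hab (Pi.mulSingle i (Units.mk0 2 h2))
  have key : ∀ m : Fin n → ℤ, characterHom m (Pi.mulSingle i (Units.mk0 (2 : K) h2)) =
      (((2 : ℚ) ^ m i : ℚ) : K) := fun m => by
    change ((∏ j, (Pi.mulSingle i (Units.mk0 (2 : K) h2) : Fin n → Kˣ) j ^ m j : Kˣ) : K) = _
    rw [Finset.prod_eq_single i]
    · simp
    · intro j _ hj; simp [hj]
    · simp
  rw [key, key] at h
  exact zpow_right_injective₀ (by norm_num : (0 : ℚ) < 2) (by norm_num) (Rat.cast_injective h)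

/-- Distinct characters are linearly independent, also with coefficients in a `K`-module. -/
theorem eq_zero_of_sum_character_smul [CharZero K] {V : Type*} [AddCommGroup V] [Module K V]
    (c : (Fin n → ℤ) →₀ V) (h : ∀ t : Fin n → Kˣ, (c.sum fun m v => character m t • v) = 0) :
    c = 0 := by
  have hli := (linearIndependent_monoidHom (Fin n → Kˣ) K).comp _
    (characterHom_injective (K := K) (n := n))
  ext m
  rw [Finsupp.zero_apply, ← Module.forall_dual_apply_eq_zero_iff K]
  intro l
  have h1 := linearIndependent_iff.1 hli (c.mapRange l (map_zero l)) (by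
    ext t
    have h2 := congrArg l (h t)
    rw [Finsupp.sum, map_sum, map_zero] at h2
    rw [Finsupp.linearCombination_apply, Finsupp.sum_mapRange_index (by simp), Finsupp.sum,
      Finset.sum_apply]
    simp only [Pi.zero_apply]
    rw [← h2]
    refine Finset.sum_congr rfl fun m _ => ?_
    rw [map_smul, smul_eq_mul, mul_comm]
    rfl)
  simpa using DFunLike.congr_fun h1 m

theorem baer_additive_units [IsAlgClosed K] [CharZero K] : Module.Baer ℤ (Additive Kˣ) := by
  have h : ∀ (u : Kˣ) (k : ℤ), k ≠ 0 → ∃ v : Kˣ, v ^ k = u := fun u k hk => by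
    have hpos : 0 < k.natAbs := Int.natAbs_pos.2 hk
    obtain ⟨z, hz⟩ := IsAlgClosed.exists_pow_nat_eq (u : K) hpos
    have hz0 : z ≠ 0 := by
      rintro rfl
      rw [zero_pow hpos.ne'] at hz
      exact u.ne_zero hz.symm
    have h1 : (Units.mk0 z hz0) ^ k.natAbs = u := Units.ext (by simpa using hz)
    rcases Int.natAbs_eq k with h | h
    · exact ⟨Units.mk0 z hz0, by rw [h, zpow_natCast, h1]⟩
    · exact ⟨(Units.mk0 z hz0)⁻¹, by rw [h, inv_zpow', neg_neg, zpow_natCast, h1]⟩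
  let _ : DivisibleBy (Additive Kˣ) ℤ :=
    { div := fun u k => if hk : k = 0 then 0 else Additive.ofMul (h u.toMul k hk).choose
      div_zero := fun u => by simp
      div_cancel := fun {k} u hk => by
        simp only [hk, dite_false]
        exact (h u.toMul k hk).choose_spec }
  exact Module.Baer.of_divisible _

theorem exists_character_eq (F : (Fin n → ℤ) →+ Additive Kˣ) :
    ∃ t : Fin n → Kˣ, ∀ m, character m t = ((F m).toMul : Kˣ) := by
  refine ⟨fun i => (F (Pi.single i 1)).toMul, fun m => ?_⟩
  have h6 : m = ∑ i, m i • (Pi.single i 1 : Fin n → ℤ) := by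
    ext j
    simp [Finset.sum_apply, Pi.single_apply]
  conv_rhs => rw [h6, map_sum]
  rw [character]
  congr 1
  rw [toMul_sum]
  exact Finset.prod_congr rfl fun i _ => by rw [map_zsmul, toMul_zsmul]

/-- A homomorphism from a subgroup of the character lattice to `Kˣ` is evaluation at an element of
the torus, because `Kˣ` is divisible. -/
theorem exists_character_eq_of_subgroup [IsAlgClosed K] [CharZero K]
    (H : AddSubgroup (Fin n → ℤ)) (g : H →+ Additive Kˣ) :
    ∃ t : Fin n → Kˣ, ∀ m : H, character (m : Fin n → ℤ) t = ((g m).toMul : Kˣ) := by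
  obtain ⟨F, hF⟩ := (baer_additive_units (K := K)).extension_property_addMonoidHom H.subtype
    H.subtype_injective g
  obtain ⟨t, ht⟩ := exists_character_eq F
  exact ⟨t, fun m => by rw [ht, ← hF]; rfl⟩

/-- A proper subgroup of the character lattice is trivial on a nontrivial element of the torus. -/
theorem exists_ne_one_of_ne_top [IsAlgClosed K] [CharZero K]
    {H : AddSubgroup (Fin n → ℤ)} (hH : H ≠ ⊤) :
    ∃ t : Fin n → Kˣ, t ≠ 1 ∧ ∀ m ∈ H, character m t = 1 := by
  obtain ⟨v, hv⟩ : ∃ v, v ∉ H := by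
    by_contra! h
    exact hH ((AddSubgroup.eq_top_iff' H).2 h)
  let q : (Fin n → ℤ) →+ (Fin n → ℤ) ⧸ H := QuotientAddGroup.mk' H
  have hqv : q v ≠ 0 := fun h => hv ((QuotientAddGroup.eq_zero_iff v).1 h)
  -- a root of unity whose order is the order of `v` modulo `H` (or `2`, if that order is infinite)
  obtain ⟨ζ, hζ1, hζ⟩ : ∃ ζ : Kˣ, ζ ≠ 1 ∧ ∀ j : ℤ, j • q v = 0 → ζ ^ j = 1 := by
    rcases Nat.eq_zero_or_pos (addOrderOf (q v)) with h0 | hpos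
    · refine ⟨Units.mk0 2 two_ne_zero, fun h => ?_, fun j hj => ?_⟩
      · have := congrArg Units.val h
        norm_num at this
      · rw [← addOrderOf_dvd_iff_zsmul_eq_zero, h0, Nat.cast_zero, zero_dvd_iff] at hj
        rw [hj, zpow_zero]
    · have : NeZero ((addOrderOf (q v) : ℕ) : K) := ⟨by exact_mod_cast hpos.ne'⟩
      obtain ⟨ζ, hζ⟩ := HasEnoughRootsOfUnity.exists_primitiveRoot K (addOrderOf (q v))
      have hζu := hζ.isUnit hpos.ne'
      refine ⟨hζu.unit, fun h => ?_, fun j hj => ?_⟩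
      · have h1 : ζ = 1 := by simpa using congrArg Units.val h
        rw [h1] at hζ
        have := IsPrimitiveRoot.unique hζ IsPrimitiveRoot.one
        exact hqv (AddMonoid.addOrderOf_eq_one_iff.1 this)
      · obtain ⟨k, rfl⟩ := addOrderOf_dvd_iff_zsmul_eq_zero.2 hj
        have h1 : hζu.unit ^ addOrderOf (q v) = 1 := Units.ext (by simpa using hζ.pow_eq_one)
        rw [zpow_mul, zpow_natCast, h1, one_zpow]
  let f : ℤ →ₗ[ℤ] (Fin n → ℤ) ⧸ H := LinearMap.toSpanSingleton ℤ _ (q v)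
  let g : ℤ →ₗ[ℤ] Additive Kˣ := LinearMap.toSpanSingleton ℤ _ (Additive.ofMul ζ)
  have hfg : LinearMap.ker f ≤ LinearMap.ker g := fun j hj => by
    rw [LinearMap.mem_ker] at hj ⊢
    exact congrArg Additive.ofMul (hζ j hj)
  obtain ⟨F, hF⟩ := (baer_additive_units (K := K)).extension_property
    ((LinearMap.ker f).liftQ f le_rfl)
    (LinearMap.ker_eq_bot.1 (Submodule.ker_liftQ_eq_bot _ _ _ le_rfl))
    ((LinearMap.ker f).liftQ g hfg)
  have hFv : F (q v) = Additive.ofMul ζ := by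
    have : F (f 1) = g 1 := LinearMap.congr_fun hF (Submodule.Quotient.mk 1)
    simpa [f, g] using this
  obtain ⟨t, ht⟩ := exists_character_eq (F.toAddMonoidHom.comp q)
  refine ⟨t, ?_, fun m hm => ?_⟩
  · rintro rfl
    have h1 := ht v
    rw [character_one] at h1
    refine hζ1 (Units.ext ?_)
    have h2 : (F.toAddMonoidHom.comp q) v = Additive.ofMul ζ := hFv
    rw [h2] at h1
    exact h1.symm
  · rw [ht]
    have : q m = 0 := (QuotientAddGroup.eq_zero_iff m).2 hm
    simp [this]

end Characters

/-! ### Coordinates on a toric variety -/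

section Coordinates

variable {K A : Type u} [Field K] [CommRing A] [Algebra K A] {n : ℕ}

/-- The monomial `χ^m` in an algebra `A` that is identified with the monoid algebra of `P`. -/
noncomputable def monomial {P : AddSubmonoid (Fin n → ℤ)} (e : AddMonoidAlgebra K P ≃ₐ[K] A)
    (m : P) : A :=
  e (AddMonoidAlgebra.single m 1)

section Monomial

variable {P : AddSubmonoid (Fin n → ℤ)} (e : AddMonoidAlgebra K P ≃ₐ[K] A)

theorem monomial_zero : monomial e 0 = 1 := map_one e

theorem monomial_add (a b : P) : monomial e (a + b) = monomial e a * monomial e b := by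
  rw [monomial, monomial, monomial, ← map_mul, AddMonoidAlgebra.single_mul_single, one_mul]

/-- The coefficient of `χ^k` in `f`, which is zero if `k ∉ P`. -/
noncomputable def monomialCoeff (k : Fin n → ℤ) : A →ₗ[K] K := by
  classical
  exact if h : k ∈ P then
    { toFun := fun f => (e.symm f).coeff ⟨k, h⟩
      map_add' := fun f g => by simp
      map_smul' := fun c f => by simp }
  else 0

theorem monomialCoeff_of_notMem {k : Fin n → ℤ} (h : k ∉ P) (f : A) : monomialCoeff e k f = 0 := by
  simp [monomialCoeff, h]

theorem monomialCoeff_coe (k : P) (f : A) : monomialCoeff e k f = (e.symm f).coeff k := by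
  simp [monomialCoeff]

theorem monomialCoeff_monomial (k : Fin n → ℤ) (m : P) [Decidable (k = m)] :
    monomialCoeff e k (monomial e m) = if k = m then 1 else 0 := by
  by_cases h : k ∈ P
  · lift k to P using h
    rw [monomialCoeff_coe, monomial, AlgEquiv.symm_apply_apply, AddMonoidAlgebra.coeff_single,
      Finsupp.single_apply]
    simp [eq_comm]
  · rw [monomialCoeff_of_notMem e h, if_neg]
    rintro rfl
    exact h m.2

theorem sum_monomialCoeff_smul (f : A) :
    ((e.symm f).coeff.sum fun m c => c • monomial e m) = f := by
  conv_rhs => rw [← e.apply_symm_apply f]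
  have := AddMonoidAlgebra.lift_unique (e : AddMonoidAlgebra K P →ₐ[K] A) (e.symm f)
  exact this.symm

theorem span_range_monomial : Submodule.span K (Set.range (monomial e)) = ⊤ := by
  refine eq_top_iff.2 fun f _ => ?_
  rw [← sum_monomialCoeff_smul e f]
  exact sum_mem fun m _ => Submodule.smul_mem _ _ (Submodule.subset_span ⟨m, rfl⟩)

theorem eq_of_monomialCoeff_eq {f g : A} (h : ∀ m : P, monomialCoeff e m f = monomialCoeff e m g) :
    f = g := by
  refine e.symm.injective ?_
  ext m
  rw [← monomialCoeff_coe, ← monomialCoeff_coe, h]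

/-- A linear map is determined by its values on monomials. -/
theorem linearMap_ext_monomial {V : Type*} [AddCommMonoid V] [Module K V] {f g : A →ₗ[K] V}
    (h : ∀ m, f (monomial e m) = g (monomial e m)) : f = g :=
  LinearMap.ext_on (span_range_monomial e) (by rintro _ ⟨m, rfl⟩; exact h m)

theorem algHom_ext_monomial {B : Type*} [Semiring B] [Algebra K B] {f g : A →ₐ[K] B}
    (h : ∀ m, f (monomial e m) = g (monomial e m)) : f = g :=
  AlgHom.toLinearMap_injective (linearMap_ext_monomial e h)

/-- The algebra homomorphism with prescribed multiplicative values on monomials. -/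
noncomputable def monomialLift {B : Type*} [Semiring B] [Algebra K B]
    (F : Multiplicative P →* B) : A →ₐ[K] B :=
  (AddMonoidAlgebra.lift K B P F).comp e.symm.toAlgHom

@[simp] theorem monomialLift_monomial {B : Type*} [Semiring B] [Algebra K B]
    (F : Multiplicative P →* B) (m : P) :
    monomialLift e F (monomial e m) = F (Multiplicative.ofAdd m) := by
  simp [monomialLift, monomial]

theorem monomialCoeff_monomial_mul (a : P) (k : Fin n → ℤ) (f : A) :
    monomialCoeff e (a + k) (monomial e a * f) = monomialCoeff e k f := by
  classical
  have h : (monomialCoeff e (a + k)).comp (LinearMap.mulLeft K (monomial e a)) =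
      monomialCoeff e k := linearMap_ext_monomial e fun m => by
    rw [LinearMap.comp_apply, LinearMap.mulLeft_apply, ← monomial_add, monomialCoeff_monomial,
      monomialCoeff_monomial]
    simp
  exact LinearMap.congr_fun h f

end Monomial

variable [IsDomain A]

/-- The coordinate algebra of a toric variety is the monoid algebra of its weight monoid `P`, with
`T` acting on monomials by characters; moreover `P` is finitely generated, and it generates the
character lattice because the action is effective. -/
theorem TorusAction.IsToric.exists_monoidAlgebra_equiv [IsAlgClosed K] [CharZero K]
    [Algebra.FiniteType K A] {T : TorusAction K A n} (hT : T.IsToric) :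
    ∃ (P : AddSubmonoid (Fin n → ℤ)) (e : AddMonoidAlgebra K P ≃ₐ[K] A),
      (P : Set (Fin n → ℤ)) = T.weightMonoid ∧ P.FG ∧
      AddSubgroup.closure (P : Set (Fin n → ℤ)) = ⊤ ∧
      ∀ t (m : P), T.act t (monomial e m) = character (m : Fin n → ℤ) t • monomial e m := by
  classical
  obtain ⟨heff, x, hx⟩ := hT
  -- evaluation at the base point of the open orbit is injective on functions of a given weight
  have hzero : ∀ f : A, (∀ t, x.eval (T.act t f) = 0) → f = 0 := fun f hf =>
    eq_zero_of_isOpen hx (x := x.map (T.act 1)) ⟨1, rfl⟩ (by rintro _ ⟨t, rfl⟩; exact hf t)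
  have hevz : ∀ m, ∀ f ∈ T.weightSpace m, x.eval f = 0 → f = 0 := fun m f hf h =>
    hzero f fun t => by
      rw [hf t]
      exact (map_smul (show A →ₐ[K] K from x) _ _).trans (by
        rw [show (show A →ₐ[K] K from x) f = 0 from h, smul_zero])
  have hdecomp : ∀ f : A, ∃ c : (Fin n → ℤ) →₀ A, (∀ m, c m ∈ T.weightSpace m) ∧
      f = c.sum fun _ a => a := fun f => by
    obtain ⟨c, hc⟩ := T.regular f
    refine ⟨c, fun m s => ?_, ?_⟩
    · have h1 := eq_zero_of_sum_character_smul
        (Finsupp.onFinset c.support (fun m => T.act s (c m) - character m s • c m) fun m hm => by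
          rw [Finsupp.mem_support_iff]
          intro h
          simp [h] at hm) (fun t => by
        rw [Finsupp.onFinset_sum _ (fun m => smul_zero (character m t : K))]
        have h2 : T.act s (T.act t f) = T.act (s * t) f := by rw [map_mul]; rfl
        rw [hc t, hc (s * t), Finsupp.sum, Finsupp.sum, map_sum] at h2
        rw [← sub_eq_zero, ← Finset.sum_sub_distrib] at h2
        rw [← h2]
        refine Finset.sum_congr rfl fun m _ => ?_
        rw [map_smul, smul_sub, character_mul, mul_comm (character m s), mul_smul])
      have h2 := DFunLike.congr_fun h1 m
      simpa [sub_eq_zero] using h2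
    · have := hc 1
      simpa using this
  have hne : ∀ m ∈ T.weightMonoid, ∃ f ∈ T.weightSpace m, x.eval f = 1 := by
    rintro m ⟨f, hf, hf0⟩
    have h1 : x.eval f ≠ 0 := fun h => hf0 (hevz m f hf h)
    refine ⟨(x.eval f)⁻¹ • f, fun t => ?_, ?_⟩
    · rw [map_smul, hf t, smul_comm]
    · exact (map_smul (show A →ₐ[K] K from x) _ _).trans (inv_mul_cancel₀ h1)
  have hmul : ∀ a b, ∀ f ∈ T.weightSpace a, ∀ g ∈ T.weightSpace b, f * g ∈ T.weightSpace (a + b) :=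
    fun a b f hf g hg t => by
      rw [map_mul, hf t, hg t, character_add, smul_mul_smul_comm]
  have hone : (1 : A) ∈ T.weightSpace 0 := fun t => by simp
  let P : AddSubmonoid (Fin n → ℤ) :=
    { carrier := T.weightMonoid
      zero_mem' := ⟨1, hone, one_ne_zero⟩
      add_mem' := by
        rintro a b ⟨f, hf, hf0⟩ ⟨g, hg, hg0⟩
        exact ⟨f * g, hmul a b f hf g hg, mul_ne_zero hf0 hg0⟩ }
  choose! χ hχ hχ1 using hne
  have huniq : ∀ m, ∀ f ∈ T.weightSpace m, ∀ g ∈ T.weightSpace m, x.eval f = x.eval g → f = g := by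
    intro m f hf g hg hfg
    rw [← sub_eq_zero]
    refine hevz m _ (fun t => by rw [map_sub, hf t, hg t, smul_sub]) ?_
    exact (map_sub (show A →ₐ[K] K from x) _ _).trans (sub_eq_zero.2 hfg)
  let F : Multiplicative P →* A :=
    { toFun := fun m => χ m.toAdd
      map_one' := huniq 0 _ (hχ 0 P.zero_mem) _ hone
        ((hχ1 0 P.zero_mem).trans (map_one (show A →ₐ[K] K from x)).symm)
      map_mul' := fun a b => by
        refine huniq _ _ (hχ _ (a * b).toAdd.2) _
          (hmul _ _ _ (hχ _ a.toAdd.2) _ (hχ _ b.toAdd.2)) ?_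
        rw [hχ1 _ (a * b).toAdd.2]
        refine ((map_mul (show A →ₐ[K] K from x) _ _).trans ?_).symm
        exact (congrArg₂ (· * ·) (hχ1 _ a.toAdd.2) (hχ1 _ b.toAdd.2)).trans (one_mul 1) }
  have hsurj : Function.Surjective (AddMonoidAlgebra.lift K A P F) := fun f => by
    obtain ⟨c, hc, rfl⟩ := hdecomp f
    change _ ∈ (AddMonoidAlgebra.lift K A P F).range
    refine sum_mem fun m _ => ?_
    by_cases hm : m ∈ P
    · refine ⟨AddMonoidAlgebra.single ⟨m, hm⟩ (x.eval (c m)), ?_⟩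
      refine huniq m _ (fun t => ?_) _ (hc m) ?_
      · simp only [AlgHom.toRingHom_eq_coe, RingHom.coe_coe, AddMonoidAlgebra.lift_single, map_smul]
        rw [show T.act t (F (Multiplicative.ofAdd ⟨m, hm⟩)) = _ from hχ m hm t, smul_comm]
        rfl
      · simp only [AlgHom.toRingHom_eq_coe, RingHom.coe_coe, AddMonoidAlgebra.lift_single]
        exact (map_smul (show A →ₐ[K] K from x) _ _).trans
          ((congrArg (x.eval (c m) * ·) (hχ1 m hm)).trans (mul_one _))
    · have : c m = 0 := by
        by_contra h
        exact hm ⟨c m, hc m, h⟩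
      rw [this]
      exact zero_mem _
  have hact : ∀ t m, T.act t (F m) = character (m.toAdd : Fin n → ℤ) t • F m := fun t m =>
    hχ _ m.toAdd.2 t
  have hinj : Function.Injective (AddMonoidAlgebra.lift K A P F) := by
    rw [injective_iff_map_eq_zero]
    intro f hf
    have h1 := eq_zero_of_sum_character_smul
      (f.coeff.embDomain (Function.Embedding.subtype (· ∈ P))) (fun t => by
        rw [Finsupp.sum_embDomain]
        have h2 : (show A →ₐ[K] K from x) (T.act t (AddMonoidAlgebra.lift K A P F f)) = 0 := by
          rw [hf, map_zero, map_zero]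
        rw [AddMonoidAlgebra.lift_apply, Finsupp.sum, map_sum, map_sum] at h2
        rw [Finsupp.sum, ← h2]
        refine Finset.sum_congr rfl fun m _ => ?_
        rw [map_smul, hact, map_smul, map_smul,
          show (show A →ₐ[K] K from x) (F (Multiplicative.ofAdd m)) = 1 from hχ1 _ m.2]
        simp [mul_comm])
    rw [Finsupp.embDomain_eq_zero] at h1
    ext m
    rw [h1]
    rfl
  let e : AddMonoidAlgebra K P ≃ₐ[K] A := AlgEquiv.ofBijective _ ⟨hinj, hsurj⟩
  have hmono : ∀ m : P, monomial e m = F (Multiplicative.ofAdd m) := fun m =>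
    (AddMonoidAlgebra.lift_single F m 1).trans (one_smul K _)
  refine ⟨P, e, rfl, ?_, ?_, fun t m => ?_⟩
  · have : Algebra.FiniteType K (AddMonoidAlgebra K P) :=
      Algebra.FiniteType.equiv inferInstance e.symm
    exact (AddMonoid.fg_iff_addSubmonoid_fg P).1 (AddMonoidAlgebra.fg_of_finiteType (R := K))
  · by_contra hcon
    obtain ⟨t, ht1, ht⟩ := exists_ne_one_of_ne_top (K := K) hcon
    refine ht1 (heff ?_)
    rw [map_one]
    ext f
    have : (T.act t).toAlgHom = AlgHom.id K A := algHom_ext_monomial e fun m => by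
      rw [hmono]
      refine (hact t _).trans ?_
      rw [ht _ (AddSubgroup.subset_closure (Multiplicative.ofAdd m).toAdd.2), one_smul]
      rfl
    exact DFunLike.congr_fun this f
  · rw [hmono]
    exact hact t _

end Coordinates

/-! ### Homogeneous derivations -/

section Derivations

variable {n : ℕ}

/-- The only way a homogeneous derivation of degree `e` can move a monomial outside the face `τ`
into `τ` is that `e` is an admissible `τ`-root. Here `c m` is the coefficient of `χ^(m+e)` in the
derivative of `χ^m`. -/
theorem isFaceRoot_and_isAdmissible_of_ne_zero {K : Type*} [Field K] [CharZero K]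
    {P : AddSubmonoid (Fin n → ℤ)} (hfg : P.FG)
    (hgen : AddSubgroup.closure (P : Set (Fin n → ℤ)) = ⊤) {τ : PointedCone ℚ (Fin n → ℚ)}
    (hτ : τ.IsFaceOf (weightCone (P : Set (Fin n → ℤ)))) {e : Fin n → ℤ} (c : (Fin n → ℤ) → K)
    (hc : ∀ a ∈ P, ∀ b ∈ P, c (a + b) = c a + c b) (hcP : ∀ a ∈ P, a + e ∉ P → c a = 0)
    {m : Fin n → ℤ} (hm : m ∈ P) (hcm : c m ≠ 0) (hmτ : toRat m ∉ τ) (hmeτ : toRat (m + e) ∈ τ) :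
    IsFaceRoot (P : Set (Fin n → ℤ)) τ e ∧ IsAdmissible (P : Set (Fin n → ℤ)) e := by
  obtain ⟨p, hp, hpos⟩ := exists_isNormalRay_pos hfg hgen hτ (toRat_mem_weightCone hm) hmτ
  have hmp : 0 < m ⬝ᵥ p := by rw [toRat_dotProduct] at hpos; exact_mod_cast hpos
  have hnormal : ∀ q, IsNormalRay (P : Set (Fin n → ℤ)) τ q → m ⬝ᵥ q + e ⬝ᵥ q = 0 := fun q hq => by
    have := hq.2 _ hmeτ
    rw [toRat_dotProduct, add_dotProduct] at this
    exact_mod_cast this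
  have hep : e ⬝ᵥ p < 0 := by have := hnormal p hp; omega
  -- `c` is a nonzero multiple of the pairing with `p`
  have hmul : ∀ a ∈ P, c a * ((m ⬝ᵥ p : ℤ) : K) = c m * ((a ⬝ᵥ p : ℤ) : K) := fun a ha =>
    hp.1.mul_eq_mul hfg hgen c hc (fun b hb h0 => hcP b hb fun h => by
      have := hp.1.nonneg h
      rw [add_dotProduct] at this
      omega) ha hm
  have hadd : ∀ a ∈ P, 0 < a ⬝ᵥ p → a + e ∈ P := fun a ha hap => by
    by_contra hcon
    have h1 := hmul a ha
    rw [hcP a ha hcon, zero_mul] at h1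
    exact mul_ne_zero hcm (by exact_mod_cast hap.ne') h1.symm
  -- subtracting `-⟨e, p⟩` repeatedly from the values of `p` on `P` leads to zero
  have hdvd : ∀ N : ℕ, ∀ a ∈ P, (a ⬝ᵥ p).toNat = N → e ⬝ᵥ p ∣ a ⬝ᵥ p := by
    intro N
    induction N using Nat.strong_induction_on with
    | _ N ih =>
      intro a ha haN
      rcases (hp.1.nonneg ha).eq_or_lt with h | h
      · rw [← h]; exact dvd_zero _
      · have h1 := hp.1.nonneg (hadd a ha h)
        have h2 : (a + e) ⬝ᵥ p = a ⬝ᵥ p + e ⬝ᵥ p := add_dotProduct _ _ _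
        have h3 := ih ((a + e) ⬝ᵥ p).toNat (by omega) _ (hadd a ha h) rfl
        rw [h2] at h3
        exact (dvd_add_left dvd_rfl).1 h3
  have hdvd' : ∀ a : Fin n → ℤ, e ⬝ᵥ p ∣ a ⬝ᵥ p := fun a => by
    have ha : a ∈ AddSubgroup.closure (P : Set (Fin n → ℤ)) := hgen ▸ AddSubgroup.mem_top a
    induction ha using AddSubgroup.closure_induction with
    | mem a ha => exact hdvd _ a ha rfl
    | zero => simp
    | add a b _ _ ha hb => rw [add_dotProduct]; exact dvd_add ha hb
    | neg a _ ha => rw [neg_dotProduct]; exact (dvd_neg).2 ha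
  have hep1 : e ⬝ᵥ p = -1 := by
    have h1 := hp.1.1 (e ⬝ᵥ p) fun i => by simpa using hdvd' (Pi.single i 1)
    rcases Int.isUnit_iff.1 h1 with h | h
    · omega
    · exact h
  have hother : ∀ q, IsPrimitiveOnRay (P : Set (Fin n → ℤ)) q → q ≠ p → 0 ≤ e ⬝ᵥ q := by
    intro q hq hqp
    obtain ⟨a, ha, haq, hap⟩ : ∃ a ∈ P, a ⬝ᵥ q = 0 ∧ a ⬝ᵥ p ≠ 0 := by
      by_contra! hcon
      exact hqp (hq.eq_of_forall hfg hgen hp.1 hcon).symm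
    have h1 := hq.nonneg (hadd a ha ((hp.1.nonneg ha).lt_of_ne' hap))
    rwa [add_dotProduct, haq, zero_add] at h1
  refine ⟨⟨⟨p, hp.1, hep1, hother⟩, p, hp, hep1, fun q hq hqp => ?_⟩, fun a ha hea => ?_⟩
  · have h1 := hother q hq.1 hqp
    have h2 := hq.1.nonneg hm
    have h3 := hnormal q hq
    omega
  · rw [add_comm]
    refine hadd a ha ?_
    have h1 := hp.1.nonneg_of_mem_weightCone hea
    rw [toRat_dotProduct, add_dotProduct, hep1] at h1
    have : 0 ≤ -1 + a ⬝ᵥ p := by exact_mod_cast h1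
    omega

variable {K A : Type u} [Field K] [CommRing A] [Algebra K A]

/-- An ideal that is stable under all derivations. -/
def IsDifferentialIdeal (K : Type u) {A : Type u} [Field K] [CommRing A] [Algebra K A]
    (I : Ideal A) : Prop :=
  ∀ D : Derivation K A A, ∀ f ∈ I, D f ∈ I

theorem IsDifferentialIdeal.comap {I : Ideal A} (hI : IsDifferentialIdeal K I) (φ : A ≃ₐ[K] A) :
    IsDifferentialIdeal K (I.comap φ) := fun D f hf => by
  -- the conjugate of `D` by `φ`
  let D' : Derivation K A A := Derivation.mk'
    (φ.toLinearMap ∘ₗ D.toLinearMap ∘ₗ φ.symm.toLinearMap) fun a b => by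
      simp [map_mul, smul_eq_mul]
  have := hI D' (φ f) hf
  have h : D' (φ f) = φ (D f) := congrArg (fun g => φ (D g)) (φ.symm_apply_apply f)
  rwa [h] at this

variable {P : AddSubmonoid (Fin n → ℤ)} (e : AddMonoidAlgebra K P ≃ₐ[K] A)

/-- The linear map with prescribed values on monomials. -/
noncomputable def monomialLinear (v : P → A) : A →ₗ[K] A :=
  (Finsupp.lsum K fun m => LinearMap.toSpanSingleton K A (v m)) ∘ₗ
    (AddMonoidAlgebra.coeffLinearEquiv K).toLinearMap ∘ₗ e.symm.toLinearMap

theorem monomialLinear_monomial (v : P → A) (m : P) :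
    monomialLinear e v (monomial e m) = v m := by
  simp [monomialLinear, monomial]

/-- The Leibniz rule may be checked on monomials. -/
theorem leibniz_of_monomial (D : A →ₗ[K] A)
    (hD : ∀ a b, D (monomial e a * monomial e b) =
      monomial e a * D (monomial e b) + monomial e b * D (monomial e a)) (f g : A) :
    D (f * g) = f * D g + g * D f := by
  have h1 : ∀ a, D ∘ₗ LinearMap.mulLeft K (monomial e a) =
      LinearMap.mulLeft K (monomial e a) ∘ₗ D + LinearMap.mulRight K (D (monomial e a)) := fun a =>
    linearMap_ext_monomial e fun b => by simpa using hD a b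
  have h2 : D ∘ₗ LinearMap.mulRight K g =
      LinearMap.mulRight K (D g) + LinearMap.mulLeft K g ∘ₗ D :=
    linearMap_ext_monomial e fun a => by simpa using LinearMap.congr_fun (h1 a) g
  simpa using LinearMap.congr_fun h2 f

/-- The derivation `χ^m ↦ mᵢ χ^m` given by the infinitesimal torus action. -/
noncomputable def eulerDerivation (i : Fin n) : Derivation K A A :=
  Derivation.mk' (monomialLinear e fun m => ((m : Fin n → ℤ) i : K) • monomial e m)
    (leibniz_of_monomial e _ fun a b => by
      rw [← monomial_add, monomialLinear_monomial, monomialLinear_monomial,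
        monomialLinear_monomial, monomial_add, mul_smul_comm, mul_smul_comm,
        mul_comm (monomial e b), ← add_smul]
      push_cast
      rw [Pi.add_apply, Int.cast_add, add_comm])

theorem monomialCoeff_eulerDerivation (i : Fin n) (k : P) (f : A) :
    monomialCoeff e k (eulerDerivation e i f) = ((k : Fin n → ℤ) i : K) * monomialCoeff e k f := by
  classical
  have h : (monomialCoeff e k) ∘ₗ (eulerDerivation e i).toLinearMap =
      ((k : Fin n → ℤ) i : K) • monomialCoeff e k := linearMap_ext_monomial e fun m => by
    have h1 : (eulerDerivation e i).toLinearMap (monomial e m) =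
        ((m : Fin n → ℤ) i : K) • monomial e m := monomialLinear_monomial e _ m
    rw [LinearMap.comp_apply, h1, map_smul, LinearMap.smul_apply, monomialCoeff_monomial]
    split_ifs with h2
    · rw [h2]
    · simp
  exact LinearMap.congr_fun h f

/-- A differential ideal contains the monomials of its elements, because the derivations from the
torus action separate weights in characteristic zero. -/
theorem IsDifferentialIdeal.monomial_mem [CharZero K] {I : Ideal A} (hI : IsDifferentialIdeal K I)
    {f : A} (hf : f ∈ I) {m : P} (hm : monomialCoeff e m f ≠ 0) : monomial e m ∈ I := by
  classical
  induction hN : (e.symm f).coeff.support.card using Nat.strong_induction_on generalizing f with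
  | _ N ih =>
    by_cases hex : ∃ m' : P, m' ≠ m ∧ monomialCoeff e m' f ≠ 0
    · obtain ⟨m', hm', hcm'⟩ := hex
      obtain ⟨i, hi⟩ := Function.ne_iff.1 (fun h => hm' (Subtype.ext h))
      set g := eulerDerivation e i f - algebraMap K A ((m' : Fin n → ℤ) i : K) * f with hg
      have hgI : g ∈ I := I.sub_mem (hI _ f hf) (I.mul_mem_left _ hf)
      have hgk : ∀ k : P, monomialCoeff e k g =
          (((k : Fin n → ℤ) i : K) - ((m' : Fin n → ℤ) i : K)) * monomialCoeff e k f := fun k => by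
        rw [hg, map_sub, monomialCoeff_eulerDerivation, ← Algebra.smul_def, map_smul, smul_eq_mul,
          sub_mul]
      refine ih _ ?_ hgI ?_ rfl
      · rw [← hN]
        refine Finset.card_lt_card ?_
        refine (Finset.ssubset_iff_of_subset fun k hk => ?_).2 ⟨m', ?_, ?_⟩
        · rw [Finsupp.mem_support_iff, ← monomialCoeff_coe, hgk] at hk
          rw [Finsupp.mem_support_iff, ← monomialCoeff_coe]
          exact right_ne_zero_of_mul hk
        · rwa [Finsupp.mem_support_iff, ← monomialCoeff_coe]
        · rw [Finsupp.mem_support_iff, ← monomialCoeff_coe, hgk]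
          simp
      · rw [hgk]
        refine mul_ne_zero ?_ hm
        rw [sub_ne_zero]
        exact_mod_cast Ne.symm hi
    · push Not at hex
      have h1 : f = monomialCoeff e m f • monomial e m := eq_of_monomialCoeff_eq e fun k => by
        rw [map_smul, monomialCoeff_monomial]
        by_cases hk : k = m
        · subst hk; simp
        · rw [hex k hk, if_neg (fun h => hk (Subtype.ext h)), smul_zero]
      have h2 : monomial e m = (monomialCoeff e m f)⁻¹ • f := by
        conv_rhs => rw [h1]
        rw [map_smul, monomialCoeff_monomial, if_pos rfl, smul_smul]
        simp [hm]
      rw [h2, Algebra.smul_def]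
      exact I.mul_mem_left _ hf

theorem IsDifferentialIdeal.mem_iff [CharZero K] {I : Ideal A} (hI : IsDifferentialIdeal K I)
    {f : A} : f ∈ I ↔ ∀ m : P, monomialCoeff e m f ≠ 0 → monomial e m ∈ I := by
  refine ⟨fun hf m hm => hI.monomial_mem e hf hm, fun h => ?_⟩
  rw [← sum_monomialCoeff_smul e f]
  refine sum_mem fun m hm => ?_
  rw [Finsupp.mem_support_iff, ← monomialCoeff_coe] at hm
  beta_reduce
  rw [Algebra.smul_def]
  exact I.mul_mem_left _ (h m hm)

/-- There are only finitely many differential prime ideals: each is determined by the generators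
of `P` whose monomials it contains. -/
theorem finite_setOf_isDifferentialIdeal [CharZero K] (e : AddMonoidAlgebra K P ≃ₐ[K] A)
    (hfg : P.FG) :
    {I : Ideal A | I.IsPrime ∧ IsDifferentialIdeal K I}.Finite := by
  classical
  obtain ⟨S, hS⟩ := ((AddMonoid.fg_iff_addSubmonoid_fg P).2 hfg).fg_top
  refine Set.Finite.of_finite_image (f := fun I => S.filter fun s => monomial e s ∈ I)
    ((Finset.finite_toSet S.powerset).subset ?_) fun I hI J hJ hIJ => ?_
  · rintro _ ⟨I, -, rfl⟩
    exact Finset.mem_coe.2 (Finset.mem_powerset.2 (Finset.filter_subset _ _))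
  · have h : ∀ m, monomial e m ∈ I ↔ monomial e m ∈ J := fun m => by
      have hm : m ∈ AddSubmonoid.closure (S : Set P) := hS ▸ AddSubmonoid.mem_top m
      induction hm using AddSubmonoid.closure_induction with
      | mem m hm =>
        have h1 := Finset.ext_iff.1 hIJ m
        simp only [Finset.mem_filter] at h1
        have hm' : m ∈ S := hm
        simpa [hm'] using h1
      | zero =>
        rw [monomial_zero, ← Ideal.eq_top_iff_one, ← Ideal.eq_top_iff_one]
        exact iff_of_false hI.1.ne_top hJ.1.ne_top
      | add a b _ _ ha hb =>
        rw [monomial_add, hI.1.mul_mem_iff_mem_or_mem, hJ.1.mul_mem_iff_mem_or_mem]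
        exact or_congr ha hb
    ext f
    rw [hI.2.mem_iff e, hJ.2.mem_iff e]
    simp only [h]

/-! ### The ideals of the orbits -/

open Classical in
/-- The homomorphism from `A` to the Laurent polynomials that kills the monomials outside the
face `τ`. -/
noncomputable def faceHom {τ : PointedCone ℚ (Fin n → ℚ)}
    (hτ : τ.IsFaceOf (weightCone (P : Set (Fin n → ℤ)))) :
    A →ₐ[K] AddMonoidAlgebra K (Fin n → ℤ) :=
  monomialLift e
    { toFun := fun m => if toRat (m.toAdd : Fin n → ℤ) ∈ τ then
        AddMonoidAlgebra.single (m.toAdd : Fin n → ℤ) 1 else 0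
      map_one' := by
        rw [if_pos]
        · rfl
        · rw [toAdd_one, AddSubmonoid.coe_zero, toRat_zero]; exact zero_mem τ
      map_mul' := fun a b => by
        have h := hτ.add_mem_iff_mem (toRat_mem_weightCone a.toAdd.2)
          (toRat_mem_weightCone b.toAdd.2)
        rw [toAdd_mul, AddSubmonoid.coe_add]
        by_cases ha : toRat (a.toAdd : Fin n → ℤ) ∈ τ <;>
          by_cases hb : toRat (b.toAdd : Fin n → ℤ) ∈ τ <;>
          simp [h, ha, hb, AddMonoidAlgebra.single_mul_single] }

/-- The prime ideal spanned by the monomials outside the face `τ`. -/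
noncomputable def facePrime {τ : PointedCone ℚ (Fin n → ℚ)}
    (hτ : τ.IsFaceOf (weightCone (P : Set (Fin n → ℤ)))) : Ideal A :=
  RingHom.ker (faceHom e hτ)

theorem coeff_faceHom {τ : PointedCone ℚ (Fin n → ℚ)}
    (hτ : τ.IsFaceOf (weightCone (P : Set (Fin n → ℤ)))) (f : A) (k : Fin n → ℤ)
    [Decidable (toRat k ∈ τ)] :
    (faceHom e hτ f).coeff k = if toRat k ∈ τ then monomialCoeff e k f else 0 := by
  classical
  have h : (Finsupp.lapply k) ∘ₗ (AddMonoidAlgebra.coeffLinearEquiv K).toLinearMap ∘ₗ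
      (faceHom e hτ).toLinearMap = if toRat k ∈ τ then monomialCoeff e k else 0 :=
    linearMap_ext_monomial e fun m => by
      have h1 : (Finsupp.lapply k ∘ₗ (AddMonoidAlgebra.coeffLinearEquiv K).toLinearMap ∘ₗ
          (faceHom e hτ).toLinearMap) (monomial e m) = (faceHom e hτ (monomial e m)).coeff k := rfl
      have h2 : faceHom e hτ (monomial e m) = if toRat (m : Fin n → ℤ) ∈ τ then
        AddMonoidAlgebra.single (m : Fin n → ℤ) 1 else 0 := monomialLift_monomial e _ m
      rw [h1, h2]
      by_cases hm : toRat (m : Fin n → ℤ) ∈ τ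
      · rw [if_pos hm, AddMonoidAlgebra.coeff_single, Finsupp.single_apply]
        by_cases hk : (m : Fin n → ℤ) = k
        · subst hk
          rw [if_pos rfl, if_pos hm, monomialCoeff_monomial, if_pos rfl]
        · rw [if_neg hk]
          split_ifs
          · rw [monomialCoeff_monomial, if_neg (Ne.symm hk)]
          · rfl
      · rw [if_neg hm]
        split_ifs with hk
        · rw [monomialCoeff_monomial, if_neg]
          · rfl
          · rintro rfl; exact hm hk
        · rfl
  have := LinearMap.congr_fun h f
  split_ifs at this ⊢ <;> exact this

theorem mem_facePrime {τ : PointedCone ℚ (Fin n → ℚ)}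
    (hτ : τ.IsFaceOf (weightCone (P : Set (Fin n → ℤ)))) {f : A} :
    f ∈ facePrime e hτ ↔ ∀ k : P, toRat (k : Fin n → ℤ) ∈ τ → monomialCoeff e k f = 0 := by
  classical
  rw [facePrime, RingHom.mem_ker]
  refine ⟨fun h k hk => ?_, fun h => ?_⟩
  · have := coeff_faceHom e hτ f k
    rw [h, if_pos hk] at this
    exact this.symm
  · ext k
    rw [coeff_faceHom]
    split_ifs with hk
    · by_cases hkP : k ∈ P
      · exact h ⟨k, hkP⟩ hk
      · exact monomialCoeff_of_notMem e hkP f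
    · rfl

theorem isPrime_facePrime {τ : PointedCone ℚ (Fin n → ℚ)}
    (hτ : τ.IsFaceOf (weightCone (P : Set (Fin n → ℤ)))) : (facePrime e hτ).IsPrime :=
  RingHom.ker_isPrime _

/-- Without admissible `τ`-roots, the ideal of the face `τ` is stable under all derivations. -/
theorem isDifferentialIdeal_facePrime [CharZero K] (hfg : P.FG)
    (hgen : AddSubgroup.closure (P : Set (Fin n → ℤ)) = ⊤) {τ : PointedCone ℚ (Fin n → ℚ)}
    (hτ : IsRootFreeFace (P : Set (Fin n → ℤ)) τ) :
    IsDifferentialIdeal K (facePrime e hτ.1) := by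
  classical
  intro D f hf
  rw [mem_facePrime] at hf ⊢
  intro k hk
  rw [← sum_monomialCoeff_smul e f, Finsupp.sum, map_sum, map_sum]
  refine Finset.sum_eq_zero fun m hm => ?_
  rw [Finsupp.mem_support_iff, ← monomialCoeff_coe] at hm
  rw [D.map_smul, map_smul]
  by_contra hne
  have hmτ : toRat (m : Fin n → ℤ) ∉ τ := fun h => hm (hf m h)
  set d : Fin n → ℤ := k - m with hd
  let c : (Fin n → ℤ) → K := fun a =>
    if h : a ∈ P then monomialCoeff e (a + d) (D (monomial e ⟨a, h⟩)) else 0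
  have hcP : ∀ a (h : a ∈ P), c a = monomialCoeff e (a + d) (D (monomial e ⟨a, h⟩)) := fun a h => by
    simp [c, h]
  have hkd : (m : Fin n → ℤ) + d = k := by rw [hd]; abel
  refine hτ.2 ⟨d, isFaceRoot_and_isAdmissible_of_ne_zero hfg hgen hτ.1 c (fun a ha b hb => ?_)
    (fun a ha h => ?_) m.2 ?_ hmτ (by rwa [hkd])⟩
  · have h1 : monomial e ⟨a + b, add_mem ha hb⟩ = monomial e ⟨a, ha⟩ * monomial e ⟨b, hb⟩ :=
      monomial_add e ⟨a, ha⟩ ⟨b, hb⟩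
    rw [hcP _ (add_mem ha hb), hcP a ha, hcP b hb, h1, D.leibniz, smul_eq_mul, smul_eq_mul, map_add,
      add_assoc a b d, monomialCoeff_monomial_mul e ⟨a, ha⟩,
      show a + (b + d) = b + (a + d) by abel, monomialCoeff_monomial_mul e ⟨b, hb⟩, add_comm]
  · rw [hcP a ha, monomialCoeff_of_notMem e h]
  · rw [hcP _ m.2, hkd]
    exact right_ne_zero_of_mul hne

end Derivations

/-! ### Rigidity of finite sets of primes under connected families -/

section Rigidity

open TensorProduct

variable {K A : Type u} [Field K] [CommRing A] [Algebra K A]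

/-- The restriction of functions on `Spec R × X` to the fibre `{b} × X = X`. -/
noncomputable def fiberHom {R : Type u} [CommRing R] [Algebra K R] (b : R →ₐ[K] K) :
    R ⊗[K] A →ₐ[K] A :=
  Algebra.TensorProduct.lift ((Algebra.ofId K A).comp b) (AlgHom.id K A) fun _ _ => .all _ _

@[simp] theorem fiberHom_tmul {R : Type u} [CommRing R] [Algebra K R] (b : R →ₐ[K] K) (r : R)
    (a : A) : fiberHom b (r ⊗ₜ[K] a) = b r • a := by
  rw [fiberHom, Algebra.TensorProduct.lift_tmul, Algebra.smul_def]
  rfl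

/-- Let `φ_b` be an algebraic family of endomorphisms over an irreducible affine base. If each `φ_b`
maps `I` into a member of a finite set of ideals, then one member works for all `b`: for each `J`,
the condition `φ_b(I) ⊆ J` is closed in `b`. -/
theorem exists_forall_le_comap_fiberHom [IsAlgClosed K] {R : Type u} [CommRing R] [IsDomain R]
    [Algebra K R] [Algebra.FiniteType K R] (Φ : A →ₐ[K] R ⊗[K] A) (I : Ideal A)
    {𝒬 : Set (Ideal A)} (h𝒬 : 𝒬.Finite)
    (h : ∀ b : R →ₐ[K] K, ∃ J ∈ 𝒬, I ≤ J.comap ((fiberHom b).comp Φ)) :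
    ∃ J ∈ 𝒬, ∀ b : R →ₐ[K] K, I ≤ J.comap ((fiberHom b).comp Φ) := by
  by_contra! hcon
  -- for each `J`, a function on the base whose nonvanishing at `b` prevents `φ_b(I) ⊆ J`
  have h1 : ∀ J ∈ 𝒬, ∃ r : R, r ≠ 0 ∧
      ∀ b : R →ₐ[K] K, b r ≠ 0 → ¬ I ≤ J.comap ((fiberHom b).comp Φ) := by
    intro J hJ
    obtain ⟨b, hb⟩ := hcon J hJ
    obtain ⟨a, ha, haJ⟩ := SetLike.not_le_iff_exists.1 hb
    obtain ⟨l, hl, hlJ⟩ := Submodule.exists_dual_map_eq_bot_of_notMem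
      (p := J.restrictScalars K) (x := fiberHom b (Φ a)) haJ inferInstance
    have hlJ' : ∀ g ∈ J, l g = 0 := fun g hg => by
      have : l g ∈ (J.restrictScalars K).map l := ⟨g, hg, rfl⟩
      rwa [hlJ, Submodule.mem_bot] at this
    have hslice : ∀ (b : R →ₐ[K] K) (g : R ⊗[K] A),
        b (TensorProduct.rid K R (LinearMap.lTensor R l g)) = l (fiberHom b g) := fun b g => by
      induction g using TensorProduct.induction_on with
      | zero => simp
      | tmul r a => simp [mul_comm]
      | add x y hx hy => simp only [map_add, hx, hy]
    refine ⟨TensorProduct.rid K R (LinearMap.lTensor R l (Φ a)), fun h0 => hl ?_, fun b' hb' hle =>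
      hb' ?_⟩
    · rw [← hslice, h0, map_zero]
    · rw [hslice]
      exact hlJ' _ (hle ha)
  choose! r hr0 hr using h1
  have h2 : ∏ J ∈ h𝒬.toFinset, r J ≠ 0 :=
    Finset.prod_ne_zero_iff.2 fun J hJ => hr0 J (h𝒬.mem_toFinset.1 hJ)
  obtain ⟨b, hb⟩ : ∃ b : R →ₐ[K] K, b (∏ J ∈ h𝒬.toFinset, r J) ≠ 0 := by
    by_contra! h0
    exact h2 (eq_zero_of_forall_algHom h0)
  obtain ⟨J, hJ, hle⟩ := h b
  rw [map_prod, Finset.prod_ne_zero_iff] at hb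
  exact hr J hJ b (hb J (h𝒬.mem_toFinset.2 hJ)) hle

open CategoryTheory CategoryTheory.Limits AlgebraicGeometry

/-- Over an affine chart `Spec R` of the base, a family is given by a homomorphism `A → R ⊗ A`. -/
theorem IrreducibleFamily.exists_algHom (F : IrreducibleFamily K A) {R : Type u} [CommRing R]
    [Algebra K R] (j : Spec (CommRingCat.of R) ⟶ F.B)
    (hj : j ≫ F.str = Spec.map (CommRingCat.ofHom (algebraMap K R))) :
    ∃ Φ : A →ₐ[K] R ⊗[K] A, ∀ (b : R →ₐ[K] K)
      (hb : (Spec.map (CommRingCat.ofHom (b : R →+* K)) ≫ j) ≫ F.str = 𝟙 _) (a : A),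
        F.aut _ hb a = fiberHom b (Φ a) := by
  let inl : Spec (CommRingCat.of (R ⊗[K] A)) ⟶ Spec (CommRingCat.of R) :=
    Spec.map (CommRingCat.ofHom Algebra.TensorProduct.includeLeftRingHom)
  let inr : Spec (CommRingCat.of (R ⊗[K] A)) ⟶ Spec (CommRingCat.of A) :=
    Spec.map (CommRingCat.ofHom
      ((Algebra.TensorProduct.includeRight : A →ₐ[K] R ⊗[K] A) : A →+* R ⊗[K] A))
  have hl : (inl ≫ j) ≫ F.str =
      Spec.map (CommRingCat.ofHom (algebraMap K (R ⊗[K] A))) := by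
    rw [Category.assoc, hj, ← Spec.map_comp, ← CommRingCat.ofHom_comp]
  have hr : inr ≫ toBase K A = Spec.map (CommRingCat.ofHom (algebraMap K (R ⊗[K] A))) := by
    rw [← Spec.map_comp, ← CommRingCat.ofHom_comp]
    rw [(Algebra.TensorProduct.includeRight : A →ₐ[K] R ⊗[K] A).comp_algebraMap]
  let g : Spec (CommRingCat.of (R ⊗[K] A)) ⟶ pullback F.str (toBase K A) :=
    pullback.lift (inl ≫ j) inr (hl.trans hr.symm)
  obtain ⟨φ, hφ⟩ := Spec.map_surjective (g ≫ F.total)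
  have hφK : φ.hom.comp (algebraMap K A) = algebraMap K (R ⊗[K] A) := by
    have h1 : Spec.map (CommRingCat.ofHom (algebraMap K A) ≫ φ) =
        Spec.map (CommRingCat.ofHom (algebraMap K (R ⊗[K] A))) := by
      rw [Spec.map_comp, hφ, Category.assoc, F.total_over, pullback.lift_fst_assoc, hl]
    exact congrArg CommRingCat.Hom.hom (Spec.map_injective h1)
  refine ⟨{ φ.hom with commutes' := fun c => RingHom.congr_fun hφK c }, fun b hb a => ?_⟩
  have h2 : Spec.map (CommRingCat.ofHom ((fiberHom b : R ⊗[K] A →ₐ[K] A) : R ⊗[K] A →+* A)) ≫ g =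
      pullback.lift (toBase K A ≫ Spec.map (CommRingCat.ofHom (b : R →+* K)) ≫ j)
        (𝟙 (Spec (CommRingCat.of A)))
        (by rw [Category.assoc, hb, Category.comp_id, Category.id_comp]) := by
    refine pullback.hom_ext ?_ ?_
    · rw [Category.assoc, pullback.lift_fst, pullback.lift_fst, ← Category.assoc, ← Category.assoc,
        ← Spec.map_comp, ← Spec.map_comp]
      congr 2
      ext r
      change fiberHom b (r ⊗ₜ[K] (1 : A)) = algebraMap K A (b r)
      rw [fiberHom_tmul, Algebra.algebraMap_eq_smul_one]
    · rw [Category.assoc, pullback.lift_snd, pullback.lift_snd, ← Spec.map_comp]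
      rw [← Spec.map_id]
      congr 1
      ext a
      change fiberHom b ((1 : R) ⊗ₜ[K] a) = a
      rw [fiberHom_tmul, map_one, one_smul]
  have h3 := F.restrict _ hb
  rw [← h2, Category.assoc, ← hφ, ← Spec.map_comp] at h3
  have h4 := Spec.map_injective h3
  exact (RingHom.congr_fun (congrArg CommRingCat.Hom.hom h4) a).symm

end Rigidity

/-! ### Elements of the neutral component fix finite invariant sets of primes -/

section Charts

open TensorProduct CategoryTheory CategoryTheory.Limits AlgebraicGeometry

variable {K A : Type u} [Field K] [CommRing A] [Algebra K A]

/-- Affine charts of the base of a family. -/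
theorem IrreducibleFamily.exists_chart (F : IrreducibleFamily K A) {x : F.B} {U : F.B.Opens}
    (hx : x ∈ U) :
    ∃ (R : Type u) (_ : CommRing R) (_ : Algebra K R) (j : Spec (CommRingCat.of R) ⟶ F.B),
      IsDomain R ∧ Algebra.FiniteType K R ∧ IsOpenImmersion j ∧
      j ≫ F.str = Spec.map (CommRingCat.ofHom (algebraMap K R)) ∧
      x ∈ Set.range j ∧ Set.range j ⊆ U := by
  obtain ⟨R, j, hj, hxj, hjU⟩ := Scheme.exists_affine_mem_range_and_range_subset hx
  obtain ⟨φ, hφ⟩ := Spec.map_surjective (j ≫ F.str)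
  have := F.isIntegral
  have := F.locallyOfFiniteType
  have hne : Nonempty (Spec R) := ⟨hxj.choose⟩
  have hint : IsIntegral (Spec R) := isIntegral_of_isOpenImmersion j
  refine ⟨R, inferInstance, φ.hom.toAlgebra, j, (affine_isIntegral_iff R).1 hint, ?_, hj, hφ.symm,
    hxj, hjU⟩
  have h1 : LocallyOfFiniteType (Spec.map φ) := by
    rw [hφ]
    infer_instance
  exact (HasRingHomProperty.Spec_iff (P := @LocallyOfFiniteType)).1 h1

theorem specMap_comp_comp_eq_id {R : Type u} [CommRing R] [Algebra K R] {B : Scheme.{u}}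
    {str : B ⟶ Spec (CommRingCat.of K)} {j : Spec (CommRingCat.of R) ⟶ B}
    (hj : j ≫ str = Spec.map (CommRingCat.ofHom (algebraMap K R))) (b : R →ₐ[K] K) :
    (Spec.map (CommRingCat.ofHom (b : R →+* K)) ≫ j) ≫ str = 𝟙 _ := by
  rw [Category.assoc, hj, ← Spec.map_comp, ← CommRingCat.ofHom_comp, b.comp_algebraMap,
    ← Spec.map_id]
  rfl

/-- A `K`-point of `B` that lies in an affine chart is a `K`-algebra homomorphism. -/
theorem exists_eq_specMap_comp {R : Type u} [CommRing R] [Algebra K R] {B : Scheme.{u}}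
    {str : B ⟶ Spec (CommRingCat.of K)} {j : Spec (CommRingCat.of R) ⟶ B} [IsOpenImmersion j]
    (hj : j ≫ str = Spec.map (CommRingCat.ofHom (algebraMap K R)))
    {b : Spec (CommRingCat.of K) ⟶ B} (hb : b ≫ str = 𝟙 _) (hrange : Set.range b ⊆ Set.range j) :
    ∃ b' : R →ₐ[K] K, b = Spec.map (CommRingCat.ofHom (b' : R →+* K)) ≫ j := by
  obtain ⟨φ, hφ⟩ := Spec.map_surjective (IsOpenImmersion.lift j b hrange)
  have h1 : b = Spec.map φ ≫ j := by rw [hφ, IsOpenImmersion.lift_fac]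
  have h2 : φ.hom.comp (algebraMap K R) = RingHom.id K := by
    rw [h1, Category.assoc, hj, ← Spec.map_comp, ← Spec.map_id] at hb
    exact congrArg CommRingCat.Hom.hom (Spec.map_injective hb)
  exact ⟨{ φ.hom with commutes' := fun c => RingHom.congr_fun h2 c }, h1⟩

/-- The automorphisms in `Aut(X)^0` fix each member of a finite set of prime ideals that is
permuted by all automorphisms. -/
theorem comap_eq_of_mem_aut0 [IsAlgClosed K] [Algebra.FiniteType K A] {𝒬 : Set (Ideal A)}
    (hfin : 𝒬.Finite) (hprime : ∀ I ∈ 𝒬, I.IsPrime)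
    (hperm : ∀ (φ : A ≃ₐ[K] A), ∀ I ∈ 𝒬, I.comap φ ∈ 𝒬) {φ : A ≃ₐ[K] A} (hφ : φ ∈ aut0 K A)
    {I : Ideal A} (hI : I ∈ 𝒬) : I.comap φ = I := by
  obtain ⟨F, b₀, b₁, hb₀, hb₁, h₀, h₁⟩ := hφ
  have := F.isIntegral
  have := Algebra.FiniteType.isNoetherianRing K A
  -- on each chart, the image of `I` under the automorphisms of the family is constant
  have hchart : ∀ (R : Type u) [CommRing R] [Algebra K R] [IsDomain R] [Algebra.FiniteType K R]
      (j : Spec (CommRingCat.of R) ⟶ F.B)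
      (hj : j ≫ F.str = Spec.map (CommRingCat.ofHom (algebraMap K R))),
      ∃ J : Ideal A, ∀ b : R →ₐ[K] K,
        I.comap (F.aut _ (specMap_comp_comp_eq_id hj b)).symm = J := by
    intro R _ _ _ _ j hj
    obtain ⟨Φ, hΦ⟩ := F.exists_algHom j hj
    have hΦ' : ∀ b : R →ₐ[K] K, ((fiberHom b).comp Φ) =
        (F.aut _ (specMap_comp_comp_eq_id hj b) : A →ₐ[K] A) := fun b =>
      AlgHom.ext fun a => (hΦ b _ a).symm
    have hheight : ∀ (ψ : A ≃ₐ[K] A) (J : Ideal A), (J.comap ψ).height = J.height := fun ψ J =>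
      RingEquiv.height_comap ψ.toRingEquiv J
    have hcomap : ∀ (ψ : A ≃ₐ[K] A), (I.comap ψ.symm).comap ψ = I := fun ψ => by
      ext a; simp
    -- images of `I` have the same height as `I`
    obtain ⟨J, ⟨hJ, hJh⟩, hle⟩ := exists_forall_le_comap_fiberHom Φ I
      (𝒬 := {J | J ∈ 𝒬 ∧ J.height = I.height}) (hfin.subset fun J hJ => hJ.1) fun b => by
        rw [hΦ']
        exact ⟨I.comap (F.aut _ (specMap_comp_comp_eq_id hj b)).symm, ⟨hperm _ I hI, hheight _ _⟩,
          (hcomap _).ge⟩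
    refine ⟨J, fun b => ?_⟩
    set ψ := F.aut _ (specMap_comp_comp_eq_id hj b) with hψ
    have h1 : I ≤ J.comap ψ := by
      have := hle b
      rwa [hΦ' b] at this
    have := hprime I hI
    have h2 : I = J.comap ψ := Ideal.eq_of_le_of_height_le I h1 (by rw [hheight, hJh])
    rw [h2]
    ext a
    simp
  -- any point of `Spec K` may serve, as there is only one
  let pt : Spec (CommRingCat.of K) := (inferInstance : Nonempty (Spec (CommRingCat.of K))).some
  have hpt : ∀ (b : Spec (CommRingCat.of K) ⟶ F.B) (s : Set F.B), b pt ∈ s → Set.range b ⊆ s := by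
    rintro b s hs _ ⟨y, rfl⟩
    rwa [Subsingleton.elim y pt]
  obtain ⟨R₀, _, _, j₀, _, _, _, hj₀, hx₀, -⟩ := F.exists_chart (x := b₀ pt) (U := ⊤) trivial
  obtain ⟨R₁, _, _, j₁, _, _, _, hj₁, hx₁, -⟩ := F.exists_chart (x := b₁ pt) (U := ⊤) trivial
  -- two charts meet, because the base is irreducible
  obtain ⟨x, hx⟩ : ((j₀.opensRange ⊓ j₁.opensRange : F.B.Opens) : Set F.B).Nonempty :=
    nonempty_preirreducible_inter j₀.opensRange.isOpen j₁.opensRange.isOpen ⟨_, hx₀⟩ ⟨_, hx₁⟩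
  obtain ⟨R₂, _, _, j₂, _, _, _, hj₂, -, hsub⟩ := F.exists_chart hx
  obtain ⟨m, hm⟩ := Ideal.exists_maximal R₂
  obtain ⟨b₂', -⟩ := exists_algHom_ker_eq (K := K) m
  obtain ⟨J₀, hJ₀⟩ := hchart R₀ j₀ hj₀
  obtain ⟨J₁, hJ₁⟩ := hchart R₁ j₁ hj₁
  have hrange₂ : Set.range (Spec.map (CommRingCat.ofHom (b₂' : R₂ →+* K)) ≫ j₂) ⊆
      (j₀.opensRange ⊓ j₁.opensRange : F.B.Opens) := by
    rintro _ ⟨y, rfl⟩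
    exact hsub ⟨Spec.map (CommRingCat.ofHom (b₂' : R₂ →+* K)) y, by simp⟩
  have hb₂ := specMap_comp_comp_eq_id hj₂ b₂'
  generalize Spec.map (CommRingCat.ofHom (b₂' : R₂ →+* K)) ≫ j₂ = b₂ at hrange₂ hb₂
  have key : ∀ (R : Type u) [CommRing R] [Algebra K R] (j : Spec (CommRingCat.of R) ⟶ F.B)
      [IsOpenImmersion j] (hj : j ≫ F.str = Spec.map (CommRingCat.ofHom (algebraMap K R)))
      (J : Ideal A)
      (_ : ∀ b : R →ₐ[K] K, I.comap (F.aut _ (specMap_comp_comp_eq_id hj b)).symm = J)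
      (b : Spec (CommRingCat.of K) ⟶ F.B) (hb : b ≫ F.str = 𝟙 _) (_ : Set.range b ⊆ Set.range j),
      I.comap (F.aut b hb).symm = J := by
    intro R _ _ j _ hj J hJ b hb hr
    obtain ⟨b', rfl⟩ := exists_eq_specMap_comp hj hb hr
    exact hJ b'
  have e1 := key R₀ j₀ hj₀ J₀ hJ₀ b₀ hb₀ (hpt _ _ hx₀)
  have e2 := key R₀ j₀ hj₀ J₀ hJ₀ b₂ hb₂ (hrange₂.trans fun y hy => hy.1)
  have e3 := key R₁ j₁ hj₁ J₁ hJ₁ b₂ hb₂ (hrange₂.trans fun y hy => hy.2)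
  have e4 := key R₁ j₁ hj₁ J₁ hJ₁ b₁ hb₁ (hpt _ _ hx₁)
  have h2 : I.comap φ.symm = I := by
    rw [← h₁, e4, ← e3, e2, ← e1, h₀]
    rfl
  conv_lhs => rw [← h2]
  ext a
  simp

end Charts

/-! ### Automorphisms connected to the identity over an affine base -/

section AffineFamilies

open TensorProduct CategoryTheory CategoryTheory.Limits AlgebraicGeometry

variable {K A R : Type u} [Field K] [CommRing A] [Algebra K A] [CommRing R] [Algebra K R]

/-- The base change to `R` of a homomorphism `A → R ⊗ A`. -/
noncomputable def extendScalars (Φ : A →ₐ[K] R ⊗[K] A) : R ⊗[K] A →ₐ[K] R ⊗[K] A :=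
  Algebra.TensorProduct.lift Algebra.TensorProduct.includeLeft Φ fun _ _ => .all _ _

theorem fiberHom_extendScalars (b : R →ₐ[K] K) (Φ : A →ₐ[K] R ⊗[K] A) (g : R ⊗[K] A) :
    fiberHom b (extendScalars Φ g) = fiberHom b (Φ (fiberHom b g)) := by
  induction g using TensorProduct.induction_on with
  | zero => simp
  | tmul r a =>
    rw [extendScalars, Algebra.TensorProduct.lift_tmul, map_mul, fiberHom_tmul,
      Algebra.TensorProduct.includeLeft_apply, fiberHom_tmul, map_smul, map_smul, smul_mul_assoc,
      one_mul]
  | add x y hx hy => simp only [map_add, hx, hy]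

/-- The automorphisms that a family of automorphisms over `Spec R` connects, at the point `b₁`, to
the identity at the point `b₀`. The family and its inverse are given by `Φ` and `Ψ`. They form a
group, since families over the same base can be composed pointwise. -/
def connectedAut (A : Type u) [CommRing A] [Algebra K A] (b₀ b₁ : R →ₐ[K] K) :
    Subgroup (A ≃ₐ[K] A) where
  carrier := {φ | ∃ Φ Ψ : A →ₐ[K] R ⊗[K] A,
    (∀ (b : R →ₐ[K] K) (a : A), fiberHom b (Φ (fiberHom b (Ψ a))) = a) ∧
    (∀ (b : R →ₐ[K] K) (a : A), fiberHom b (Ψ (fiberHom b (Φ a))) = a) ∧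
    (∀ a : A, fiberHom b₀ (Φ a) = a) ∧ ∀ a : A, fiberHom b₁ (Φ a) = φ a}
  one_mem' := ⟨Algebra.TensorProduct.includeRight, Algebra.TensorProduct.includeRight,
    by simp, by simp, by simp, by simp⟩
  mul_mem' := by
    rintro φ φ' ⟨Φ, Ψ, h1, h2, h3, h4⟩ ⟨Φ', Ψ', h1', h2', h3', h4'⟩
    refine ⟨(extendScalars Φ).comp Φ', (extendScalars Ψ').comp Ψ, fun b a => ?_, fun b a => ?_,
      fun a => ?_, fun a => ?_⟩
    · simp only [AlgHom.comp_apply, fiberHom_extendScalars, h1', h1]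
    · simp only [AlgHom.comp_apply, fiberHom_extendScalars, h2, h2']
    · simp only [AlgHom.comp_apply, fiberHom_extendScalars, h3, h3']
    · simp only [AlgHom.comp_apply, fiberHom_extendScalars, h4, h4', AlgEquiv.mul_apply]
  inv_mem' := by
    rintro φ ⟨Φ, Ψ, h1, h2, h3, h4⟩
    refine ⟨Ψ, Φ, h2, h1, fun a => ?_, fun a => ?_⟩
    · have := h1 b₀ a
      rwa [h3] at this
    · have := h1 b₁ a
      rw [h4] at this
      exact (φ.symm_apply_eq.2 this.symm).symm

theorem connectedAut_subset_aut0 [IsDomain R] [Algebra.FiniteType K R] (b₀ b₁ : R →ₐ[K] K) :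
    (connectedAut A b₀ b₁ : Set (A ≃ₐ[K] A)) ⊆ aut0 K A := by
  rintro φ ⟨Φ, Ψ, h1, h2, h3, h4⟩
  let str : Spec (CommRingCat.of R) ⟶ Spec (CommRingCat.of K) :=
    Spec.map (CommRingCat.ofHom (algebraMap K R))
  have hpt : ∀ (b : Spec (CommRingCat.of K) ⟶ Spec (CommRingCat.of R)), b ≫ str = 𝟙 _ →
      ∃ b' : R →ₐ[K] K, b = Spec.map (CommRingCat.ofHom (b' : R →+* K)) := fun b hb => by
    obtain ⟨b', hb'⟩ := exists_eq_specMap_comp (j := 𝟙 _) (Category.id_comp str) hb (by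
      intro y _; exact ⟨y, rfl⟩)
    exact ⟨b', hb'.trans (Category.comp_id _)⟩
  choose pt hpt using hpt
  have hlocal : LocallyOfFiniteType str :=
    (HasRingHomProperty.Spec_iff (P := @LocallyOfFiniteType)).2
      (show (algebraMap K R).FiniteType from RingHom.finiteType_algebraMap.2 inferInstance)
  let F : IrreducibleFamily K A :=
    { B := Spec (CommRingCat.of R)
      str := str
      isIntegral := inferInstance
      isSeparated := inferInstance
      locallyOfFiniteType := hlocal
      quasiCompact := inferInstance
      total := (pullbackSpecIso K R A).hom ≫
        Spec.map (CommRingCat.ofHom (Φ : A →+* R ⊗[K] A))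
      total_over := by
        have h : Spec.map (CommRingCat.ofHom (Φ : A →+* R ⊗[K] A)) ≫ toBase K A =
            Spec.map (CommRingCat.ofHom (algebraMap K (R ⊗[K] A))) := by
          rw [← Spec.map_comp, ← CommRingCat.ofHom_comp, Φ.comp_algebraMap]
        rw [Category.assoc, h, pullbackSpecIso_hom_base]
      aut := fun b hb => AlgEquiv.ofAlgHom ((fiberHom (pt b hb)).comp Φ)
        ((fiberHom (pt b hb)).comp Ψ) (AlgHom.ext fun a => h1 _ a) (AlgHom.ext fun a => h2 _ a)
      restrict := fun b hb => by
        have h : pullback.lift (toBase K A ≫ b) (𝟙 (Spec (CommRingCat.of A)))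
            (by rw [Category.assoc, hb, Category.comp_id, Category.id_comp]) =
            Spec.map (CommRingCat.ofHom
              ((fiberHom (pt b hb) : R ⊗[K] A →ₐ[K] A) : R ⊗[K] A →+* A)) ≫
              (pullbackSpecIso K R A).inv := by
          refine pullback.hom_ext ?_ ?_
          · rw [pullback.lift_fst, Category.assoc, pullbackSpecIso_inv_fst, ← Spec.map_comp]
            conv_lhs => rw [hpt b hb, ← Spec.map_comp]
            congr 1
            ext r
            change algebraMap K A (pt b hb r) = fiberHom (pt b hb) (r ⊗ₜ[K] (1 : A))
            rw [fiberHom_tmul, Algebra.algebraMap_eq_smul_one]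
          · rw [pullback.lift_snd, Category.assoc, pullbackSpecIso_inv_snd, ← Spec.map_comp,
              ← Spec.map_id]
            congr 1
            ext a
            change a = fiberHom (pt b hb) ((1 : R) ⊗ₜ[K] a)
            rw [fiberHom_tmul, map_one, one_smul]
        rw [h, Category.assoc, Iso.inv_hom_id_assoc, ← Spec.map_comp]
        rfl }
  have hsec : ∀ b : R →ₐ[K] K, Spec.map (CommRingCat.ofHom (b : R →+* K)) ≫ str = 𝟙 _ :=
    fun b => by
      rw [← Spec.map_comp, ← CommRingCat.ofHom_comp, b.comp_algebraMap, ← Spec.map_id]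
      rfl
  have hpt' : ∀ b : R →ₐ[K] K, pt _ (hsec b) = b := fun b => by
    have h5 := Spec.map_injective (hpt _ (hsec b))
    ext r
    exact (RingHom.congr_fun (congrArg CommRingCat.Hom.hom h5) r).symm
  refine ⟨F, _, _, hsec b₀, hsec b₁, ?_, ?_⟩
  · ext a
    change fiberHom (pt _ (hsec b₀)) (Φ a) = a
    rw [hpt', h3]
  · ext a
    change fiberHom (pt _ (hsec b₁)) (Φ a) = φ a
    rw [hpt', h4]

end AffineFamilies

/-! ### Root subgroups and the torus in the group of connected automorphisms -/

section RootSubgroups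

open TensorProduct Polynomial

variable {K A : Type u} [Field K] [CommRing A] [Algebra K A] {n : ℕ}
variable {P : AddSubmonoid (Fin n → ℤ)} (e : AddMonoidAlgebra K P ≃ₐ[K] A)

open Classical in
/-- The monomial `χ^(m + k ε)`, or zero if `m + k ε ∉ P`. -/
noncomputable def shiftedMonomial (ε m : Fin n → ℤ) (k : ℕ) : A :=
  if h : m + k • ε ∈ P then monomial e ⟨m + k • ε, h⟩ else 0

theorem shiftedMonomial_of_mem {ε m : Fin n → ℤ} {k : ℕ} (h : m + k • ε ∈ P) :
    shiftedMonomial e ε m k = monomial e ⟨m + k • ε, h⟩ := dif_pos h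

theorem shiftedMonomial_mul {ε a b : Fin n → ℤ} {i j : ℕ} (ha : a + i • ε ∈ P)
    (hb : b + j • ε ∈ P) :
    shiftedMonomial e ε a i * shiftedMonomial e ε b j = shiftedMonomial e ε (a + b) (i + j) := by
  have h : a + b + (i + j) • ε = (a + i • ε) + (b + j • ε) := by rw [add_smul]; abel
  rw [shiftedMonomial_of_mem e ha, shiftedMonomial_of_mem e hb,
    shiftedMonomial_of_mem e (h ▸ add_mem ha hb), ← monomial_add]
  congr 1
  exact Subtype.ext h.symm

open Classical in
theorem shiftedMonomial_add_nsmul (ε m : Fin n → ℤ) (k i : ℕ) :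
    shiftedMonomial e ε (m + k • ε) i = shiftedMonomial e ε m (k + i) := by
  have h : m + k • ε + i • ε = m + (k + i) • ε := by rw [add_smul, add_assoc]
  exact congrArg (fun a => if h : a ∈ P then monomial e ⟨a, h⟩ else 0) h

/-- A direction `ε` in which the monomials of `P` can be shifted as often as the functional `p`,
which takes nonnegative values on `P` and the value `-1` at `ε`, permits. -/
structure IsShiftDirection (P : AddSubmonoid (Fin n → ℤ)) (p ε : Fin n → ℤ) : Prop where
  nonneg : ∀ m ∈ P, 0 ≤ m ⬝ᵥ p
  dotProduct_eq : ε ⬝ᵥ p = -1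
  add_mem : ∀ m ∈ P, ∀ k : ℕ, (k : ℤ) ≤ m ⬝ᵥ p → m + k • ε ∈ P

variable {p ε : Fin n → ℤ}

theorem IsAdmissible.isShiftDirection (hfg : P.FG)
    (hgen : AddSubgroup.closure (P : Set (Fin n → ℤ)) = ⊤)
    (hε : IsAdmissible (P : Set (Fin n → ℤ)) ε)
    (hp : IsDemazureRootAt (P : Set (Fin n → ℤ)) p ε) : IsShiftDirection P p ε :=
  ⟨fun _ hm => hp.1.nonneg hm, hp.2.1, fun _ hm _ hk => hε.add_nsmul_mem hfg hgen hp hm hk⟩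

theorem IsShiftDirection.mem_of_le (hε : IsShiftDirection P p ε) {m : Fin n → ℤ} (hm : m ∈ P)
    {k : ℕ} (hk : k ≤ (m ⬝ᵥ p).toNat) : m + k • ε ∈ P := by
  have := hε.nonneg m hm
  exact hε.add_mem m hm k (by omega)

/-- The homomorphism `χ^m ↦ χ^m (1 + X χ^ε)^⟨m, p⟩`, which is the exponential `exp (X ∂)` of the
locally nilpotent derivation `∂ : χ^m ↦ ⟨m, p⟩ χ^(m + ε)`. -/
noncomputable def rootHom (hε : IsShiftDirection P p ε) : A →ₐ[K] A[X] :=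
  monomialLift e
    { toFun := fun m => ∑ k ∈ Finset.range (((m.toAdd : Fin n → ℤ) ⬝ᵥ p).toNat + 1),
        Polynomial.monomial k
          ((((m.toAdd : Fin n → ℤ) ⬝ᵥ p).toNat.choose k : A) * shiftedMonomial e ε m.toAdd k)
      map_one' := by
        have h0 : (0 : Fin n → ℤ) + 0 • ε ∈ P := by simp
        have h1 : shiftedMonomial e ε 0 0 = 1 := by
          rw [shiftedMonomial_of_mem e h0, ← monomial_zero e]
          congr 1
          exact Subtype.ext (by simp)
        simp [h1]
      map_mul' := fun a b => by
        have hcoeff : ∀ (m : P) (k : ℕ),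
            (∑ k ∈ Finset.range (((m : Fin n → ℤ) ⬝ᵥ p).toNat + 1), Polynomial.monomial k
              ((((m : Fin n → ℤ) ⬝ᵥ p).toNat.choose k : A) *
                shiftedMonomial e ε m k)).coeff k =
            (((m : Fin n → ℤ) ⬝ᵥ p).toNat.choose k : A) * shiftedMonomial e ε m k := fun m k => by
          simp only [finsetSum_coeff, coeff_monomial, Finset.sum_ite_eq', Finset.mem_range]
          split_ifs with h
          · rfl
          · rw [Nat.choose_eq_zero_of_lt (by omega), Nat.cast_zero, zero_mul]
        have hab : (((a * b).toAdd : Fin n → ℤ) ⬝ᵥ p).toNat =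
            ((a.toAdd : Fin n → ℤ) ⬝ᵥ p).toNat + ((b.toAdd : Fin n → ℤ) ⬝ᵥ p).toNat := by
          rw [toAdd_mul, AddSubmonoid.coe_add, add_dotProduct,
            Int.toNat_add (hε.nonneg _ a.toAdd.2) (hε.nonneg _ b.toAdd.2)]
        ext k
        rw [coeff_mul, hcoeff, hab, Nat.add_choose_eq, Nat.cast_sum, Finset.sum_mul]
        refine Finset.sum_congr rfl fun ij hij => ?_
        rw [hcoeff, hcoeff]
        by_cases hi : ij.1 ≤ ((a.toAdd : Fin n → ℤ) ⬝ᵥ p).toNat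
        · by_cases hj : ij.2 ≤ ((b.toAdd : Fin n → ℤ) ⬝ᵥ p).toNat
          · rw [mul_mul_mul_comm, shiftedMonomial_mul e (hε.mem_of_le a.toAdd.2 hi)
              (hε.mem_of_le b.toAdd.2 hj), Finset.HasAntidiagonal.mem_antidiagonal.1 hij,
              Nat.cast_mul]
            rfl
          · rw [Nat.choose_eq_zero_of_lt (not_le.1 hj)]
            simp
        · rw [Nat.choose_eq_zero_of_lt (not_le.1 hi)]
          simp }

/-- The endomorphism `exp (c ∂)`. -/
noncomputable def rootEnd (hε : IsShiftDirection P p ε) (c : K) : A →ₐ[K] A :=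
  ((Polynomial.aeval (algebraMap K A c)).restrictScalars K).comp (rootHom e hε)

theorem rootEnd_monomial (hε : IsShiftDirection P p ε) (c : K) (m : P) :
    rootEnd e hε c (monomial e m) =
      ∑ k ∈ Finset.range (((m : Fin n → ℤ) ⬝ᵥ p).toNat + 1),
        ((((m : Fin n → ℤ) ⬝ᵥ p).toNat.choose k : K) * c ^ k) • shiftedMonomial e ε m k := by
  have h : rootHom e hε (monomial e m) = _ := monomialLift_monomial e _ m
  rw [rootEnd, AlgHom.comp_apply, h]
  simp only [MonoidHom.coe_mk, OneHom.coe_mk, toAdd_ofAdd, map_sum, AlgHom.restrictScalars_apply,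
    aeval_monomial, Algebra.algebraMap_self, RingHom.id_apply]
  refine Finset.sum_congr rfl fun k _ => ?_
  rw [Algebra.smul_def, map_mul, map_natCast, map_pow]
  ring

theorem rootEnd_rootEnd (hε : IsShiftDirection P p ε) (c d : K) (f : A) :
    rootEnd e hε d (rootEnd e hε c f) = rootEnd e hε (c + d) f := by
  have key : (rootEnd e hε d).comp (rootEnd e hε c) = rootEnd e hε (c + d) := by
    refine algHom_ext_monomial e fun m => ?_
    set h := ((m : Fin n → ℤ) ⬝ᵥ p).toNat with hh
    -- `S` sends `X ^ k` to `χ^(m + k ε)`; both sides come from `(1 + (c + d) X) ^ h`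
    let S : K[X] →ₗ[K] A := Polynomial.lsum fun k => LinearMap.toSpanSingleton K A
      (shiftedMonomial e ε m k)
    have hS : ∀ k, S (X ^ k) = shiftedMonomial e ε m k := fun k => by
      rw [← monomial_one_right_eq_X_pow]
      simp [S, Polynomial.lsum_apply, sum_monomial_index]
    have h1 : ∀ k ≤ h, rootEnd e hε d (shiftedMonomial e ε m k) =
        S (X ^ k * (C d * X + 1) ^ (h - k)) := fun k hk => by
      have hmem := hε.mem_of_le m.2 hk
      have hk' : ((((m : Fin n → ℤ) + k • ε) ⬝ᵥ p)).toNat = h - k := by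
        have h0 := hε.nonneg m m.2
        have : ((m : Fin n → ℤ) + k • ε) ⬝ᵥ p = (m : Fin n → ℤ) ⬝ᵥ p - k := by
          rw [add_dotProduct, smul_dotProduct, hε.dotProduct_eq]
          simp [sub_eq_add_neg]
        rw [this]
        omega
      rw [shiftedMonomial_of_mem e hmem, rootEnd_monomial, add_pow, Finset.mul_sum, map_sum]
      simp only [hk']
      refine Finset.sum_congr rfl fun i _ => ?_
      have h2 : (X : K[X]) ^ k * ((C d * X) ^ i * 1 ^ (h - k - i) * ((h - k).choose i : K[X])) =
          (((h - k).choose i : K) * d ^ i) • X ^ (k + i) := by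
        rw [smul_eq_C_mul, C_mul, C_pow, C_eq_natCast]
        ring
      rw [h2, map_smul, hS, shiftedMonomial_add_nsmul]
    have h3 : ∀ c : K, ∑ k ∈ Finset.range (h + 1), ((h.choose k : K) * c ^ k) •
        shiftedMonomial e ε m k = S ((C c * X + 1) ^ h) := fun c => by
      rw [add_pow, map_sum]
      refine Finset.sum_congr rfl fun k _ => ?_
      have h2 : (C c * X : K[X]) ^ k * 1 ^ (h - k) * (h.choose k : K[X]) =
          ((h.choose k : K) * c ^ k) • X ^ k := by
        rw [smul_eq_C_mul, C_mul, C_pow, C_eq_natCast]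
        ring
      rw [h2, map_smul, hS]
    have h4 : (C (c + d) * X + 1 : K[X]) ^ h = (C c * X + (C d * X + 1)) ^ h := by
      rw [C_add]
      ring
    rw [AlgHom.comp_apply, rootEnd_monomial, rootEnd_monomial, map_sum, h3, h4, add_pow, map_sum]
    refine Finset.sum_congr rfl fun k hk => ?_
    rw [map_smul, h1 k (by have := Finset.mem_range.1 hk; omega), ← map_smul]
    congr 1
    rw [smul_eq_C_mul, C_mul, C_pow, C_eq_natCast]
    ring
  exact DFunLike.congr_fun key f

theorem rootEnd_zero (hε : IsShiftDirection P p ε) (f : A) : rootEnd e hε 0 f = f := by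
  have key : rootEnd e hε (0 : K) = AlgHom.id K A := algHom_ext_monomial e fun m => by
    have h0 : (m : Fin n → ℤ) + 0 • ε ∈ P := by simp
    rw [rootEnd_monomial, Finset.sum_eq_single 0]
    · rw [shiftedMonomial_of_mem e h0]
      simp
    · intro k _ hk
      simp [hk]
    · simp
  exact DFunLike.congr_fun key f

end RootSubgroups

section Connected

open TensorProduct Polynomial

variable {K A : Type u} [Field K] [CommRing A] [Algebra K A] {n : ℕ}
variable {P : AddSubmonoid (Fin n → ℤ)} (e : AddMonoidAlgebra K P ≃ₐ[K] A)
variable {p ε : Fin n → ℤ}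

/-- The automorphism `exp (c ∂)`. -/
noncomputable def rootAut (hε : IsShiftDirection P p ε) (c : K) : A ≃ₐ[K] A :=
  AlgEquiv.ofAlgHom (rootEnd e hε c) (rootEnd e hε (-c))
    (AlgHom.ext fun f => by
      rw [AlgHom.comp_apply, rootEnd_rootEnd, neg_add_cancel, rootEnd_zero]; rfl)
    (AlgHom.ext fun f => by
      rw [AlgHom.comp_apply, rootEnd_rootEnd, add_neg_cancel, rootEnd_zero]; rfl)

variable {R : Type u} [CommRing R] [Algebra K R]

/-- The one-parameter group `exp (s ∂)` connects `exp (c ∂)` to the identity, along any function `s`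
on the base that takes the values `0` and `c`. -/
theorem rootAut_mem_connectedAut (hε : IsShiftDirection P p ε) {b₀ b₁ : R →ₐ[K] K} {s : R}
    (hs₀ : b₀ s = 0) {c : K} (hs₁ : b₁ s = c) : rootAut e hε c ∈ connectedAut A b₀ b₁ := by
  let Φ : R → (A →ₐ[K] R ⊗[K] A) := fun s =>
    (Polynomial.eval₂AlgHom (Algebra.TensorProduct.includeRight : A →ₐ[K] R ⊗[K] A)
      (s ⊗ₜ[K] (1 : A)) fun _ => .all _ _).comp (rootHom e hε)
  have hΦ : ∀ (b : R →ₐ[K] K) (s : R) (f : A), fiberHom b (Φ s f) = rootEnd e hε (b s) f := by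
    intro b s f
    have h : (fiberHom b).comp (Polynomial.eval₂AlgHom
        (Algebra.TensorProduct.includeRight : A →ₐ[K] R ⊗[K] A) (s ⊗ₜ[K] (1 : A))
        fun _ => .all _ _) = (Polynomial.aeval (algebraMap K A (b s))).restrictScalars K := by
      refine AlgHom.ext fun q => ?_
      induction q using Polynomial.induction_on' with
      | add q r hq hr => rw [map_add, map_add, hq, hr]
      | monomial k a =>
        simp [Algebra.smul_def, mul_comm]
    exact DFunLike.congr_fun h (rootHom e hε f)
  refine ⟨Φ s, Φ (-s), fun b f => ?_, fun b f => ?_, fun f => ?_, fun f => ?_⟩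
  · rw [hΦ, hΦ, rootEnd_rootEnd, map_neg, neg_add_cancel, rootEnd_zero]
  · rw [hΦ, hΦ, rootEnd_rootEnd, map_neg, add_neg_cancel, rootEnd_zero]
  · rw [hΦ, hs₀, rootEnd_zero]
  · rw [hΦ, hs₁]
    rfl

/-- The torus element `t` is connected to the identity along any homomorphism from the character
lattice to the units of the base that specializes to `1` and to evaluation at `t`. -/
theorem act_mem_connectedAut (T : TorusAction K A n)
    (hact : ∀ t (m : P), T.act t (monomial e m) = character (m : Fin n → ℤ) t • monomial e m)
    {b₀ b₁ : R →ₐ[K] K} (u : Multiplicative (Fin n → ℤ) →* R)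
    (hu₀ : ∀ m, b₀ (u m) = 1) {t : Fin n → Kˣ}
    (hu₁ : ∀ m : Fin n → ℤ, b₁ (u (Multiplicative.ofAdd m)) = character m t) :
    T.act t ∈ connectedAut A b₀ b₁ := by
  let Φ : (Multiplicative (Fin n → ℤ) →* R) → (A →ₐ[K] R ⊗[K] A) := fun v => monomialLift e
    { toFun := fun m => v (Multiplicative.ofAdd (m.toAdd : Fin n → ℤ)) ⊗ₜ[K] monomial e m.toAdd
      map_one' := by
        rw [toAdd_one, monomial_zero]
        exact congrArg (· ⊗ₜ[K] (1 : A)) (map_one v)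
      map_mul' := fun a b => by
        rw [toAdd_mul, monomial_add, AddSubmonoid.coe_add, ofAdd_add, map_mul,
          Algebra.TensorProduct.tmul_mul_tmul] }
  have hΦ : ∀ (v : Multiplicative (Fin n → ℤ) →* R) (b : R →ₐ[K] K) (m : P),
      fiberHom b (Φ v (monomial e m)) =
        b (v (Multiplicative.ofAdd (m : Fin n → ℤ))) • monomial e m := by
    intro v b m
    have h : Φ v (monomial e m) = _ := monomialLift_monomial e _ m
    rw [h]
    exact fiberHom_tmul b _ _
  let w : Multiplicative (Fin n → ℤ) →* R := u.comp (invMonoidHom)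
  have huw : ∀ (b : R →ₐ[K] K) (m : Multiplicative (Fin n → ℤ)), b (u m) * b (w m) = 1 :=
    fun b m => by
      rw [← map_mul, MonoidHom.comp_apply, ← map_mul, invMonoidHom_apply, mul_inv_cancel, map_one,
        map_one]
  have hinv : ∀ (v v' : Multiplicative (Fin n → ℤ) →* R) (b : R →ₐ[K] K),
      (∀ m, b (v m) * b (v' m) = 1) → ∀ f, fiberHom b (Φ v (fiberHom b (Φ v' f))) = f := by
    intro v v' b h f
    have key : ((fiberHom b).comp (Φ v)).comp ((fiberHom b).comp (Φ v')) = AlgHom.id K A :=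
      algHom_ext_monomial e fun m => by
        simp only [AlgHom.comp_apply, hΦ, map_smul, smul_smul, AlgHom.id_apply]
        rw [mul_comm, h, one_smul]
    exact DFunLike.congr_fun key f
  refine ⟨Φ u, Φ w, fun b f => hinv u w b (huw b) f,
    fun b f => hinv w u b (fun m => by rw [mul_comm, huw]) f, fun f => ?_, fun f => ?_⟩
  · have key : (fiberHom b₀).comp (Φ u) = AlgHom.id K A := algHom_ext_monomial e fun m => by
      rw [AlgHom.comp_apply, hΦ, hu₀, one_smul, AlgHom.id_apply]
    exact DFunLike.congr_fun key f
  · have key : (fiberHom b₁).comp (Φ u) = (T.act t : A →ₐ[K] A) := algHom_ext_monomial e fun m => by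
      rw [AlgHom.comp_apply, hΦ, hu₁]
      exact (hact t m).symm
    exact DFunLike.congr_fun key f

/-- For each torus element `t` there is a group of automorphisms in `Aut(X)^0` that contains `t`
and all root subgroups; the base of the families is the product of the torus and a line. -/
theorem exists_subgroup_subset_aut0 (T : TorusAction K A n)
    (hact : ∀ t (m : P), T.act t (monomial e m) = character (m : Fin n → ℤ) t • monomial e m)
    (t : Fin n → Kˣ) :
    ∃ H : Subgroup (A ≃ₐ[K] A), (H : Set (A ≃ₐ[K] A)) ⊆ aut0 K A ∧ T.act t ∈ H ∧
      ∀ (p ε : Fin n → ℤ) (hε : IsShiftDirection P p ε), rootAut e hε 1 ∈ H := by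
  let L := AddMonoidAlgebra K (Fin n → ℤ)
  let χ : (Fin n → Kˣ) → (L →ₐ[K] K) := fun t => AddMonoidAlgebra.lift K K (Fin n → ℤ)
    { toFun := fun m => character m.toAdd t
      map_one' := character_zero t
      map_mul' := fun a b => character_add _ _ t }
  have hχ : ∀ t (m : Fin n → ℤ), χ t (AddMonoidAlgebra.single m 1) = character m t := fun t m =>
    (AddMonoidAlgebra.lift_single _ m 1).trans (one_smul K _)
  let b : (Fin n → Kˣ) → K → (L[X] →ₐ[K] K) := fun t s =>
    Polynomial.eval₂AlgHom (χ t) s fun _ => .all _ _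
  have hbX : ∀ t s, b t s X = s := fun t s => by simp [b]
  have hbC : ∀ t s (f : L), b t s (C f) = χ t f := fun t s f => by simp [b]
  have : Algebra.FiniteType K L[X] :=
    Algebra.FiniteType.trans (S := L) inferInstance inferInstance
  refine ⟨connectedAut A (b 1 0) (b t 1), connectedAut_subset_aut0 _ _, ?_, fun p ε hε => ?_⟩
  · refine act_mem_connectedAut e T hact
      ((C : L →+* L[X]).toMonoidHom.comp (AddMonoidAlgebra.of K (Fin n → ℤ))) (fun m => ?_)
      fun m => ?_
    · exact (hbC _ _ _).trans ((hχ _ _).trans (character_one _))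
    · exact (hbC _ _ _).trans (hχ _ _)
  · exact rootAut_mem_connectedAut e hε (hbX _ _) (hbX _ _)

end Connected

/-! ### Torus orbits -/

section TorusOrbits

variable {K A : Type u} [Field K] [CommRing A] [Algebra K A] {n : ℕ}

namespace Points

theorem eval_map (x : Points K A) (φ : A ≃ₐ[K] A) (f : A) : (x.map φ).eval f = x.eval (φ f) := rfl

theorem eval_add (x : Points K A) (f g : A) : x.eval (f + g) = x.eval f + x.eval g :=
  map_add (show A →ₐ[K] K from x) f g

theorem eval_mul (x : Points K A) (f g : A) : x.eval (f * g) = x.eval f * x.eval g :=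
  map_mul (show A →ₐ[K] K from x) f g

theorem eval_smul (x : Points K A) (c : K) (f : A) : x.eval (c • f) = c * x.eval f :=
  map_smul (show A →ₐ[K] K from x) c f

theorem eval_one (x : Points K A) : x.eval 1 = 1 :=
  map_one (show A →ₐ[K] K from x)

end Points

variable {P : AddSubmonoid (Fin n → ℤ)} (e : AddMonoidAlgebra K P ≃ₐ[K] A)

theorem Points.ext_monomial {x y : Points K A}
    (h : ∀ m : P, x.eval (monomial e m) = y.eval (monomial e m)) : x = y :=
  algHom_ext_monomial e h

theorem Points.eval_eq_sum (x : Points K A) (f : A) :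
    x.eval f = (e.symm f).coeff.sum fun m c => c * x.eval (monomial e m) := by
  conv_lhs => rw [← sum_monomialCoeff_smul e f]
  exact (map_finsuppSum (show A →ₐ[K] K from x) _ _).trans
    (Finsupp.sum_congr fun m _ => x.eval_smul _ _)

variable {T : TorusAction K A n}

theorem monomialCoeff_act
    (hact : ∀ t (m : P), T.act t (monomial e m) = character (m : Fin n → ℤ) t • monomial e m)
    (t : Fin n → Kˣ) (k : P) (f : A) :
    monomialCoeff e k (T.act t f) = character (k : Fin n → ℤ) t * monomialCoeff e k f := by
  classical
  have h : monomialCoeff e k ∘ₗ (T.act t).toLinearMap =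
      character (k : Fin n → ℤ) t • monomialCoeff e k := linearMap_ext_monomial e fun m => by
    rw [LinearMap.comp_apply, AlgEquiv.toLinearMap_apply, hact, map_smul, LinearMap.smul_apply,
      monomialCoeff_monomial]
    split_ifs with h
    · rw [h]
    · rw [smul_zero, smul_zero]
  exact LinearMap.congr_fun h f

/-- The ideal `I_τ` consists of the functions without monomials in `τ`. -/
theorem mem_faceIdeal [CharZero K] (hP : (P : Set (Fin n → ℤ)) = T.weightMonoid)
    (hact : ∀ t (m : P), T.act t (monomial e m) = character (m : Fin n → ℤ) t • monomial e m)
    {τ : PointedCone ℚ (Fin n → ℚ)} {f : A} :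
    f ∈ T.faceIdeal τ ↔ ∀ k : P, toRat (k : Fin n → ℤ) ∈ τ → monomialCoeff e k f = 0 := by
  refine ⟨fun hf k hk => ?_, fun h => ?_⟩
  · suffices h : T.faceIdeal τ ≤ LinearMap.ker (monomialCoeff e k) from h hf
    refine Submodule.span_le.2 (Set.iUnion₂_subset fun m hm g hg => ?_)
    have hne : characterHom (K := K) (k : Fin n → ℤ) ≠ characterHom m := fun h =>
      hm.2 (characterHom_injective h ▸ hk)
    obtain ⟨t, ht⟩ := DFunLike.ne_iff.1 hne
    have h1 := monomialCoeff_act e hact t k g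
    rw [hg t, map_smul, smul_eq_mul] at h1
    by_contra h0
    exact ht (mul_right_cancel₀ h0 h1).symm
  · rw [← sum_monomialCoeff_smul e f]
    refine sum_mem fun k hk => Submodule.smul_mem _ _ (Submodule.subset_span ?_)
    rw [Finsupp.mem_support_iff, ← monomialCoeff_coe] at hk
    refine Set.mem_biUnion (x := (k : Fin n → ℤ)) ⟨hP ▸ k.2, fun hkτ => hk (h k hkτ)⟩ ?_
    exact fun t => hact t k

theorem eval_eq_zero_on_orbit_iff [CharZero K]
    (hact : ∀ t (m : P), T.act t (monomial e m) = character (m : Fin n → ℤ) t • monomial e m)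
    (x : Points K A) (f : A) :
    (∀ y ∈ T.orbit x, y.eval f = 0) ↔
      ∀ k : P, monomialCoeff e k f * x.eval (monomial e k) = 0 := by
  classical
  let c : P →₀ K := Finsupp.onFinset (e.symm f).coeff.support
    (fun k => (e.symm f).coeff k * x.eval (monomial e k)) fun k hk =>
      Finsupp.mem_support_iff.2 (left_ne_zero_of_mul hk)
  let c' : (Fin n → ℤ) →₀ K := c.embDomain ⟨Subtype.val, Subtype.val_injective⟩
  have hval : ∀ t, (x.map (T.act t)).eval f = c'.sum fun m v => character m t • v := fun t => by
    rw [Points.eval_eq_sum e, Finsupp.sum_embDomain, Finsupp.onFinset_sum _ fun _ => smul_zero _]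
    refine Finset.sum_congr rfl fun k _ => ?_
    beta_reduce
    rw [Points.eval_map, hact, Points.eval_smul]
    exact mul_left_comm _ _ _
  have hc' : ∀ k : P, c' k = monomialCoeff e k f * x.eval (monomial e k) := fun k => by
    rw [monomialCoeff_coe]
    exact Finsupp.embDomain_apply_self _ _ _
  refine ⟨fun h k => ?_, fun h => ?_⟩
  · have h0 : c' = 0 := eq_zero_of_sum_character_smul c' fun t => by
      rw [← hval]
      exact h _ ⟨t, rfl⟩
    rw [← hc', h0, Finsupp.zero_apply]
  · rintro _ ⟨t, rfl⟩
    have h0 : c = 0 := Finsupp.ext fun k => by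
      have := h k
      rwa [monomialCoeff_coe] at this
    have h0' : c' = 0 := (congrArg (Finsupp.embDomain _) h0).trans (Finsupp.embDomain_zero _)
    change (x.map (T.act t)).eval f = 0
    rw [hval, h0', Finsupp.sum_zero_index]

/-- The orbit `O_τ` consists of the points at which precisely the monomials in `τ` do not vanish. -/
theorem mem_faceOrbit [CharZero K] (hP : (P : Set (Fin n → ℤ)) = T.weightMonoid)
    (hact : ∀ t (m : P), T.act t (monomial e m) = character (m : Fin n → ℤ) t • monomial e m)
    {τ : PointedCone ℚ (Fin n → ℚ)} {x : Points K A} :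
    x ∈ T.faceOrbit τ ↔ ∀ m : P, x.eval (monomial e m) ≠ 0 ↔ toRat (m : Fin n → ℤ) ∈ τ := by
  classical
  simp only [TorusAction.faceOrbit, Set.mem_ofPred_eq, eval_eq_zero_on_orbit_iff e hact,
    mem_faceIdeal e hP hact]
  refine ⟨fun h m => ?_, fun h f => forall_congr' fun k => ?_⟩
  · have := h (monomial e m)
    simp only [monomialCoeff_monomial] at this
    refine ⟨fun hm => by_contra fun hmτ => hm ?_, fun hmτ hm => ?_⟩
    · have h1 := this.2 (fun k hk => if_neg fun (hkm : (k : Fin n → ℤ) = m) => hmτ (hkm ▸ hk)) m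
      rwa [if_pos rfl, one_mul] at h1
    · have h1 := this.1 (fun k => ?_) m hmτ
      · rw [if_pos rfl] at h1
        exact one_ne_zero h1
      · split_ifs with hkm
        · rw [Subtype.ext hkm, hm, mul_zero]
        · exact zero_mul _
  · rw [mul_eq_zero, ← h k, or_iff_not_imp_right]

section Face

variable {τ : PointedCone ℚ (Fin n → ℚ)}

theorem nonempty_faceOrbit [CharZero K] (hP : (P : Set (Fin n → ℤ)) = T.weightMonoid)
    (hact : ∀ t (m : P), T.act t (monomial e m) = character (m : Fin n → ℤ) t • monomial e m)
    (hτ : τ.IsFaceOf (weightCone (P : Set (Fin n → ℤ)))) : (T.faceOrbit τ).Nonempty := by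
  classical
  let x : A →ₐ[K] K := (AddMonoidAlgebra.lift K K (Fin n → ℤ) 1).comp (faceHom e hτ)
  refine ⟨x, (mem_faceOrbit e hP hact).2 fun m => ?_⟩
  have h : x (monomial e m) = if toRat (m : Fin n → ℤ) ∈ τ then 1 else 0 := by
    have h1 : faceHom e hτ (monomial e m) = _ := monomialLift_monomial e _ m
    rw [AlgHom.comp_apply, h1]
    simp only [MonoidHom.coe_mk, OneHom.coe_mk, toAdd_ofAdd]
    split_ifs <;> simp
  change x (monomial e m) ≠ 0 ↔ _
  rw [h]
  simp

theorem map_act_mem_faceOrbit [CharZero K] (hP : (P : Set (Fin n → ℤ)) = T.weightMonoid)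
    (hact : ∀ t (m : P), T.act t (monomial e m) = character (m : Fin n → ℤ) t • monomial e m)
    {x : Points K A} (hx : x ∈ T.faceOrbit τ) (t : Fin n → Kˣ) :
    x.map (T.act t) ∈ T.faceOrbit τ := by
  rw [mem_faceOrbit e hP hact] at hx ⊢
  intro m
  rw [← hx, Points.eval_map, hact, Points.eval_smul, Ne, mul_eq_zero,
    or_iff_right (character_ne_zero _ _)]

/-- The closure of `O_τ` is the zero set of the ideal of `τ`. -/
theorem mem_closure_faceOrbit_iff_facePrime [CharZero K]
    (hP : (P : Set (Fin n → ℤ)) = T.weightMonoid)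
    (hact : ∀ t (m : P), T.act t (monomial e m) = character (m : Fin n → ℤ) t • monomial e m)
    (hτ : τ.IsFaceOf (weightCone (P : Set (Fin n → ℤ)))) {y : Points K A} :
    y ∈ closure (T.faceOrbit τ) ↔ ∀ f ∈ facePrime e hτ, y.eval f = 0 := by
  rw [mem_closure_iff]
  refine forall_congr' fun f => imp_congr ?_ Iff.rfl
  rw [mem_facePrime, ← mem_faceIdeal e hP hact]
  refine ⟨fun h => ?_, fun h x hx => (hx f).2 h x ⟨1, ?_⟩⟩
  · obtain ⟨x, hx⟩ := nonempty_faceOrbit e hP hact hτ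
    refine (hx f).1 ?_
    rintro _ ⟨t, rfl⟩
    exact h _ (map_act_mem_faceOrbit e hP hact hx t)
  · change x.map (T.act 1) = x
    rw [map_one]
    rfl

theorem mem_closure_faceOrbit [CharZero K] (hP : (P : Set (Fin n → ℤ)) = T.weightMonoid)
    (hact : ∀ t (m : P), T.act t (monomial e m) = character (m : Fin n → ℤ) t • monomial e m)
    (hτ : τ.IsFaceOf (weightCone (P : Set (Fin n → ℤ)))) {y : Points K A} :
    y ∈ closure (T.faceOrbit τ) ↔
      ∀ m : P, y.eval (monomial e m) ≠ 0 → toRat (m : Fin n → ℤ) ∈ τ := by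
  classical
  rw [mem_closure_faceOrbit_iff_facePrime e hP hact hτ]
  refine ⟨fun h m => not_imp_comm.1 fun hm => h _ ?_, fun h f hf => ?_⟩
  · rw [mem_facePrime]
    intro k hk
    rw [monomialCoeff_monomial, if_neg]
    exact fun hkm => hm (hkm ▸ hk)
  · rw [Points.eval_eq_sum e]
    refine Finset.sum_eq_zero fun k _ => ?_
    beta_reduce
    by_cases hk : toRat (k : Fin n → ℤ) ∈ τ
    · rw [mem_facePrime] at hf
      rw [← monomialCoeff_coe, hf k hk, zero_mul]
    · rw [not_imp_comm.1 (h k) hk, mul_zero]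

end Face

/-- Every point lies in the orbit of a face. -/
theorem exists_mem_faceOrbit [CharZero K] (hP : (P : Set (Fin n → ℤ)) = T.weightMonoid)
    (hact : ∀ t (m : P), T.act t (monomial e m) = character (m : Fin n → ℤ) t • monomial e m)
    (x : Points K A) :
    ∃ τ : PointedCone ℚ (Fin n → ℚ), τ.IsFaceOf (weightCone (P : Set (Fin n → ℤ))) ∧
      x ∈ T.faceOrbit τ := by
  let F : AddSubmonoid (Fin n → ℤ) :=
    { carrier := {m | ∃ h : m ∈ P, x.eval (monomial e ⟨m, h⟩) ≠ 0}
      zero_mem' := ⟨P.zero_mem, fun h => by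
        have h1 : x.eval (monomial e 0) = 0 := h
        rw [monomial_zero, Points.eval_one] at h1
        exact one_ne_zero h1⟩
      add_mem' := by
        rintro a b ⟨ha, hxa⟩ ⟨hb, hxb⟩
        refine ⟨P.add_mem ha hb, ?_⟩
        have h1 : monomial e ⟨a + b, P.add_mem ha hb⟩ = _ := monomial_add e ⟨a, ha⟩ ⟨b, hb⟩
        rw [h1, Points.eval_mul]
        exact mul_ne_zero hxa hxb }
  obtain ⟨h1, h2⟩ := isFaceOf_hull_of_summand_mem (P := P) (F := F) (fun m hm => hm.1) (by
    rintro a ha b hb ⟨hab, hx⟩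
    refine ⟨ha, left_ne_zero_of_mul (b := x.eval (monomial e ⟨b, hb⟩)) ?_⟩
    rw [← Points.eval_mul, ← monomial_add]
    exact hx)
  exact ⟨_, h1, (mem_faceOrbit e hP hact).2 fun m => by
    rw [h2 m m.2]
    exact ⟨fun h => ⟨m.2, h⟩, fun h => h.2⟩⟩

/-- A homomorphism from a submonoid of an abelian group to an abelian group extends to the subgroup
of differences. -/
theorem exists_extend_addSubmonoid {M G : Type*} [AddCommGroup M] [AddCommGroup G]
    (S : AddSubmonoid M) (u : S →+ G) :
    ∃ (H : AddSubgroup M) (g : H →+ G), ∀ s : S, ∃ h : (s : M) ∈ H, g ⟨s, h⟩ = u s := by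
  let H : AddSubgroup M :=
    { carrier := {m | ∃ a b : S, m = a - b}
      zero_mem' := ⟨0, 0, by simp⟩
      add_mem' := by
        rintro _ _ ⟨a, b, rfl⟩ ⟨c, d, rfl⟩
        exact ⟨a + c, b + d, by push_cast; abel⟩
      neg_mem' := by
        rintro _ ⟨a, b, rfl⟩
        exact ⟨b, a, by abel⟩ }
  have hwd : ∀ a b c d : S, (a : M) - b = c - d → u a - u b = u c - u d := fun a b c d h => by
    rw [sub_eq_sub_iff_add_eq_add] at h ⊢
    rw [← map_add, ← map_add]
    exact congrArg u (Subtype.ext h)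
  choose a b hab using fun m : H => m.2
  have hg : ∀ (m : H) (c d : S), (m : M) = c - d → u (a m) - u (b m) = u c - u d :=
    fun m c d h => hwd _ _ _ _ ((hab m).symm.trans h)
  refine ⟨H, AddMonoidHom.mk' (fun m => u (a m) - u (b m)) fun m m' => ?_, fun s =>
    ⟨⟨s, 0, by simp⟩, ?_⟩⟩
  · rw [hg (m + m') (a m + a m') (b m + b m'), map_add, map_add]
    · abel
    · push_cast
      rw [hab m, hab m']
      abel
  · rw [AddMonoidHom.mk'_apply, hg _ s 0 (by simp), map_zero, sub_zero]

/-- Two points in `O_τ` differ by an element of the torus: the quotients of the values of the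
monomials in `τ` extend to a character of the lattice. -/
theorem exists_eq_map_act [IsAlgClosed K] [CharZero K]
    (hP : (P : Set (Fin n → ℤ)) = T.weightMonoid)
    (hact : ∀ t (m : P), T.act t (monomial e m) = character (m : Fin n → ℤ) t • monomial e m)
    {τ : PointedCone ℚ (Fin n → ℚ)} {x y : Points K A} (hx : x ∈ T.faceOrbit τ)
    (hy : y ∈ T.faceOrbit τ) : ∃ t, y = x.map (T.act t) := by
  rw [mem_faceOrbit e hP hact] at hx hy
  let S : AddSubmonoid (Fin n → ℤ) := P ⊓ (τ.toAddSubmonoid.comap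
    ({ toFun := toRat, map_zero' := toRat_zero, map_add' := toRat_add } :
      (Fin n → ℤ) →+ (Fin n → ℚ)))
  let v : ∀ z : Points K A, (∀ m : P, z.eval (monomial e m) ≠ 0 ↔ toRat (m : Fin n → ℤ) ∈ τ) →
      (S →+ Additive Kˣ) := fun z hz =>
    { toFun := fun m => Additive.ofMul (Units.mk0 (z.eval (monomial e ⟨m, m.2.1⟩))
        ((hz ⟨m, m.2.1⟩).2 m.2.2))
      map_zero' := congrArg Additive.ofMul <| Units.ext <|
        (congrArg z.eval (monomial_zero e)).trans z.eval_one
      map_add' := fun a b => congrArg Additive.ofMul <| Units.ext <|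
        (congrArg z.eval (monomial_add e ⟨a, a.2.1⟩ ⟨b, b.2.1⟩)).trans (z.eval_mul _ _) }
  obtain ⟨H, g, hg⟩ := exists_extend_addSubmonoid S (v y hy - v x hx)
  obtain ⟨t, ht⟩ := exists_character_eq_of_subgroup H g
  refine ⟨t, Points.ext_monomial e fun m => ?_⟩
  rw [Points.eval_map, hact, Points.eval_smul]
  by_cases hm : toRat (m : Fin n → ℤ) ∈ τ
  · obtain ⟨h1, h2⟩ := hg ⟨m, m.2, hm⟩
    rw [ht ⟨m, h1⟩, h2]
    change _ = ((_ / _ : Kˣ) : K) * _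
    rw [Units.val_div_eq_div_val]
    exact (div_mul_cancel₀ _ ((hx m).2 hm)).symm
  · rw [not_imp_comm.1 (hx m).1 hm, not_imp_comm.1 (hy m).1 hm, mul_zero]

end TorusOrbits

/-! ### Orbits of the neutral component -/

section NeutralComponent

variable {K A : Type u} [Field K] [CommRing A] [Algebra K A] {n : ℕ}
variable {P : AddSubmonoid (Fin n → ℤ)} (e : AddMonoidAlgebra K P ≃ₐ[K] A)
variable {T : TorusAction K A n}

/-- The group generated by the automorphisms `exp ∂` for the root derivations `∂`. -/
def rootSubgroup : Subgroup (A ≃ₐ[K] A) :=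
  Subgroup.closure {φ | ∃ (p ε : Fin n → ℤ) (hε : IsShiftDirection P p ε), φ = rootAut e hε 1}

/-- An admissible `τ`-root moves each point of `O_τ` to a point where strictly more monomials do not
vanish. -/
theorem exists_rootAut_eval_ne_zero [CharZero K] (hfg : P.FG)
    (hgen : AddSubgroup.closure (P : Set (Fin n → ℤ)) = ⊤)
    (hP : (P : Set (Fin n → ℤ)) = T.weightMonoid)
    (hact : ∀ t (m : P), T.act t (monomial e m) = character (m : Fin n → ℤ) t • monomial e m)
    {τ : PointedCone ℚ (Fin n → ℚ)} (hτ : τ.IsFaceOf (weightCone (P : Set (Fin n → ℤ))))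
    {ε : Fin n → ℤ} (hετ : IsFaceRoot (P : Set (Fin n → ℤ)) τ ε)
    (hε : IsAdmissible (P : Set (Fin n → ℤ)) ε) {x : Points K A} (hx : x ∈ T.faceOrbit τ) :
    ∃ φ ∈ rootSubgroup e,
      (∀ m : P, x.eval (monomial e m) ≠ 0 → (x.map φ).eval (monomial e m) ≠ 0) ∧
      ∃ m : P, x.eval (monomial e m) = 0 ∧ (x.map φ).eval (monomial e m) ≠ 0 := by
  rw [mem_faceOrbit e hP hact] at hx
  obtain ⟨⟨p₀, hp₀⟩, p, hp, hεp, hεq⟩ := hετ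
  -- the ray through `p` is the distinguished ray of `ε`
  have hpp : p = p₀ := by
    by_contra h
    have := hp₀.2.2 p hp.1 h
    omega
  subst hpp
  have hsh := hε.isShiftDirection hfg hgen hp₀
  refine ⟨rootAut e hsh 1, Subgroup.subset_closure ⟨_, _, hsh, rfl⟩, fun m hm => ?_, ?_⟩
  · have hmp : (m : Fin n → ℤ) ⬝ᵥ p = 0 := by
      have := hp.2 _ ((hx m).1 hm)
      rw [toRat_dotProduct] at this
      exact_mod_cast this
    have h0 : (m : Fin n → ℤ) + 0 • ε ∈ P := by simp
    have h1 : rootAut e hsh 1 (monomial e m) = monomial e m := by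
      refine (rootEnd_monomial e hsh 1 m).trans ?_
      rw [hmp]
      simp [shiftedMonomial_of_mem e h0]
    rwa [Points.eval_map, h1]
  · obtain ⟨m, hm, hmp, hmτ, hmε, hmετ⟩ := exists_add_mem_face hfg hgen hτ hε hp₀ hp hεq
    lift m to P using hm
    have h0 : (m : Fin n → ℤ) + 0 • ε ∈ P := by simp
    have h1 : (m : Fin n → ℤ) + 1 • ε ∈ P := by simpa using hmε
    have h2 : rootAut e hsh 1 (monomial e m) =
        monomial e m + monomial e ⟨(m : Fin n → ℤ) + ε, hmε⟩ := by
      refine (rootEnd_monomial e hsh 1 m).trans ?_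
      rw [hmp]
      simp [Finset.sum_range_succ, shiftedMonomial_of_mem e h0, shiftedMonomial_of_mem e h1]
    have h3 : x.eval (monomial e m) = 0 := not_imp_comm.1 (hx m).1 hmτ
    refine ⟨m, h3, ?_⟩
    rw [Points.eval_map, h2, Points.eval_add, h3, zero_add]
    exact (hx _).2 hmετ

/-- The root subgroups move each point to the orbit of a face without admissible roots. -/
theorem exists_map_mem_faceOrbit [CharZero K] (hfg : P.FG)
    (hgen : AddSubgroup.closure (P : Set (Fin n → ℤ)) = ⊤)
    (hP : (P : Set (Fin n → ℤ)) = T.weightMonoid)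
    (hact : ∀ t (m : P), T.act t (monomial e m) = character (m : Fin n → ℤ) t • monomial e m)
    (x : Points K A) :
    ∃ φ ∈ rootSubgroup e, ∃ τ, IsRootFreeFace (P : Set (Fin n → ℤ)) τ ∧
      x.map φ ∈ T.faceOrbit τ := by
  classical
  obtain ⟨S, hS⟩ := ((AddMonoid.fg_iff_addSubmonoid_fg P).2 hfg).fg_top
  -- each step decreases the number of generators of `P` that vanish at the point
  induction hN : (S.filter fun s => x.eval (monomial e s) = 0).card using Nat.strong_induction_on
    generalizing x with
  | _ N ih =>
    obtain ⟨τ, hτ, hx⟩ := exists_mem_faceOrbit e hP hact x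
    by_cases hfree : ∃ ε, IsFaceRoot (P : Set (Fin n → ℤ)) τ ε ∧
        IsAdmissible (P : Set (Fin n → ℤ)) ε
    · obtain ⟨ε, hετ, hε⟩ := hfree
      obtain ⟨φ, hφ, hle, m, hm, hm'⟩ :=
        exists_rootAut_eval_ne_zero e hfg hgen hP hact hτ hετ hε hx
      have hgens : ¬ ∀ s ∈ S, (x.map φ).eval (monomial e s) ≠ 0 → x.eval (monomial e s) ≠ 0 := by
        intro hS'
        suffices h : ∀ k : P, (x.map φ).eval (monomial e k) ≠ 0 → x.eval (monomial e k) ≠ 0 from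
          h m hm' hm
        intro k
        have hk : k ∈ AddSubmonoid.closure (S : Set P) := hS ▸ AddSubmonoid.mem_top k
        induction hk using AddSubmonoid.closure_induction with
        | mem s hs => exact hS' s hs
        | zero =>
          intro _
          rw [monomial_zero, Points.eval_one]
          exact one_ne_zero
        | add a b _ _ ha hb =>
          rw [monomial_add, Points.eval_mul, Points.eval_mul]
          exact fun h => mul_ne_zero (ha (left_ne_zero_of_mul h)) (hb (right_ne_zero_of_mul h))
      have hlt : (S.filter fun s => (x.map φ).eval (monomial e s) = 0).card < N := by
        rw [← hN]
        refine Finset.card_lt_card (Finset.ssubset_iff_subset_ne.2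
          ⟨Finset.monotone_filter_right S fun s _ hs => not_imp_not.1 (hle s) hs, fun heq => ?_⟩)
        exact hgens fun s hs h1 h2 =>
          h1 (Finset.mem_filter.1 (heq.ge (Finset.mem_filter.2 ⟨hs, h2⟩))).2
      obtain ⟨ψ, hψ, h⟩ := ih _ hlt (x.map φ) rfl
      exact ⟨φ * ψ, mul_mem hφ hψ, h⟩
    · exact ⟨1, one_mem _, τ, ⟨hτ, hfree⟩, hx⟩

theorem rootSubgroup_subset_aut0
    (hact : ∀ t (m : P), T.act t (monomial e m) = character (m : Fin n → ℤ) t • monomial e m) :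
    (rootSubgroup e : Set (A ≃ₐ[K] A)) ⊆ aut0 K A := by
  obtain ⟨H, hH, -, hroot⟩ := exists_subgroup_subset_aut0 e T hact 1
  refine Set.Subset.trans ?_ hH
  refine SetLike.coe_subset_coe.2 ((Subgroup.closure_le _).2 ?_)
  rintro _ ⟨p, ε, hε, rfl⟩
  exact hroot p ε hε

section Aut

variable [IsAlgClosed K] [CharZero K] [Algebra.FiniteType K A]

/-- `Aut(X)^0` preserves the closure of the orbit of a face `γ` without admissible roots: the prime
ideals that are stable under all derivations are finite in number and permuted by the automorphisms,
so each of them is preserved by `Aut(X)^0`, and the ideal of `γ` is one of them. -/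
theorem map_mem_closure_faceOrbit_iff (hfg : P.FG)
    (hgen : AddSubgroup.closure (P : Set (Fin n → ℤ)) = ⊤)
    (hP : (P : Set (Fin n → ℤ)) = T.weightMonoid)
    (hact : ∀ t (m : P), T.act t (monomial e m) = character (m : Fin n → ℤ) t • monomial e m)
    {γ : PointedCone ℚ (Fin n → ℚ)} (hγ : IsRootFreeFace (P : Set (Fin n → ℤ)) γ)
    {φ : A ≃ₐ[K] A} (hφ : φ ∈ aut0 K A) {x : Points K A} :
    x.map φ ∈ closure (T.faceOrbit γ) ↔ x ∈ closure (T.faceOrbit γ) := by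
  rw [mem_closure_faceOrbit_iff_facePrime e hP hact hγ.1,
    mem_closure_faceOrbit_iff_facePrime e hP hact hγ.1]
  have h : (facePrime e hγ.1).comap φ = facePrime e hγ.1 :=
    comap_eq_of_mem_aut0 (finite_setOf_isDifferentialIdeal e hfg) (fun I hI => hI.1)
      (fun ψ I hI => ⟨hI.1.comap ψ, hI.2.comap ψ⟩) hφ
      ⟨isPrime_facePrime e hγ.1, isDifferentialIdeal_facePrime e hfg hgen hγ⟩
  refine ⟨fun hx f hf => ?_, fun hx f hf => hx _ ?_⟩
  · have h1 : φ.symm f ∈ facePrime e hγ.1 := by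
      rw [← h, Ideal.mem_comap, φ.apply_symm_apply]
      exact hf
    have h2 := hx _ h1
    rwa [Points.eval_map, φ.apply_symm_apply] at h2
  · rw [← h] at hf
    exact hf

end Aut

/-- The set `closure O_τ` without the closures of the orbits of the smaller faces without admissible
roots. -/
def faceStratum (T : TorusAction K A n) (τ : PointedCone ℚ (Fin n → ℚ)) : Set (Points K A) :=
  closure (T.faceOrbit τ) \
    ⋃ γ ∈ {γ | IsRootFreeFace T.weightMonoid γ ∧ γ < τ}, closure (T.faceOrbit γ)

theorem mem_faceStratum (hP : (P : Set (Fin n → ℤ)) = T.weightMonoid)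
    {τ : PointedCone ℚ (Fin n → ℚ)} {x : Points K A} :
    x ∈ faceStratum T τ ↔ x ∈ closure (T.faceOrbit τ) ∧
      ∀ γ, IsRootFreeFace (P : Set (Fin n → ℤ)) γ → γ < τ → x ∉ closure (T.faceOrbit γ) := by
  rw [faceStratum, ← hP]
  simp

theorem le_of_mem_closure_faceOrbit [CharZero K] (hP : (P : Set (Fin n → ℤ)) = T.weightMonoid)
    (hact : ∀ t (m : P), T.act t (monomial e m) = character (m : Fin n → ℤ) t • monomial e m)
    {τ γ : PointedCone ℚ (Fin n → ℚ)} (hτ : τ.IsFaceOf (weightCone (P : Set (Fin n → ℤ))))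
    (hγ : γ.IsFaceOf (weightCone (P : Set (Fin n → ℤ)))) {x : Points K A}
    (hx : x ∈ T.faceOrbit τ) (hxγ : x ∈ closure (T.faceOrbit γ)) : τ ≤ γ := by
  rw [mem_faceOrbit e hP hact] at hx
  rw [mem_closure_faceOrbit e hP hact hγ] at hxγ
  exact le_of_forall_mem hτ fun m hm hmτ => hxγ ⟨m, hm⟩ ((hx ⟨m, hm⟩).2 hmτ)

theorem faceOrbit_subset_faceStratum [CharZero K] (hP : (P : Set (Fin n → ℤ)) = T.weightMonoid)
    (hact : ∀ t (m : P), T.act t (monomial e m) = character (m : Fin n → ℤ) t • monomial e m)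
    {τ : PointedCone ℚ (Fin n → ℚ)} (hτ : τ.IsFaceOf (weightCone (P : Set (Fin n → ℤ)))) :
    T.faceOrbit τ ⊆ faceStratum T τ := fun _ hx =>
  (mem_faceStratum hP).2 ⟨subset_closure hx, fun _ hγ hlt hxγ =>
    hlt.not_ge (le_of_mem_closure_faceOrbit e hP hact hτ hγ.1 hx hxγ)⟩

section Aut

variable [IsAlgClosed K] [CharZero K] [Algebra.FiniteType K A]

theorem map_mem_faceStratum_iff (hfg : P.FG)
    (hgen : AddSubgroup.closure (P : Set (Fin n → ℤ)) = ⊤)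
    (hP : (P : Set (Fin n → ℤ)) = T.weightMonoid)
    (hact : ∀ t (m : P), T.act t (monomial e m) = character (m : Fin n → ℤ) t • monomial e m)
    {τ : PointedCone ℚ (Fin n → ℚ)} (hτ : IsRootFreeFace (P : Set (Fin n → ℤ)) τ)
    {φ : A ≃ₐ[K] A} (hφ : φ ∈ aut0 K A) {x : Points K A} :
    x.map φ ∈ faceStratum T τ ↔ x ∈ faceStratum T τ := by
  rw [mem_faceStratum hP, mem_faceStratum hP,
    map_mem_closure_faceOrbit_iff e hfg hgen hP hact hτ hφ]
  refine and_congr_right fun _ => forall_congr' fun γ => forall_congr' fun hγ => ?_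
  rw [map_mem_closure_faceOrbit_iff e hfg hgen hP hact hγ hφ]

/-- The root subgroups move each point of the stratum of `τ` into `O_τ`. -/
theorem exists_map_mem_faceOrbit_of_mem_faceStratum (hfg : P.FG)
    (hgen : AddSubgroup.closure (P : Set (Fin n → ℤ)) = ⊤)
    (hP : (P : Set (Fin n → ℤ)) = T.weightMonoid)
    (hact : ∀ t (m : P), T.act t (monomial e m) = character (m : Fin n → ℤ) t • monomial e m)
    {τ : PointedCone ℚ (Fin n → ℚ)} (hτ : IsRootFreeFace (P : Set (Fin n → ℤ)) τ)
    {x : Points K A} (hx : x ∈ faceStratum T τ) :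
    ∃ φ ∈ rootSubgroup e, x.map φ ∈ T.faceOrbit τ := by
  obtain ⟨φ, hφ, τ', hτ', hx'⟩ := exists_map_mem_faceOrbit e hfg hgen hP hact x
  have hφ0 := rootSubgroup_subset_aut0 e hact hφ
  have h1 := (map_mem_faceStratum_iff e hfg hgen hP hact hτ hφ0).2 hx
  rw [mem_faceStratum hP] at h1
  have hle : τ' ≤ τ := le_of_mem_closure_faceOrbit e hP hact hτ'.1 hτ.1 hx' h1.1
  have heq : τ' = τ := hle.eq_of_not_lt fun hlt => h1.2 τ' hτ' hlt (subset_closure hx')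
  exact ⟨φ, hφ, heq ▸ hx'⟩

/-- The strata are the orbits of `Aut(X)^0`. -/
theorem aut0Orbit_eq_faceStratum (hfg : P.FG)
    (hgen : AddSubgroup.closure (P : Set (Fin n → ℤ)) = ⊤)
    (hP : (P : Set (Fin n → ℤ)) = T.weightMonoid)
    (hact : ∀ t (m : P), T.act t (monomial e m) = character (m : Fin n → ℤ) t • monomial e m)
    {τ : PointedCone ℚ (Fin n → ℚ)} (hτ : IsRootFreeFace (P : Set (Fin n → ℤ)) τ)
    {x : Points K A} (hx : x ∈ faceStratum T τ) : aut0Orbit x = faceStratum T τ := by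
  refine Set.Subset.antisymm ?_ fun y hy => ?_
  · rintro _ ⟨φ, hφ, rfl⟩
    exact (map_mem_faceStratum_iff e hfg hgen hP hact hτ hφ).2 hx
  · obtain ⟨φ, hφ, hx'⟩ := exists_map_mem_faceOrbit_of_mem_faceStratum e hfg hgen hP hact hτ hx
    obtain ⟨ψ, hψ, hy'⟩ := exists_map_mem_faceOrbit_of_mem_faceStratum e hfg hgen hP hact hτ hy
    obtain ⟨t, ht⟩ := exists_eq_map_act e hP hact hx' hy'
    obtain ⟨H, hH, htH, hroot⟩ := exists_subgroup_subset_aut0 e T hact t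
    have hle : rootSubgroup e ≤ H := (Subgroup.closure_le _).2 (by
      rintro _ ⟨p, ε, hε, rfl⟩
      exact hroot p ε hε)
    refine ⟨φ * T.act t * ψ⁻¹, hH (mul_mem (mul_mem (hle hφ) htH) (inv_mem (hle hψ))), ?_⟩
    have h1 : (y.map ψ).map ψ⁻¹ = y.map (ψ * ψ⁻¹) := rfl
    have h2 : ((x.map φ).map (T.act t)).map ψ⁻¹ = x.map (φ * T.act t * ψ⁻¹) := rfl
    rw [← h2, ← ht, h1, mul_inv_cancel]
    rfl

theorem exists_mem_faceStratum (hfg : P.FG)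
    (hgen : AddSubgroup.closure (P : Set (Fin n → ℤ)) = ⊤)
    (hP : (P : Set (Fin n → ℤ)) = T.weightMonoid)
    (hact : ∀ t (m : P), T.act t (monomial e m) = character (m : Fin n → ℤ) t • monomial e m)
    (x : Points K A) :
    ∃ τ, IsRootFreeFace (P : Set (Fin n → ℤ)) τ ∧ x ∈ faceStratum T τ := by
  obtain ⟨φ, hφ, τ, hτ, hx⟩ := exists_map_mem_faceOrbit e hfg hgen hP hact x
  exact ⟨τ, hτ, (map_mem_faceStratum_iff e hfg hgen hP hact hτ
    (rootSubgroup_subset_aut0 e hact hφ)).1 (faceOrbit_subset_faceStratum e hP hact hτ.1 hx)⟩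

end Aut

theorem closure_faceStratum [CharZero K] (hP : (P : Set (Fin n → ℤ)) = T.weightMonoid)
    (hact : ∀ t (m : P), T.act t (monomial e m) = character (m : Fin n → ℤ) t • monomial e m)
    {τ : PointedCone ℚ (Fin n → ℚ)} (hτ : τ.IsFaceOf (weightCone (P : Set (Fin n → ℤ)))) :
    closure (faceStratum T τ) = closure (T.faceOrbit τ) :=
  Set.Subset.antisymm (closure_minimal Set.sdiff_subset isClosed_closure)
    (closure_mono (faceOrbit_subset_faceStratum e hP hact hτ))

end NeutralComponent

end ToricOrbits

theorem corollary6 {K A : Type u} [Field K] [IsAlgClosed K] [CharZero K]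
    [CommRing A] [IsDomain A] [Algebra K A] [Algebra.FiniteType K A]
    {n : ℕ} (T : ToricOrbits.TorusAction K A n) (hT : T.IsToric) :
    -- the closures of the `Aut(X)^0`-orbits are the sets `closure O_τ` for the faces `τ` of
    -- `σ^∨` without admissible `τ`-roots
    (∀ Z : Set (ToricOrbits.Points K A),
      (∃ x, Z = closure (ToricOrbits.aut0Orbit x)) ↔
        ∃ τ, ToricOrbits.IsRootFreeFace T.weightMonoid τ ∧ Z = closure (T.faceOrbit τ)) ∧
    -- the `Aut(X)^0`-orbits are these closures with the smaller closures of this kind removed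
    (∀ Y : Set (ToricOrbits.Points K A),
      (∃ x, Y = ToricOrbits.aut0Orbit x) ↔
        ∃ τ, ToricOrbits.IsRootFreeFace T.weightMonoid τ ∧
          Y = closure (T.faceOrbit τ) \
            ⋃ γ ∈ {γ | ToricOrbits.IsRootFreeFace T.weightMonoid γ ∧ γ < τ},
              closure (T.faceOrbit γ)) := by
  obtain ⟨P, e, hP, hfg, hgen, hact⟩ := hT.exists_monoidAlgebra_equiv
  have horbit : ∀ Y : Set (ToricOrbits.Points K A), (∃ x, Y = ToricOrbits.aut0Orbit x) ↔
      ∃ τ, ToricOrbits.IsRootFreeFace T.weightMonoid τ ∧ Y = ToricOrbits.faceStratum T τ := by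
    rw [← hP]
    refine fun Y => ⟨?_, ?_⟩
    · rintro ⟨x, rfl⟩
      obtain ⟨τ, hτ, hx⟩ := ToricOrbits.exists_mem_faceStratum e hfg hgen hP hact x
      exact ⟨τ, hτ, ToricOrbits.aut0Orbit_eq_faceStratum e hfg hgen hP hact hτ hx⟩
    · rintro ⟨τ, hτ, rfl⟩
      obtain ⟨x, hx⟩ := ToricOrbits.nonempty_faceOrbit e hP hact hτ.1
      exact ⟨x, (ToricOrbits.aut0Orbit_eq_faceStratum e hfg hgen hP hact hτ
        (ToricOrbits.faceOrbit_subset_faceStratum e hP hact hτ.1 hx)).symm⟩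
  have hcl : ∀ τ, ToricOrbits.IsRootFreeFace T.weightMonoid τ →
      closure (ToricOrbits.faceStratum T τ) = closure (T.faceOrbit τ) := fun τ hτ =>
    ToricOrbits.closure_faceStratum e hP hact (hP ▸ hτ.1)
  refine ⟨fun Z => ⟨?_, ?_⟩, horbit⟩
  · rintro ⟨x, rfl⟩
    obtain ⟨τ, hτ, h⟩ := (horbit _).1 ⟨x, rfl⟩
    exact ⟨τ, hτ, by rw [h, hcl τ hτ]⟩
  · rintro ⟨τ, hτ, rfl⟩
    obtain ⟨x, h⟩ := (horbit _).2 ⟨τ, hτ, rfl⟩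
    exact ⟨x, by rw [← h, hcl τ hτ]⟩
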